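/- Let $d\in\{2,3\}$, let $\Omega=\mathbb R^d$ or $\Omega=\mathbb T^d$, and fix $s>d/2$. For functions $F,G$ of the velocity $v\in\mathbb R^d$ define the hard-sphere collision operator $$Q(F,G)=\tfrac12\big(Q^+(F,G)-Q^-(F,G)+Q^+(G,F)-Q^-(G,F)\big),$$ $$Q^+(F,G)(v)=\int_{\mathbb R^d}\int_{\mathbb S^{d-1}}|v-v_*|\,F(v')\,G(v_*')\,d\sigma\,dv_*,\qquad Q^-(F,G)(v)=\int_{\mathbb R^d}\int_{\mathbb S^{d-1}}|v-v_*|\,F(v)\,G(v_*)\,d\sigma\,dv_*,$$ $$v'=\tfrac{v+v_*}2+\tfrac{|v-v_*|}2\sigma,\qquad v_*'=\tfrac{v+v_*}2-\tfrac{|v-v_*|}2\sigma ;$$ for functions $f,g$ of $(x,v)\in\Omega\times\mathbb R^d$ the variable $x$ is a parameter, i.e. $Q(f,g)(x,\cdot)=Q(f(x,\cdot),g(x,\cdot))$. Let $\langle v\rangle=\sqrt{1+|v|^2}$, $M(v)=(2\pi)^{-d/2}e^{-|v|^2/2}$, $\nu(v)=\int_{\mathbb R^d}M(v_*)|v-v_*|\,dv_*$.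 For $p\in[1,\infty]$ and $\alpha>0$ define, for real-valued measurable $f=f(x,v)$, $$\|f\|_{\mathcal E^{p,\alpha}}=\big\|f\langle v\rangle^\alpha\big\|_{L^p_vH^s_x},\qquad \|f\|_{\mathcal E^{p,\alpha}_\nu}=\big\|f\,\nu^{1/p}\big\|_{\mathcal E^{p,\alpha}}\qquad(\nu^{1/\infty}=1).$$ Let $p\in[1,\infty]$ with conjugate exponent $p'$ ($1/p+1/p'=1$), and let $\alpha>\alpha_Q(p):=2+d/p'$. There is a constant $C>0$, depending only on $p$ and $\alpha$ (and on the fixed $d,s,\Omega$), such that for all real-valued measurable $f,g$ for which the norms $\|\cdot\|_{\mathcal E^{p,\alpha}}$ and $\|\cdot\|_{\mathcal E^{p,\alpha}_\nu}$ are finite, the integrals defining $Q(f,g)(x,v)$ converge absolutely for almost every $(x,v)$, $Q(f,g)$ is measurable, and $$\|Q(f,g)\|_{\mathcal E^{p,\alpha-1/p'}}\le C\big(\|f\|_{\mathcal E^{p,\alpha}}\|g\|_{\mathcal E^{p,\alpha}_\nu}+\|f\|_{\mathcal E^{p,\alpha}_\nu}\|g\|_{\mathcal E^{p,\alpha}}\big).$$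 If moreover $p<\infty$, then, with the same $C$, for every real-valued measurable $h$ with $\|h\|_{\mathcal E^{p,\alpha}}$ and $\|h\|_{\mathcal E^{p,\alpha}_\nu}$ finite, the following integrand (read as $0$ where $\|h(\cdot,v)\|_{H^s_x}=0$) is integrable and $$\int_{\mathbb R^d}\big\langle Q(f,g),h\big\rangle_{H^s_x}\,\|h\|_{H^s_x}^{p-2}\,\langle v\rangle^{p\alpha}\,dv\le C\big(\|f\|_{\mathcal E^{p,\alpha}}\|g\|_{\mathcal E^{p,\alpha}_\nu}+\|f\|_{\mathcal E^{p,\alpha}_\nu}\|g\|_{\mathcal E^{p,\alpha}}\big)\,\|h\|_{\mathcal E^{p,\alpha}_\nu}^{p-1}.$$ -/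

import Mathlib

open MeasureTheory
open scoped ENNReal FourierTransform

noncomputable section

/-- The spatial domain: the whole space `ℝ^d` or the torus `𝕋^d`. -/
inductive SpatialDomain where
  | wholeSpace
  | torus

namespace SpatialDomain

/-- The points of the spatial domain: `ℝ^d`, or `𝕋^d = (ℝ/ℤ)^d`. -/
abbrev Pt (d : ℕ) : SpatialDomain → Type
  | wholeSpace => EuclideanSpace ℝ (Fin d)
  | torus => UnitAddTorus (Fin d)

instance instMeasurableSpacePt (d : ℕ) : (Ω : SpatialDomain) → MeasurableSpace (Ω.Pt d)
  | wholeSpace => inferInstanceAs (MeasurableSpace (EuclideanSpace ℝ (Fin d)))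
  | torus => inferInstanceAs (MeasurableSpace (Fin d → UnitAddCircle))

/-- Lebesgue measure on `ℝ^d`, normalized Haar measure on `𝕋^d`. -/
abbrev vol (d : ℕ) : (Ω : SpatialDomain) → Measure (Ω.Pt d)
  | wholeSpace => (volume : Measure (EuclideanSpace ℝ (Fin d)))
  | torus => (Measure.pi fun _ : Fin d => (AddCircle.haarAddCircle : Measure UnitAddCircle))

/-- The Fourier variable: `ℝ^d`, or `ℤ^d`. -/
abbrev Freq (d : ℕ) : SpatialDomain → Type
  | wholeSpace => EuclideanSpace ℝ (Fin d)
  | torus => Fin d → ℤ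

instance instMeasurableSpaceFreq (d : ℕ) : (Ω : SpatialDomain) → MeasurableSpace (Ω.Freq d)
  | wholeSpace => inferInstanceAs (MeasurableSpace (EuclideanSpace ℝ (Fin d)))
  | torus => inferInstanceAs (MeasurableSpace (Fin d → ℤ))

/-- Lebesgue measure on the frequencies `ℝ^d`, counting measure on the frequencies `ℤ^d`. -/
abbrev freqVol (d : ℕ) : (Ω : SpatialDomain) → Measure (Ω.Freq d)
  | wholeSpace => (volume : Measure (EuclideanSpace ℝ (Fin d)))
  | torus => (Measure.count : Measure (Fin d → ℤ))

/-- The squared Euclidean length `|ξ|²` of a frequency. -/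
def freqSq (d : ℕ) : (Ω : SpatialDomain) → Ω.Freq d → ℝ
  | wholeSpace => fun ξ : EuclideanSpace ℝ (Fin d) => ‖ξ‖ ^ 2
  | torus => fun n : Fin d → ℤ => ∑ i, (n i : ℝ) ^ 2

open Classical in
/-- The Fourier transform in `x` of a square-integrable function, for the characters
`x ↦ exp (2πi x·ξ)`: the Fourier–Plancherel transform on `ℝ^d` (zero by convention when `u` is not
square-integrable), the Fourier coefficients on `𝕋^d`. -/
def fourier (d : ℕ) : (Ω : SpatialDomain) → (Ω.Pt d → ℝ) → Ω.Freq d → ℂ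
  | wholeSpace => fun (u : EuclideanSpace ℝ (Fin d) → ℝ) =>
      if hu : MemLp (fun x => (u x : ℂ)) 2 (volume : Measure (EuclideanSpace ℝ (Fin d))) then
        ⇑(𝓕 (hu.toLp (fun x => (u x : ℂ))) :
          Lp ℂ 2 (volume : Measure (EuclideanSpace ℝ (Fin d))))
      else 0
  | torus => fun (u : UnitAddTorus (Fin d) → ℝ) =>
      UnitAddTorus.mFourierCoeff (fun x => (u x : ℂ))

/-- The symbol `(1 + |2πξ|²)^s` of `(1 - Δ)^s`. -/
def besselWeight (d : ℕ) (Ω : SpatialDomain) (s : ℝ) (ξ : Ω.Freq d) : ℝ :=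
  (1 + (2 * Real.pi) ^ 2 * Ω.freqSq d ξ) ^ s

open Classical in
/-- The norm `‖u‖_{H^s_x}`, with value `∞` when `u` does not belong to `H^s_x` (`s ≥ 0`). -/
def hsNorm (d : ℕ) (Ω : SpatialDomain) (s : ℝ) (u : Ω.Pt d → ℝ) : ℝ≥0∞ :=
  if MemLp u 2 (Ω.vol d) then
    (∫⁻ ξ, ENNReal.ofReal (Ω.besselWeight d s ξ) * ‖Ω.fourier d u ξ‖ₑ ^ 2 ∂(Ω.freqVol d))
      ^ (1 / 2 : ℝ)
  else ∞

/-- The inner product `⟨u, w⟩_{H^s_x}` of two real-valued functions of `H^s_x`. -/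
def hsInner (d : ℕ) (Ω : SpatialDomain) (s : ℝ) (u w : Ω.Pt d → ℝ) : ℝ :=
  ∫ ξ, Ω.besselWeight d s ξ * (Ω.fourier d u ξ * starRingEnd ℂ (Ω.fourier d w ξ)).re
    ∂(Ω.freqVol d)

end SpatialDomain

namespace Boltzmann

/-- The velocity space `ℝ^d`. -/
abbrev Vel (d : ℕ) : Type := EuclideanSpace ℝ (Fin d)

/-- The unit sphere `𝕊^{d-1}`. -/
abbrev Sph (d : ℕ) : Type := Metric.sphere (0 : Vel d) 1

/-- The product of Lebesgue measure `dv_*` and of the surface measure `dσ` on the sphere. -/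
def collMeasure (d : ℕ) : Measure (Vel d × Sph d) :=
  (volume : Measure (Vel d)).prod (volume : Measure (Vel d)).toSphere

/-- The pre-collisional velocity `v' = (v + v_*)/2 + |v - v_*| σ / 2`. -/
def vPre {d : ℕ} (v vs : Vel d) (σ : Sph d) : Vel d :=
  (1 / 2 : ℝ) • (v + vs) + (‖v - vs‖ / 2) • (σ : Vel d)

/-- The pre-collisional velocity `v_*' = (v + v_*)/2 - |v - v_*| σ / 2`. -/
def vsPre {d : ℕ} (v vs : Vel d) (σ : Sph d) : Vel d :=
  (1 / 2 : ℝ) • (v + vs) - (‖v - vs‖ / 2) • (σ : Vel d)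

/-- The integrand `|v - v_*| F' G_*'` of the gain part, as a function of `(v_*, σ)`. -/
def gainIntegrand {d : ℕ} (F G : Vel d → ℝ) (v : Vel d) (z : Vel d × Sph d) : ℝ :=
  ‖v - z.1‖ * (F (vPre v z.1 z.2) * G (vsPre v z.1 z.2))

/-- The integrand `|v - v_*| F G_*` of the loss part, as a function of `(v_*, σ)`. -/
def lossIntegrand {d : ℕ} (F G : Vel d → ℝ) (v : Vel d) (z : Vel d × Sph d) : ℝ :=
  ‖v - z.1‖ * (F v * G z.1)

/-- The gain part `Q⁺(F, G)`. -/
def Qgain {d : ℕ} (F G : Vel d → ℝ) (v : Vel d) : ℝ :=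
  ∫ z, gainIntegrand F G v z ∂(collMeasure d)

/-- The loss part `Q⁻(F, G)`. -/
def Qloss {d : ℕ} (F G : Vel d → ℝ) (v : Vel d) : ℝ :=
  ∫ z, lossIntegrand F G v z ∂(collMeasure d)

/-- The (symmetrized) hard-sphere collision operator on functions of the velocity. -/
def Qvel {d : ℕ} (F G : Vel d → ℝ) (v : Vel d) : ℝ :=
  (1 / 2) * (Qgain F G v - Qloss F G v + Qgain G F v - Qloss G F v)

/-- The collision operator on functions of `(x, v)`; it acts on the velocity, `x` is a parameter. -/
def Q {d : ℕ} {X : Type} (f g : X → Vel d → ℝ) (x : X) (v : Vel d) : ℝ :=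
  Qvel (f x) (g x) v

/-- All four integrals defining `Q(F, G)(v)` converge absolutely. -/
def QConverges {d : ℕ} (F G : Vel d → ℝ) (v : Vel d) : Prop :=
  Integrable (gainIntegrand F G v) (collMeasure d) ∧
  Integrable (lossIntegrand F G v) (collMeasure d) ∧
  Integrable (gainIntegrand G F v) (collMeasure d) ∧
  Integrable (lossIntegrand G F v) (collMeasure d)

/-- The bracket `⟨v⟩ = √(1 + |v|²)`. -/
def bracket {d : ℕ} (v : Vel d) : ℝ := Real.sqrt (1 + ‖v‖ ^ 2)

/-- The normal centered distribution `M(v) = (2π)^{-d/2} exp (-|v|²/2)`. -/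
def maxwellian {d : ℕ} (v : Vel d) : ℝ :=
  (2 * Real.pi) ^ (-(d : ℝ) / 2) * Real.exp (-‖v‖ ^ 2 / 2)

/-- The collision frequency `ν(v) = ∫ M(v_*) |v - v_*| dv_*`. -/
def collFreq {d : ℕ} (v : Vel d) : ℝ := ∫ vs : Vel d, maxwellian vs * ‖v - vs‖

/-- The norm of `L^p_v H^s_x` (no weight). -/
def lpHsNorm (d : ℕ) (Ω : SpatialDomain) (s : ℝ) (p : ℝ≥0∞) (f : Ω.Pt d → Vel d → ℝ) : ℝ≥0∞ :=
  eLpNorm (fun v : Vel d => Ω.hsNorm d s (fun x => f x v)) p volume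

/-- The norm `‖f ⟨v⟩^α‖_{L^p_v H^s_x}`. -/
def polyNorm (d : ℕ) (Ω : SpatialDomain) (s : ℝ) (p : ℝ≥0∞) (α : ℝ)
    (f : Ω.Pt d → Vel d → ℝ) : ℝ≥0∞ :=
  lpHsNorm d Ω s p (fun x v => f x v * bracket v ^ α)

/-- The norm `‖f ν^{1/p}‖` with respect to `polyNorm` (where `1/∞ = 0`). -/
def polyNormNu (d : ℕ) (Ω : SpatialDomain) (s : ℝ) (p : ℝ≥0∞) (α : ℝ)
    (f : Ω.Pt d → Vel d → ℝ) : ℝ≥0∞ :=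
  polyNorm d Ω s p α (fun x v => f x v * collFreq v ^ (p⁻¹).toReal)

/-- Joint (a.e. strong) measurability in `(x, v)`. -/
def JointlyMeasurable (d : ℕ) (Ω : SpatialDomain) (f : Ω.Pt d → Vel d → ℝ) : Prop :=
  AEStronglyMeasurable (Function.uncurry f) ((Ω.vol d).prod volume)

/-- `f` is measurable with finite norms `polyNorm` and `polyNormNu`. -/
def MemPolyNu (d : ℕ) (Ω : SpatialDomain) (s : ℝ) (p : ℝ≥0∞) (α : ℝ)
    (f : Ω.Pt d → Vel d → ℝ) : Prop :=
  JointlyMeasurable d Ω f ∧ polyNorm d Ω s p α f < ∞ ∧ polyNormNu d Ω s p α f < ∞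

/-- The integrand `⟨q, h⟩_{H^s_x} ‖h‖_{H^s_x}^{p-2} ⟨v⟩^{pα}` at the velocity `v`. It vanishes where
`‖h‖_{H^s_x} = 0`. -/
def dualIntegrand (d : ℕ) (Ω : SpatialDomain) (s : ℝ) (p : ℝ≥0∞) (α : ℝ)
    (q h : Ω.Pt d → Vel d → ℝ) (v : Vel d) : ℝ :=
  Ω.hsInner d s (fun x => q x v) (fun x => h x v)
    * (Ω.hsNorm d s (fun x => h x v)).toReal ^ (p.toReal - 2) * bracket v ^ (p.toReal * α)

end Boltzmann

end

/-! The estimate is reduced to one for nonnegative functions of the velocity alone. For s > d/2 the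
space H^s_x is an algebra, and its norm is a countable supremum of moduli of L² pairings, so that
norms pass under integrals (`IsDualNorm.integral_le`). Hence the H^s_x norm of each gain or loss
integral at v is at most a constant times the scalar integral `collInt` of φ = ‖f(·,v)‖ and ψ =
‖g(·,v)‖.

Gain and loss are treated together, as integrals along a map T sending (v, v_*, σ) to (v', v_*') or
to (v, v_*). Two properties of T carry the proof (`IsCollisionMap`). The first is the change of
variables: the integral of H ∘ T is |𝕊^{d-1}| times the integral of H, and T preserves the relative
speed. The second is the kernel bound: for β > d + 1, the integral of |v - v_*| times the weights
⟨·⟩^{-β} at both components of T is O(⟨v⟩^{1-β}). Hölder's inequality for the measure |v - v_*| dσ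
dv_* with β = αp' bounds the p-th power of `collInt` pointwise by the `collInt` of the p-th powers
of φ⟨v⟩^α and ψ⟨v⟩^α. Integration in v, the change of variables and |v - v_*| ≤ ⟨v⟩ + ⟨v_*⟩ then
give `eLpNorm_collInt_le`; the extra ⟨v⟩ becomes ν because ν ≥ c⟨v⟩.

The delicate point is the kernel bound for the gain. By energy conservation v' and v_*' cannot both
be small compared with ⟨v⟩ + |v - v_*|, so one weight is bounded at once. The other is cut
dyadically into balls of radius R. With v - v_* = ρω one has v' = v - (ρ/2)(ω - σ). If this lies in
the ball and |v| is large compared with R, then ω - σ is almost parallel to v, and σ lies in a cap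
of radius O(R/|v|) about the reflection of ω in the hyperplane orthogonal to v. The cap and the
range of ρ give R^d ⟨v⟩^{1-β}, summable against R^{-β}.

The dual bound follows from the norm bound by the Cauchy–Schwarz inequality in H^s_x and Hölder's
inequality in v. -/

noncomputable section

/-! ### Polar coordinates and the collisional change of variables. -/

namespace Boltzmann

open Set Metric

variable {d : ℕ}

/-- The total mass of the surface measure of the unit sphere. -/
def sphereMass (d : ℕ) : ℝ≥0∞ := (volume : Measure (Vel d)).toSphere univ

lemma sphereMass_lt_top : sphereMass d < ∞ := measure_lt_top _ _

instance : SFinite (collMeasure d) := by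
  have : SFinite (volume : Measure (Vel d)).toSphere := inferInstance
  exact Measure.prod.instSFinite

/-- The origin is a null set because d > 0, and off it `homeomorphUnitSphereProd` carries Lebesgue
measure to the product of the surface measure and ρ^{d-1} dρ. -/
lemma lintegral_polar (hd : 0 < d) (f : Vel d → ℝ≥0∞) (hf : Measurable f) :
    ∫⁻ x, f x = ∫⁻ ω : Sph d, (∫⁻ ρ in Ioi (0 : ℝ), ENNReal.ofReal (ρ ^ (d - 1)) *
      f (ρ • (ω : Vel d))) ∂(volume : Measure (Vel d)).toSphere := by
  have : Nonempty (Fin d) := ⟨⟨0, hd⟩⟩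
  have hmp := (volume : Measure (Vel d)).measurePreserving_homeomorphUnitSphereProd
  have hm : Measurable (fun z : Sph d × Ioi (0 : ℝ) => f ((z.2 : ℝ) • (z.1 : Vel d))) :=
    hf.comp (by fun_prop)
  have h1 : ∫⁻ x, f x = ∫⁻ x : ({(0 : Vel d)}ᶜ : Set (Vel d)), f x
      ∂((volume : Measure (Vel d)).comap Subtype.val) := by
    rw [lintegral_subtype_comap (measurableSet_singleton _).compl, restrict_compl_singleton]
  have h2 := hmp.lintegral_comp hm
  rw [lintegral_prod _ hm.aemeasurable] at h2
  rw [h1]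
  convert h2 using 1
  · refine lintegral_congr fun x => ?_
    congr 1
    exact congrArg Subtype.val ((homeomorphUnitSphereProd (Vel d)).symm_apply_apply x).symm
  · refine lintegral_congr fun ω => ?_
    have hw : Measurable fun r : Ioi (0 : ℝ) =>
        ENNReal.ofReal ((r : ℝ) ^ (Module.finrank ℝ (Vel d) - 1)) := by fun_prop
    have hg : Measurable fun r : Ioi (0 : ℝ) => f ((r : ℝ) • (ω : Vel d)) :=
      hf.comp (by fun_prop)
    refine Eq.trans ?_ (lintegral_withDensity_eq_lintegral_mul _ hw hg).symm
    simp only [finrank_euclideanSpace, Fintype.card_fin, Pi.mul_apply]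
    exact (lintegral_subtype_comap measurableSet_Ioi fun ρ : ℝ => ENNReal.ofReal (ρ ^ (d - 1)) *
      f (ρ • (ω : Vel d))).symm

/-- Centre of mass c and relative velocity u; the substitution is composed of a reflected
translation in w and a translation in v, so no Jacobian appears. -/
lemma lintegral_lintegral_centre (G : Vel d → Vel d → ℝ≥0∞)
    (hG : Measurable (Function.uncurry G)) :
    ∫⁻ v, ∫⁻ w, G v w = ∫⁻ u, ∫⁻ c, G (c + (1 / 2 : ℝ) • u) (c - (1 / 2 : ℝ) • u) := by
  have h1 : ∀ v, ∫⁻ w, G v w = ∫⁻ u, G v (v - u) := fun v =>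
    (lintegral_sub_left_eq_self (fun w => G v w) v).symm
  simp_rw [h1]
  rw [lintegral_lintegral_swap]
  · refine lintegral_congr fun u => ?_
    rw [← lintegral_add_right_eq_self (fun v => G v (v - u)) ((1 / 2 : ℝ) • u)]
    refine lintegral_congr fun c => ?_
    congr 1
    module
  · refine Measurable.aemeasurable ?_
    exact hG.comp (f := fun z : Vel d × Vel d => (z.1, z.1 - z.2)) (by fun_prop)

lemma measurable_vPre : Measurable fun z : Vel d × Vel d × Sph d => vPre z.1 z.2.1 z.2.2 := by
  unfold vPre; fun_prop

lemma measurable_vsPre : Measurable fun z : Vel d × Vel d × Sph d => vsPre z.1 z.2.1 z.2.2 := by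
  unfold vsPre; fun_prop

/-- The collision map `(v, v_*, σ) ↦ (v', v_*')`. -/
def collMap (z : Vel d × Vel d × Sph d) : Vel d × Vel d :=
  (vPre z.1 z.2.1 z.2.2, vsPre z.1 z.2.1 z.2.2)

lemma measurable_collMap : Measurable (collMap (d := d)) :=
  measurable_vPre.prodMk measurable_vsPre

/-- A collision keeps c and |u| and turns the direction of u into σ. With u = ρω the integrand no
longer sees ω, whose integral yields the total mass of the sphere, while (ρ, σ) become the polar
coordinates of the new relative velocity. -/
lemma lintegral_collMap (hd : 0 < d) (H : Vel d × Vel d → ℝ≥0∞) (hH : Measurable H) :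
    ∫⁻ z, H (collMap z) ∂(volume.prod (collMeasure d)) =
      sphereMass d * ∫⁻ z, H z ∂((volume : Measure (Vel d)).prod volume) := by
  set S := (volume : Measure (Vel d)).toSphere
  have hHc : Measurable fun z => H (collMap z) := hH.comp measurable_collMap
  set h : Vel d → ℝ≥0∞ := fun y => ∫⁻ c, H (c + (1 / 2 : ℝ) • y, c - (1 / 2 : ℝ) • y) with hh
  have hmh : Measurable h := by
    refine Measurable.lintegral_prod_right' (f := fun z : Vel d × Vel d =>
      H (z.2 + (1 / 2 : ℝ) • z.1, z.2 - (1 / 2 : ℝ) • z.1)) ?_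
    exact hH.comp (by fun_prop)
  have e1 : ∫⁻ z, H (collMap z) ∂(volume.prod (collMeasure d)) =
      ∫⁻ v, ∫⁻ w, ∫⁻ σ, H (collMap (v, w, σ)) ∂S := by
    rw [lintegral_prod _ hHc.aemeasurable]
    refine lintegral_congr fun v => ?_
    rw [collMeasure, lintegral_prod]
    exact (hHc.comp measurable_prodMk_left).aemeasurable
  have hG : Measurable (Function.uncurry fun v w : Vel d => ∫⁻ σ, H (collMap (v, w, σ)) ∂S) := by
    refine Measurable.lintegral_prod_right' (f := fun z : (Vel d × Vel d) × Sph d =>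
      H (collMap (z.1.1, z.1.2, z.2))) ?_
    exact hHc.comp (by fun_prop)
  have e2 : ∀ u : Vel d, ∫⁻ c, ∫⁻ σ, H (collMap (c + (1 / 2 : ℝ) • u, c - (1 / 2 : ℝ) • u, σ)) ∂S
      = ∫⁻ σ : Sph d, h (‖u‖ • (σ : Vel d)) ∂S := by
    intro u
    rw [lintegral_lintegral_swap]
    · refine lintegral_congr fun σ => lintegral_congr fun c => ?_
      have hu : c + (1 / 2 : ℝ) • u - (c - (1 / 2 : ℝ) • u) = u := by module
      congr 1
      simp only [collMap, vPre, vsPre, hu, Prod.mk.injEq]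
      constructor <;> module
    · exact (hHc.comp (f := fun z : Vel d × Sph d => (z.1 + (1 / 2 : ℝ) • u,
        z.1 - (1 / 2 : ℝ) • u, z.2)) (by fun_prop)).aemeasurable
  have hk : Measurable fun u : Vel d => ∫⁻ σ : Sph d, h (‖u‖ • (σ : Vel d)) ∂S := by
    refine Measurable.lintegral_prod_right' (f := fun z : Vel d × Sph d =>
      h (‖z.1‖ • (z.2 : Vel d))) ?_
    exact hmh.comp (by fun_prop)
  have hprod : Measurable fun z : Sph d × ℝ => h (z.2 • (z.1 : Vel d)) :=
    hmh.comp (by fun_prop)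
  rw [e1, lintegral_lintegral_centre _ hG]
  simp_rw [e2]
  rw [lintegral_polar hd _ hk, lintegral_prod _ hH.aemeasurable,
    lintegral_lintegral_centre (fun v w => H (v, w)) hH]
  change _ = _ * ∫⁻ u, h u
  rw [lintegral_polar hd _ hmh]
  have e3 : ∀ ω : Sph d, (∫⁻ ρ in Ioi (0 : ℝ), ENNReal.ofReal (ρ ^ (d - 1)) *
      ∫⁻ σ : Sph d, h (‖ρ • (ω : Vel d)‖ • (σ : Vel d)) ∂S) =
      ∫⁻ σ : Sph d, (∫⁻ ρ in Ioi (0 : ℝ), ENNReal.ofReal (ρ ^ (d - 1)) * h (ρ • (σ : Vel d))) ∂S := by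
    intro ω
    rw [lintegral_lintegral_swap]
    · refine setLIntegral_congr_fun measurableSet_Ioi fun ρ hρ => ?_
      have hω : ‖(ω : Vel d)‖ = 1 := by simp
      have hρ' : ‖ρ • (ω : Vel d)‖ = ρ := by
        rw [norm_smul, hω, mul_one, Real.norm_of_nonneg (le_of_lt hρ)]
      simp only [hρ']
      rw [lintegral_const_mul]
      exact hprod.comp (measurable_prodMk_right)
    · refine Measurable.aemeasurable ?_
      refine Measurable.mul ?_ hprod
      fun_prop
  simp_rw [e3]
  rw [lintegral_const, mul_comm]
  rfl

end Boltzmann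

/-! ### Brackets, spherical caps and reflections. -/

namespace Boltzmann

open Set Metric

variable {d : ℕ}

lemma one_le_bracket (v : Vel d) : 1 ≤ bracket v := by
  rw [bracket, Real.one_le_sqrt]; nlinarith [sq_nonneg ‖v‖]

lemma bracket_pos (v : Vel d) : 0 < bracket v := one_pos.trans_le (one_le_bracket v)

lemma bracket_sq (v : Vel d) : bracket v ^ 2 = 1 + ‖v‖ ^ 2 :=
  Real.sq_sqrt (by positivity)

lemma norm_le_bracket (v : Vel d) : ‖v‖ ≤ bracket v :=
  Real.le_sqrt_of_sq_le (by linarith)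

lemma bracket_le_one_add_norm (v : Vel d) : bracket v ≤ 1 + ‖v‖ :=
  Real.sqrt_le_iff.2 ⟨by positivity, by nlinarith [norm_nonneg v]⟩

lemma measurable_bracket : Measurable (bracket (d := d)) := by
  unfold bracket; fun_prop

-- The surface measure of a set is d times the volume of the cone over it. The cone over a cap of
-- radius r about a lies within 2r of the points kra with k ≤ 1/r. This gives at most 2/r balls of
-- radius 2r, of total volume O(r^{d-1}).
open scoped Pointwise in
lemma toSphere_cap_le (d : ℕ) : ∃ C : ℝ≥0∞, C < ∞ ∧ ∀ a : Vel d, ‖a‖ ≤ 1 → ∀ r : ℝ, 0 < r →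
    r ≤ 1 → (volume : Measure (Vel d)).toSphere {σ | ‖(σ : Vel d) - a‖ < r} ≤
      C * ENNReal.ofReal (r ^ (d - 1)) := by
  rcases Nat.eq_zero_or_pos d with rfl | hd
  · refine ⟨0, by simp, fun a _ r _ _ => ?_⟩
    have : (volume : Measure (Vel 0)).toSphere = 0 := by
      rw [Measure.toSphere_eq_zero_iff_finrank]; simp
    simp [this]
  have : Nonempty (Fin d) := ⟨⟨0, hd⟩⟩
  refine ⟨d * (ENNReal.ofReal (2 ^ (d + 1)) * volume (ball (0 : Vel d) 1)),
    ENNReal.mul_lt_top (by simp) (ENNReal.mul_lt_top (by simp) measure_ball_lt_top), ?_⟩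
  intro a ha r hr hr1
  have hms : MeasurableSet {σ : Sph d | ‖(σ : Vel d) - a‖ < r} :=
    measurableSet_lt (by fun_prop) measurable_const
  rw [Measure.toSphere_apply' _ hms, finrank_euclideanSpace, Fintype.card_fin, mul_assoc]
  gcongr
  set n := ⌊1 / r⌋₊ with hn
  have hsub : Ioo (0 : ℝ) 1 • ((↑) '' {σ : Sph d | ‖(σ : Vel d) - a‖ < r}) ⊆
      ⋃ k ∈ Finset.range (n + 1), closedBall (((k : ℝ) * r) • a) (2 * r) := by
    rintro x ⟨t, ht, _, ⟨σ, hσ, rfl⟩, rfl⟩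
    have hk0 : 0 ≤ t / r := div_nonneg ht.1.le hr.le
    have hk1 := Nat.floor_le hk0
    have hk2 := Nat.lt_floor_add_one (t / r)
    rw [le_div_iff₀ hr] at hk1
    rw [div_lt_iff₀ hr] at hk2
    simp only [mem_iUnion, Finset.mem_range]
    refine ⟨⌊t / r⌋₊, Nat.lt_succ_of_le (Nat.floor_le_floor (by gcongr; exact ht.2.le)), ?_⟩
    rw [mem_closedBall, dist_eq_norm]
    have hsplit : t • (σ : Vel d) - ((⌊t / r⌋₊ : ℝ) * r) • a =
        t • ((σ : Vel d) - a) + (t - (⌊t / r⌋₊ : ℝ) * r) • a := by module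
    calc ‖t • (σ : Vel d) - ((⌊t / r⌋₊ : ℝ) * r) • a‖
        ≤ ‖t • ((σ : Vel d) - a)‖ + ‖(t - (⌊t / r⌋₊ : ℝ) * r) • a‖ := by
          rw [hsplit]; exact norm_add_le _ _
      _ ≤ 1 * r + r * 1 := by
          rw [norm_smul, norm_smul]
          gcongr
          · rw [Real.norm_of_nonneg ht.1.le]; exact ht.2.le
          · exact le_of_lt hσ
          · rw [Real.norm_of_nonneg (by linarith)]; linarith
      _ = 2 * r := by ring
  refine (measure_mono hsub).trans ((measure_biUnion_finset_le _ _).trans ?_)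
  have hball : ∀ k ∈ Finset.range (n + 1),
      volume (closedBall (((k : ℝ) * r) • a) (2 * r)) =
        ENNReal.ofReal ((2 * r) ^ d) * volume (ball (0 : Vel d) 1) := by
    intro k _
    rw [Measure.addHaar_closedBall _ _ (by positivity), finrank_euclideanSpace, Fintype.card_fin]
  rw [Finset.sum_congr rfl hball, Finset.sum_const, Finset.card_range, nsmul_eq_mul]
  have hn1 : (n + 1 : ℝ) ≤ 2 / r := by
    have : (n : ℝ) ≤ 1 / r := Nat.floor_le (by positivity)
    have : 1 ≤ 1 / r := (one_le_div hr).2 hr1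
    have : 2 / r = 1 / r + 1 / r := by ring
    linarith
  have hreal : (n + 1 : ℝ) * (2 * r) ^ d ≤ 2 ^ (d + 1) * r ^ (d - 1) := by
    obtain ⟨e, rfl⟩ := Nat.exists_eq_add_of_le' hd
    calc (n + 1 : ℝ) * (2 * r) ^ (e + 1) ≤ 2 / r * (2 * r) ^ (e + 1) := by gcongr
      _ = 2 ^ (e + 1 + 1) * r ^ (e + 1 - 1) := by
        rw [Nat.add_sub_cancel]; field_simp; ring
  calc ((n + 1 : ℕ) : ℝ≥0∞) * (ENNReal.ofReal ((2 * r) ^ d) * volume (ball (0 : Vel d) 1))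
      = ENNReal.ofReal ((n + 1 : ℝ) * (2 * r) ^ d) * volume (ball (0 : Vel d) 1) := by
        rw [ENNReal.ofReal_mul (by positivity), mul_assoc, ← ENNReal.ofReal_natCast]
        push_cast; rfl
    _ ≤ ENNReal.ofReal (2 ^ (d + 1) * r ^ (d - 1)) * volume (ball (0 : Vel d) 1) := by
        gcongr
    _ = _ := by
        rw [ENNReal.ofReal_mul (by positivity), mul_right_comm]

lemma lintegral_add_rpow_Ioi {a γ : ℝ} (ha : 0 < a) (hγ : γ < -1) :
    ∫⁻ ρ in Ioi (0 : ℝ), ENNReal.ofReal ((a + ρ) ^ γ) =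
      ENNReal.ofReal (a ^ (γ + 1) / (-(γ + 1))) := by
  have h1 := integral_Ioi_rpow_of_lt hγ ha
  have h2 := integrableOn_Ioi_rpow_of_lt hγ ha
  have h3 : ∫⁻ ρ in Ioi (0 : ℝ), ENNReal.ofReal ((a + ρ) ^ γ) =
      ∫⁻ ρ in Ioi a, ENNReal.ofReal (ρ ^ γ) := by
    rw [← lintegral_indicator measurableSet_Ioi, ← lintegral_indicator measurableSet_Ioi,
      ← lintegral_add_left_eq_self ((Ioi a).indicator fun ρ => ENNReal.ofReal (ρ ^ γ)) a]
    refine lintegral_congr fun ρ => ?_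
    simp [indicator]
  rw [h3, ← ofReal_integral_eq_lintegral_ofReal h2, h1, div_neg, neg_div]
  filter_upwards [ae_restrict_mem measurableSet_Ioi] with ρ hρ
  exact Real.rpow_nonneg (ha.trans hρ).le _

/-- Since w and w - z are unit vectors, ‖z‖ = 2⟨w, n⟩ with n = z/‖z‖, so w - z is the reflection of
w in the hyperplane orthogonal to n. The closeness of (ρ/2)z to v puts n within 2R/‖v‖ of e = v/‖v‖,
and replacing n by e moves the reflection of w by at most 4‖e - n‖. -/
lemma norm_sub_reflection_lt {v w z : Vel d} {ρ R : ℝ} (hv : 0 < ‖v‖) (hρ : 0 < ρ)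
    (hz : z ≠ 0) (hw : ‖w‖ = 1) (hwz : ‖w - z‖ = 1) (h : ‖v - (ρ / 2) • z‖ < R) :
    ‖w - z - (w - (2 * inner ℝ w (‖v‖⁻¹ • v)) • (‖v‖⁻¹ • v))‖ < 8 * R / ‖v‖ := by
  set e := ‖v‖⁻¹ • v with he
  set n := ‖z‖⁻¹ • z with hn
  have hzn : 0 < ‖z‖ := norm_pos_iff.2 hz
  have he1 : ‖e‖ = 1 := by rw [he, norm_smul, norm_inv, norm_norm, inv_mul_cancel₀ hv.ne']
  have hn1 : ‖n‖ = 1 := by rw [hn, norm_smul, norm_inv, norm_norm, inv_mul_cancel₀ hzn.ne']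
  have hve : v = ‖v‖ • e := by rw [he, smul_smul, mul_inv_cancel₀ hv.ne', one_smul]
  have hzn' : z = ‖z‖ • n := by rw [hn, smul_smul, mul_inv_cancel₀ hzn.ne', one_smul]
  have hin : ‖z‖ = 2 * inner ℝ w n := by
    have h1 : ‖w - z‖ ^ 2 = ‖w‖ ^ 2 - 2 * inner ℝ w z + ‖z‖ ^ 2 := norm_sub_sq_real w z
    have h2 : inner ℝ w z = ‖z‖ * inner ℝ w n := by
      conv_lhs => rw [hzn', inner_smul_right]
    rw [hw, hwz, h2] at h1
    have : ‖z‖ * (‖z‖ - 2 * inner ℝ w n) = 0 := by linarith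
    rcases mul_eq_zero.1 this with h3 | h3
    · exact absurd h3 hzn.ne'
    · linarith
  have hen : ‖e - n‖ < 2 * R / ‖v‖ := by
    rw [lt_div_iff₀ hv]
    have h1 : ‖v‖ • (e - n) = (v - (ρ / 2) • z) + (ρ / 2 * ‖z‖ - ‖v‖) • n := by
      conv_rhs => rw [hzn']
      rw [smul_smul, smul_sub, ← hve, norm_smul, hn1, norm_norm, mul_one]
      module
    have h2 : |ρ / 2 * ‖z‖ - ‖v‖| ≤ ‖v - (ρ / 2) • z‖ := by
      have := abs_norm_sub_norm_le ((ρ / 2) • z) v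
      rwa [norm_smul, Real.norm_of_nonneg (by positivity), norm_sub_rev] at this
    calc ‖e - n‖ * ‖v‖ = ‖‖v‖ • (e - n)‖ := by rw [norm_smul, norm_norm, mul_comm]
      _ ≤ ‖v - (ρ / 2) • z‖ + |ρ / 2 * ‖z‖ - ‖v‖| := by
        rw [h1]
        refine (norm_add_le _ _).trans ?_
        rw [norm_smul, hn1, mul_one, Real.norm_eq_abs]
      _ < 2 * R := by linarith
  have hsplit : w - z - (w - (2 * inner ℝ w e) • e) =
      (2 * inner ℝ w (e - n)) • e + (2 * inner ℝ w n) • (e - n) := by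
    conv_lhs => rw [hzn', hin]
    rw [inner_sub_right]
    module
  calc ‖w - z - (w - (2 * inner ℝ w e) • e)‖ ≤ 4 * ‖e - n‖ := by
        rw [hsplit]
        refine (norm_add_le _ _).trans ?_
        clear_value e n
        rw [norm_smul, norm_smul, he1, norm_mul, norm_mul]
        have h1 := norm_inner_le_norm (𝕜 := ℝ) w (e - n)
        have h2 := norm_inner_le_norm (𝕜 := ℝ) w n
        rw [hw, one_mul] at h1 h2
        rw [hn1] at h2
        have h3 : ‖inner ℝ w n‖ * ‖e - n‖ ≤ 1 * ‖e - n‖ := by gcongr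
        norm_num at *
        nlinarith
    _ < 4 * (2 * R / ‖v‖) := by linarith
    _ = 8 * R / ‖v‖ := by ring

end Boltzmann

/-! ### The gain integral restricted to one ball. -/

namespace Boltzmann

open Set Metric

variable {d : ℕ}

/-- The density `ρ^d (a + ρ)^{-β}` restricted to those `ρ` for which `v - (ρ/2) z` lies in the ball
of radius `R`. -/
def slabDensity (β R a : ℝ) (v z : Vel d) (ρ : ℝ) : ℝ≥0∞ :=
  ENNReal.ofReal (ρ ^ d * (a + ρ) ^ (-β)) *
    (ball (0 : Vel d) R).indicator 1 (v - (ρ / 2) • z)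

lemma measurable_slabDensity (β R a : ℝ) (v : Vel d) :
    Measurable fun q : Vel d × ℝ => slabDensity β R a v q.1 q.2 := by
  unfold slabDensity
  refine Measurable.mul (by fun_prop) ?_
  exact (measurable_one.indicator measurableSet_ball).comp (by fun_prop)

lemma pow_mul_rpow_le {a ρ β : ℝ} (ha : 0 < a) (hρ : 0 < ρ) :
    ρ ^ d * (a + ρ) ^ (-β) ≤ (a + ρ) ^ ((d : ℝ) - β) := by
  rw [sub_eq_add_neg, Real.rpow_add (by positivity), Real.rpow_natCast]
  gcongr
  linarith

/-- The indicator is dropped: this crude bound serves when ‖v‖ is at most of order R. -/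
lemma lintegral_slabDensity_le_rpow {β R a : ℝ} (hβ : (d : ℝ) + 1 < β) (ha : 0 < a)
    (v z : Vel d) : ∫⁻ ρ in Ioi (0 : ℝ), slabDensity β R a v z ρ ≤
      ENNReal.ofReal (a ^ ((d : ℝ) + 1 - β) / (β - (d + 1))) := by
  have h := lintegral_add_rpow_Ioi (γ := (d : ℝ) - β) ha (by linarith)
  rw [show (d : ℝ) - β + 1 = d + 1 - β by ring, neg_sub] at h
  rw [← h]
  refine setLIntegral_mono' measurableSet_Ioi fun ρ hρ => ?_
  unfold slabDensity
  calc _ ≤ ENNReal.ofReal (ρ ^ d * (a + ρ) ^ (-β)) * 1 := by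
        gcongr
        exact indicator_le_self _ _ _
    _ ≤ _ := by
        rw [mul_one]
        exact ENNReal.ofReal_le_ofReal (pow_mul_rpow_le ha hρ)

/-- The indicator confines ρ to an interval of length 4R/‖z‖ on which ρ ≥ ‖v‖/‖z‖. The powers of ‖z‖
combine to ‖z‖^{β-d-1}, whose exponent is positive, so small z do no harm and ‖z‖ ≤ 2 is enough. -/
lemma lintegral_slabDensity_le {β R a : ℝ} (hβ : (d : ℝ) + 1 < β) (ha : 0 < a) (hR : 0 < R)
    {v z : Vel d} (hv : 2 * R ≤ ‖v‖) (hz : ‖z‖ ≤ 2) :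
    ∫⁻ ρ in Ioi (0 : ℝ), slabDensity β R a v z ρ ≤
      ENNReal.ofReal (4 * R * 2 ^ (β - d - 1) * ‖v‖ ^ ((d : ℝ) - β)) := by
  have hv0 : 0 < ‖v‖ := by linarith
  rcases eq_or_ne z 0 with rfl | hz0
  · have : ∀ ρ, slabDensity β R a v (0 : Vel d) ρ = 0 := by
      intro ρ
      have : v ∉ ball (0 : Vel d) R := by
        rw [mem_ball_zero_iff]; linarith
      simp [slabDensity, this]
    simp [this]
  have hzn : 0 < ‖z‖ := norm_pos_iff.2 hz0
  set I := Icc (2 * (‖v‖ - R) / ‖z‖) (2 * (‖v‖ + R) / ‖z‖) with hI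
  set M := (‖v‖ / ‖z‖) ^ ((d : ℝ) - β) with hM
  have hM0 : 0 ≤ M := by positivity
  have hpt : ∀ ρ ∈ Ioi (0 : ℝ), slabDensity β R a v z ρ ≤
      I.indicator (fun _ => ENNReal.ofReal M) ρ := by
    intro ρ hρ
    have hρ0 : 0 < ρ := hρ
    unfold slabDensity
    by_cases hb : v - (ρ / 2) • z ∈ ball (0 : Vel d) R
    · have hb' := mem_ball_zero_iff.1 hb
      have h2 : |ρ / 2 * ‖z‖ - ‖v‖| < R := by
        have := abs_norm_sub_norm_le ((ρ / 2) • z) v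
        rw [norm_smul, Real.norm_of_nonneg (by positivity), norm_sub_rev] at this
        exact this.trans_lt hb'
      rw [abs_lt] at h2
      have hmem : ρ ∈ I := by
        constructor
        · rw [div_le_iff₀ hzn]; linarith
        · rw [le_div_iff₀ hzn]; linarith
      rw [indicator_of_mem hb, indicator_of_mem hmem, Pi.one_apply, mul_one]
      refine ENNReal.ofReal_le_ofReal ((pow_mul_rpow_le ha hρ0).trans ?_)
      refine Real.rpow_le_rpow_of_nonpos (by positivity) ?_ (by linarith)
      rw [div_le_iff₀ hzn]
      nlinarith
    · rw [indicator_of_notMem hb, mul_zero]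
      exact zero_le
  refine (setLIntegral_mono' measurableSet_Ioi hpt).trans ?_
  refine (setLIntegral_le_lintegral _ _).trans ?_
  rw [lintegral_indicator_const measurableSet_Icc, Real.volume_Icc, ← ENNReal.ofReal_mul hM0]
  refine ENNReal.ofReal_le_ofReal ?_
  have e1 : 2 * (‖v‖ + R) / ‖z‖ - 2 * (‖v‖ - R) / ‖z‖ = 4 * R * ‖z‖⁻¹ := by
    field_simp; ring
  have e2 : M = ‖v‖ ^ ((d : ℝ) - β) * ‖z‖ ^ (β - d) := by
    rw [hM, Real.div_rpow hv0.le hzn.le, div_eq_mul_inv, ← Real.rpow_neg hzn.le, neg_sub]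
  have e3 : ‖z‖ ^ (β - d) * ‖z‖⁻¹ = ‖z‖ ^ (β - d - 1) := by
    rw [Real.rpow_sub_one hzn.ne', div_eq_mul_inv]
  have e4 : ‖z‖ ^ (β - d - 1) ≤ 2 ^ (β - d - 1) :=
    Real.rpow_le_rpow hzn.le hz (by linarith)
  calc M * (2 * (‖v‖ + R) / ‖z‖ - 2 * (‖v‖ - R) / ‖z‖)
      = 4 * R * (‖z‖ ^ (β - d) * ‖z‖⁻¹) * ‖v‖ ^ ((d : ℝ) - β) := by rw [e1, e2]; ring
    _ ≤ _ := by rw [e3]; gcongr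

/-- The sign ε covers both v' and v_*'. For ‖v‖ < 8R the crude bound suffices, as ⟨v⟩^d ≤ (9R)^d.
For ‖v‖ ≥ 8R and fixed ω, only σ in a cap of radius 8R/‖v‖ contribute: the cap gives (R/‖v‖)^{d-1}
and the radial integral R‖v‖^{d-β}, together R^d‖v‖^{1-β}. -/
lemma lintegral_slabDensity_sphere_le (hd : 0 < d) {β : ℝ} (hβ : (d : ℝ) + 1 < β) :
    ∃ C : ℝ≥0∞, C < ∞ ∧ ∀ (R : ℝ) (v : Vel d) (ε : ℝ), 1 ≤ R → ε = 1 ∨ ε = -1 →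
      ∫⁻ ω : Sph d, (∫⁻ σ : Sph d, (∫⁻ ρ in Ioi (0 : ℝ),
        slabDensity β R (bracket v) v ((ω : Vel d) - ε • (σ : Vel d)) ρ)
          ∂(volume : Measure (Vel d)).toSphere) ∂(volume : Measure (Vel d)).toSphere ≤
      C * ENNReal.ofReal (R ^ d * bracket v ^ (1 - β)) := by
  obtain ⟨C₁, hC₁, hcap⟩ := toSphere_cap_le d
  set S := (volume : Measure (Vel d)).toSphere
  set κ := sphereMass d with hκ
  have hκt : κ < ∞ := sphereMass_lt_top
  set A : ℝ≥0∞ := κ * κ * ENNReal.ofReal (9 ^ d / (β - (d + 1))) with hA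
  set B : ℝ≥0∞ := κ * C₁ * ENNReal.ofReal (8 ^ (d - 1) * 4 * 2 ^ (β - d - 1) * 2 ^ (β - 1)) with hB
  refine ⟨A + B, ?_, fun R v ε hR hε => ?_⟩
  · refine ENNReal.add_lt_top.2 ⟨?_, ?_⟩
    · exact ENNReal.mul_lt_top (ENNReal.mul_lt_top hκt hκt) ENNReal.ofReal_lt_top
    · exact ENNReal.mul_lt_top (ENNReal.mul_lt_top hκt hC₁) ENNReal.ofReal_lt_top
  have ha := bracket_pos v
  have hR0 : 0 < R := by linarith
  rcases lt_or_ge ‖v‖ (8 * R) with hv | hv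
  · have h9 : bracket v ≤ 9 * R := (bracket_le_one_add_norm v).trans (by linarith)
    have hreal : bracket v ^ ((d : ℝ) + 1 - β) / (β - (d + 1)) ≤
        9 ^ d / (β - (d + 1)) * (R ^ d * bracket v ^ (1 - β)) := by
      have hb : 0 < β - (d + 1) := by linarith
      have : bracket v ^ ((d : ℝ) + 1 - β) = bracket v ^ d * bracket v ^ (1 - β) := by
        rw [← Real.rpow_natCast, ← Real.rpow_add ha]; ring_nf
      rw [this, div_mul_eq_mul_div, ← mul_assoc, ← mul_pow]
      gcongr
    calc _ ≤ ∫⁻ _ : Sph d, (∫⁻ _ : Sph d,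
          ENNReal.ofReal (bracket v ^ ((d : ℝ) + 1 - β) / (β - (d + 1))) ∂S) ∂S := by
          gcongr with ω σ
          exact lintegral_slabDensity_le_rpow hβ ha _ _
      _ = κ * κ * ENNReal.ofReal (bracket v ^ ((d : ℝ) + 1 - β) / (β - (d + 1))) := by
          simp only [lintegral_const, hκ, sphereMass, S]; ring
      _ ≤ κ * κ * ENNReal.ofReal (9 ^ d / (β - (d + 1)) * (R ^ d * bracket v ^ (1 - β))) := by
          gcongr
      _ = A * ENNReal.ofReal (R ^ d * bracket v ^ (1 - β)) := by
          rw [ENNReal.ofReal_mul (div_nonneg (by positivity) (by linarith)), hA]; ring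
      _ ≤ _ := by gcongr; exact le_self_add
  · have hv0 : 0 < ‖v‖ := by linarith
    have hε2 : ε * ε = 1 := by rcases hε with rfl | rfl <;> norm_num
    have hεn : ‖ε‖ = 1 := by rcases hε with rfl | rfl <;> norm_num
    set D := ENNReal.ofReal (4 * R * 2 ^ (β - d - 1) * ‖v‖ ^ ((d : ℝ) - β)) with hD
    have hinner : ∀ ω : Sph d, ∫⁻ σ : Sph d, (∫⁻ ρ in Ioi (0 : ℝ),
        slabDensity β R (bracket v) v ((ω : Vel d) - ε • (σ : Vel d)) ρ) ∂S ≤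
        C₁ * ENNReal.ofReal ((8 * R / ‖v‖) ^ (d - 1)) * D := by
      intro ω
      have hω : ‖(ω : Vel d)‖ = 1 := by simp
      set e := ‖v‖⁻¹ • v with he
      have he1 : ‖e‖ = 1 := by rw [he, norm_smul, norm_inv, norm_norm, inv_mul_cancel₀ hv0.ne']
      -- The cap is centred at ε times the reflection of ω, since with z = ω - εσ it is εσ = ω - z
      -- that the reflection estimate locates.
      set c := ε • ((ω : Vel d) - (2 * inner ℝ (ω : Vel d) e) • e) with hc
      have hc1 : ‖c‖ ≤ 1 := by
        rw [hc, norm_smul, hεn, one_mul]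
        refine le_of_sq_le_sq ?_ zero_le_one
        rw [norm_sub_sq_real, inner_smul_right, norm_smul, he1, hω, Real.norm_eq_abs, mul_one,
          sq_abs]
        linarith
      set T := {σ : Sph d | ‖(σ : Vel d) - c‖ < 8 * R / ‖v‖} with hT
      have hTm : MeasurableSet T := measurableSet_lt (by fun_prop) measurable_const
      have hpt : ∀ σ : Sph d, (∫⁻ ρ in Ioi (0 : ℝ),
          slabDensity β R (bracket v) v ((ω : Vel d) - ε • (σ : Vel d)) ρ) ≤
          T.indicator (fun _ => D) σ := by
        intro σ
        have hσ : ‖(σ : Vel d)‖ = 1 := by simp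
        have hεσ : ‖ε • (σ : Vel d)‖ = 1 := by rw [norm_smul, hεn, hσ, one_mul]
        by_cases hmem : σ ∈ T
        · rw [indicator_of_mem hmem]
          refine lintegral_slabDensity_le hβ ha hR0 (by linarith) ?_
          refine (norm_sub_le _ _).trans ?_
          rw [hω, hεσ]; norm_num
        · rw [indicator_of_notMem hmem, nonpos_iff_eq_zero]
          have : ∀ ρ ∈ Ioi (0 : ℝ),
              slabDensity β R (bracket v) v ((ω : Vel d) - ε • (σ : Vel d)) ρ = 0 := by
            intro ρ hρ
            unfold slabDensity
            rw [indicator_of_notMem, mul_zero]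
            intro hb
            rw [mem_ball_zero_iff] at hb
            refine hmem ?_
            have hz : (ω : Vel d) - ε • (σ : Vel d) ≠ 0 := by
              intro h0
              rw [h0, smul_zero, sub_zero] at hb
              linarith
            have h1 := norm_sub_reflection_lt hv0 hρ hz hω (by rwa [sub_sub_cancel]) hb
            rw [sub_sub_cancel] at h1
            have h2 : (σ : Vel d) - c = ε • (ε • (σ : Vel d) -
                ((ω : Vel d) - (2 * inner ℝ (ω : Vel d) e) • e)) := by
              rw [smul_sub, smul_smul, hε2, one_smul, hc]
            change ‖(σ : Vel d) - c‖ < _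
            rw [h2, norm_smul, hεn, one_mul]
            exact h1
          rw [setLIntegral_congr_fun measurableSet_Ioi this]
          simp
      calc _ ≤ ∫⁻ σ, T.indicator (fun _ => D) σ ∂S := lintegral_mono hpt
        _ = D * S T := lintegral_indicator_const hTm _
        _ ≤ D * (C₁ * ENNReal.ofReal ((8 * R / ‖v‖) ^ (d - 1))) := by
            gcongr
            exact hcap c hc1 _ (by positivity) ((div_le_one hv0).2 hv)
        _ = _ := by ring
    have hreal : (8 * R / ‖v‖) ^ (d - 1) * (4 * R * 2 ^ (β - d - 1) * ‖v‖ ^ ((d : ℝ) - β)) ≤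
        8 ^ (d - 1) * 4 * 2 ^ (β - d - 1) * 2 ^ (β - 1) * (R ^ d * bracket v ^ (1 - β)) := by
      have e1 : ‖v‖ ^ ((d : ℝ) - β) = ‖v‖ ^ (1 - β) * ‖v‖ ^ (d - 1) := by
        rw [← Real.rpow_natCast, ← Real.rpow_add hv0, Nat.cast_sub hd]; ring_nf
      have e2 : ‖v‖ ^ (1 - β) ≤ 2 ^ (β - 1) * bracket v ^ (1 - β) := by
        have h1 : bracket v / 2 ≤ ‖v‖ := by
          have := bracket_le_one_add_norm v; linarith
        calc ‖v‖ ^ (1 - β) ≤ (bracket v / 2) ^ (1 - β) :=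
              Real.rpow_le_rpow_of_nonpos (by positivity) h1 (by linarith [d.cast_nonneg (α := ℝ)])
          _ = 2 ^ (β - 1) * bracket v ^ (1 - β) := by
              rw [Real.div_rpow ha.le two_pos.le, div_eq_mul_inv, ← Real.rpow_neg two_pos.le,
                neg_sub, mul_comm]
      have e3 : R ^ (d - 1) * R = R ^ d := by rw [← pow_succ, Nat.sub_add_cancel hd]
      have hvp : 0 < ‖v‖ ^ (d - 1) := by positivity
      calc (8 * R / ‖v‖) ^ (d - 1) * (4 * R * 2 ^ (β - d - 1) * ‖v‖ ^ ((d : ℝ) - β))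
          = 8 ^ (d - 1) * 4 * 2 ^ (β - d - 1) * (R ^ (d - 1) * R) * ‖v‖ ^ (1 - β) := by
            rw [e1, div_pow, mul_pow]; field_simp
        _ ≤ 8 ^ (d - 1) * 4 * 2 ^ (β - d - 1) * (R ^ (d - 1) * R) *
              (2 ^ (β - 1) * bracket v ^ (1 - β)) := by gcongr
        _ = _ := by rw [e3]; ring
    calc _ ≤ ∫⁻ _ : Sph d, C₁ * ENNReal.ofReal ((8 * R / ‖v‖) ^ (d - 1)) * D ∂S :=
          lintegral_mono hinner
      _ = κ * C₁ * ENNReal.ofReal ((8 * R / ‖v‖) ^ (d - 1) *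
            (4 * R * 2 ^ (β - d - 1) * ‖v‖ ^ ((d : ℝ) - β))) := by
          rw [lintegral_const, ENNReal.ofReal_mul (by positivity), hD, hκ, sphereMass]; ring
      _ ≤ κ * C₁ * ENNReal.ofReal (8 ^ (d - 1) * 4 * 2 ^ (β - d - 1) * 2 ^ (β - 1) *
            (R ^ d * bracket v ^ (1 - β))) := by gcongr
      _ = B * ENNReal.ofReal (R ^ d * bracket v ^ (1 - β)) := by
          rw [ENNReal.ofReal_mul (by positivity), hB]; ring
      _ ≤ _ := by gcongr; exact le_add_self

end Boltzmann

/-! ### Kernel bounds for the gain and the loss. -/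

namespace Boltzmann

open Set Metric

variable {d : ℕ}

lemma norm_vPre_sub_vsPre (v w : Vel d) (σ : Sph d) : ‖vPre v w σ - vsPre v w σ‖ = ‖v - w‖ := by
  have h : vPre v w σ - vsPre v w σ = ‖v - w‖ • (σ : Vel d) := by
    unfold vPre vsPre; module
  rw [h, norm_smul, norm_norm]
  simp

lemma energy_conservation (v w : Vel d) (σ : Sph d) :
    ‖vPre v w σ‖ ^ 2 + ‖vsPre v w σ‖ ^ 2 = ‖v‖ ^ 2 + ‖w‖ ^ 2 := by
  have h1 := parallelogram_law_with_norm ℝ ((1 / 2 : ℝ) • (v + w)) ((‖v - w‖ / 2) • (σ : Vel d))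
  have h2 := parallelogram_law_with_norm ℝ v w
  have h3 : ‖(‖v - w‖ / 2) • (σ : Vel d)‖ = ‖v - w‖ / 2 := by
    rw [norm_smul, Real.norm_of_nonneg (by positivity)]; simp
  have h4 : ‖(1 / 2 : ℝ) • (v + w)‖ = ‖v + w‖ / 2 := by
    rw [norm_smul]; norm_num; ring
  rw [h3, h4] at h1
  unfold vPre vsPre
  nlinarith

/-- From (a + b)² ≤ 2a² + 2b² and the parallelogram law the left side is at most 2 + 6‖v‖² + 4‖w‖²,
while energy conservation turns the right side into 12 + 6‖v‖² + 6‖w‖². -/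
lemma bracket_add_norm_sub_sq_le (v w : Vel d) (σ : Sph d) :
    (bracket v + ‖v - w‖) ^ 2 ≤ 6 * (bracket (vPre v w σ) ^ 2 + bracket (vsPre v w σ) ^ 2) := by
  have h1 := energy_conservation v w σ
  have h2 := parallelogram_law_with_norm ℝ v w
  simp only [bracket_sq] at *
  have h3 := bracket_sq v
  nlinarith [sq_nonneg (bracket v - ‖v - w‖), sq_nonneg ‖v + w‖, sq_nonneg ‖w‖]

/-- The larger of x and y is at least s/√12 ≥ s/4; its negative power is absorbed into s^{-β} and
the other is kept. -/
lemma rpow_neg_mul_rpow_neg_le {x y s β : ℝ} (hx : 0 < x) (hy : 0 < y) (hs : 0 < s) (hβ : 0 ≤ β)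
    (h : s ^ 2 ≤ 6 * (x ^ 2 + y ^ 2)) :
    x ^ (-β) * y ^ (-β) ≤ 4 ^ β * s ^ (-β) * (x ^ (-β) + y ^ (-β)) := by
  wlog hxy : x ≤ y generalizing x y
  · have := this hy hx (by linarith) (by linarith)
    linarith
  have h1 : s / 4 ≤ y := by nlinarith
  have h2 : y ^ (-β) ≤ 4 ^ β * s ^ (-β) := by
    calc y ^ (-β) ≤ (s / 4) ^ (-β) :=
          Real.rpow_le_rpow_of_nonpos (by positivity) h1 (by linarith)
      _ = 4 ^ β * s ^ (-β) := by
          rw [Real.div_rpow hs.le (by norm_num), div_eq_mul_inv, ← Real.rpow_neg (by norm_num),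
            neg_neg, mul_comm]
  have h3 : 0 ≤ x ^ (-β) := by positivity
  have h4 : 0 ≤ y ^ (-β) := by positivity
  have h5 : 0 ≤ 4 ^ β * s ^ (-β) := by positivity
  nlinarith

/-- Dyadic decomposition: the single term with 2^k ≤ ⟨y⟩ < 2^{k+1} already dominates. -/
lemma ofReal_bracket_rpow_neg_le_tsum {β : ℝ} (hβ : 0 ≤ β) (y : Vel d) :
    ENNReal.ofReal (bracket y ^ (-β)) ≤ ∑' k : ℕ, ENNReal.ofReal ((2 ^ k : ℝ) ^ (-β)) *
      (ball (0 : Vel d) (2 ^ (k + 1))).indicator 1 y := by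
  obtain ⟨k, hk1, hk2⟩ := exists_nat_pow_near (one_le_bracket y) one_lt_two
  refine le_trans ?_ (ENNReal.le_tsum k)
  have hmem : y ∈ ball (0 : Vel d) (2 ^ (k + 1)) :=
    mem_ball_zero_iff.2 ((norm_le_bracket y).trans_lt hk2)
  rw [indicator_of_mem hmem, Pi.one_apply, mul_one]
  exact ENNReal.ofReal_le_ofReal
    (Real.rpow_le_rpow_of_nonpos (by positivity) hk1 (by linarith))

/-- One post-collisional weight is left. Its k-th dyadic piece carries 2^{-kβ} and contributes at
most a constant times 2^{(k+1)d}⟨v⟩^{1-β}, by the ball estimate with R = 2^{k+1}; the geometric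
series of ratio 2^{d-β} converges. -/
lemma lintegral_gain_kernel_half_le (hd : 0 < d) {β : ℝ} (hβ : (d : ℝ) + 1 < β) :
    ∃ K : ℝ≥0∞, K < ∞ ∧ ∀ (v : Vel d) (ε : ℝ), ε = 1 ∨ ε = -1 →
      ∫⁻ u : Vel d, (∫⁻ σ : Sph d, ENNReal.ofReal (‖u‖ * (bracket v + ‖u‖) ^ (-β)) *
        ENNReal.ofReal (bracket (v - (1 / 2 : ℝ) • u + (ε * ‖u‖ / 2) • (σ : Vel d)) ^ (-β))
          ∂(volume : Measure (Vel d)).toSphere) ≤ K * ENNReal.ofReal (bracket v ^ (1 - β)) := by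
  obtain ⟨C, hC, hslab⟩ := lintegral_slabDensity_sphere_le hd hβ
  set S := (volume : Measure (Vel d)).toSphere
  have hd0 : (0 : ℝ) ≤ d := d.cast_nonneg
  set q : ℝ := 2 ^ ((d : ℝ) - β) with hq
  have hq0 : 0 ≤ q := by positivity
  have hq1 : q < 1 := Real.rpow_lt_one_of_one_lt_of_neg one_lt_two (by linarith)
  have hgeo : ∑' k : ℕ, ENNReal.ofReal (q ^ k) < ∞ := by
    rw [← ENNReal.ofReal_tsum_of_nonneg (fun k => by positivity)
      (summable_geometric_of_lt_one hq0 hq1)]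
    exact ENNReal.ofReal_lt_top
  refine ⟨C * ENNReal.ofReal (2 ^ d) * ∑' k : ℕ, ENNReal.ofReal (q ^ k),
    ENNReal.mul_lt_top (ENNReal.mul_lt_top hC ENNReal.ofReal_lt_top) hgeo, fun v ε hε => ?_⟩
  set a := bracket v with ha
  have ha0 : 0 < a := bracket_pos v
  have hk : Measurable fun z : Vel d × Sph d => ENNReal.ofReal (‖z.1‖ * (a + ‖z.1‖) ^ (-β)) *
      ENNReal.ofReal (bracket (v - (1 / 2 : ℝ) • z.1 + (ε * ‖z.1‖ / 2) • (z.2 : Vel d)) ^ (-β)) := by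
    have : Measurable fun z : Vel d × Sph d =>
        bracket (v - (1 / 2 : ℝ) • z.1 + (ε * ‖z.1‖ / 2) • (z.2 : Vel d)) :=
      measurable_bracket.comp (by fun_prop)
    fun_prop
  have hms : ∀ ω : Sph d, Measurable fun q : Sph d × ℝ => ∑' k : ℕ,
      ENNReal.ofReal ((2 ^ k : ℝ) ^ (-β)) *
        slabDensity β (2 ^ (k + 1)) a v ((ω : Vel d) - ε • (q.1 : Vel d)) q.2 := by
    intro ω
    refine Measurable.tsum fun k => Measurable.const_mul ?_ _
    exact (measurable_slabDensity β (2 ^ (k + 1)) a v).comp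
      (f := fun q : Sph d × ℝ => ((ω : Vel d) - ε • (q.1 : Vel d), q.2)) (by fun_prop)
  rw [lintegral_polar hd _ hk.lintegral_prod_right']
  calc _ ≤ ∫⁻ ω : Sph d, (∫⁻ ρ in Ioi (0 : ℝ), (∫⁻ σ : Sph d, ∑' k : ℕ,
        ENNReal.ofReal ((2 ^ k : ℝ) ^ (-β)) *
          slabDensity β (2 ^ (k + 1)) a v ((ω : Vel d) - ε • (σ : Vel d)) ρ ∂S)) ∂S := by
        refine lintegral_mono fun ω => setLIntegral_mono' measurableSet_Ioi fun ρ hρ => ?_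
        have hρ0 : 0 < ρ := hρ
        have hω : ‖(ω : Vel d)‖ = 1 := by simp
        have hρω : ‖ρ • (ω : Vel d)‖ = ρ := by
          rw [norm_smul, hω, mul_one, Real.norm_of_nonneg hρ0.le]
        dsimp only
        rw [← lintegral_const_mul' _ _ ENNReal.ofReal_ne_top]
        refine lintegral_mono fun σ => ?_
        rw [hρω]
        have harg : v - (1 / 2 : ℝ) • ρ • (ω : Vel d) + (ε * ρ / 2) • (σ : Vel d) =
            v - (ρ / 2) • ((ω : Vel d) - ε • (σ : Vel d)) := by module
        rw [harg, ← mul_assoc, ← ENNReal.ofReal_mul (by positivity)]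
        have hpow : ρ ^ (d - 1) * (ρ * (a + ρ) ^ (-β)) = ρ ^ d * (a + ρ) ^ (-β) := by
          rw [← mul_assoc, ← pow_succ, Nat.sub_add_cancel hd]
        rw [hpow]
        grw [ofReal_bracket_rpow_neg_le_tsum (by linarith : 0 ≤ β)]
        rw [← ENNReal.tsum_mul_left]
        refine le_of_eq (tsum_congr fun k => ?_)
        unfold slabDensity
        ring
    _ = ∑' k : ℕ, ENNReal.ofReal ((2 ^ k : ℝ) ^ (-β)) * ∫⁻ ω : Sph d, (∫⁻ σ : Sph d,
          (∫⁻ ρ in Ioi (0 : ℝ), slabDensity β (2 ^ (k + 1)) a v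
            ((ω : Vel d) - ε • (σ : Vel d)) ρ) ∂S) ∂S := by
        have hm3 : ∀ k : ℕ, Measurable fun q : (Sph d × Sph d) × ℝ =>
            slabDensity β (2 ^ (k + 1)) a v ((q.1.1 : Vel d) - ε • (q.1.2 : Vel d)) q.2 :=
          fun k => (measurable_slabDensity β (2 ^ (k + 1)) a v).comp
            (f := fun q : (Sph d × Sph d) × ℝ => ((q.1.1 : Vel d) - ε • (q.1.2 : Vel d), q.2))
            (by fun_prop)
        have hm2 : ∀ k : ℕ, Measurable fun q : Sph d × Sph d => ∫⁻ ρ in Ioi (0 : ℝ),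
            slabDensity β (2 ^ (k + 1)) a v ((q.1 : Vel d) - ε • (q.2 : Vel d)) ρ :=
          fun k => (hm3 k).lintegral_prod_right'
        have hm1 : ∀ k : ℕ, Measurable fun ω : Sph d => ∫⁻ σ : Sph d, (∫⁻ ρ in Ioi (0 : ℝ),
            slabDensity β (2 ^ (k + 1)) a v ((ω : Vel d) - ε • (σ : Vel d)) ρ) ∂S :=
          fun k => (hm2 k).lintegral_prod_right'
        -- Tonelli: the sum leaves the integrals and the radial integral becomes the innermost one,
        -- as the ball estimate requires.
        have hsw : ∀ ω : Sph d, (∫⁻ ρ in Ioi (0 : ℝ), (∫⁻ σ : Sph d, ∑' k : ℕ,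
            ENNReal.ofReal ((2 ^ k : ℝ) ^ (-β)) *
            slabDensity β (2 ^ (k + 1)) a v ((ω : Vel d) - ε • (σ : Vel d)) ρ ∂S)) =
            ∑' k : ℕ, ENNReal.ofReal ((2 ^ k : ℝ) ^ (-β)) * ∫⁻ σ : Sph d,
              (∫⁻ ρ in Ioi (0 : ℝ), slabDensity β (2 ^ (k + 1)) a v
                ((ω : Vel d) - ε • (σ : Vel d)) ρ) ∂S := by
          intro ω
          have hsm : AEMeasurable (Function.uncurry fun (ρ : ℝ) (σ : Sph d) => ∑' k : ℕ,
              ENNReal.ofReal ((2 ^ k : ℝ) ^ (-β)) *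
              slabDensity β (2 ^ (k + 1)) a v ((ω : Vel d) - ε • (σ : Vel d)) ρ)
              ((volume.restrict (Ioi (0 : ℝ))).prod S) :=
            ((hms ω).comp measurable_swap).aemeasurable
          rw [lintegral_lintegral_swap hsm]
          have : ∀ σ : Sph d, (∫⁻ ρ in Ioi (0 : ℝ), ∑' k : ℕ,
              ENNReal.ofReal ((2 ^ k : ℝ) ^ (-β)) *
              slabDensity β (2 ^ (k + 1)) a v ((ω : Vel d) - ε • (σ : Vel d)) ρ) =
              ∑' k : ℕ, ENNReal.ofReal ((2 ^ k : ℝ) ^ (-β)) * ∫⁻ ρ in Ioi (0 : ℝ),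
              slabDensity β (2 ^ (k + 1)) a v ((ω : Vel d) - ε • (σ : Vel d)) ρ := by
            intro σ
            have hm : ∀ k : ℕ, Measurable fun ρ : ℝ =>
                slabDensity β (2 ^ (k + 1)) a v ((ω : Vel d) - ε • (σ : Vel d)) ρ :=
              fun k => (measurable_slabDensity β (2 ^ (k + 1)) a v).comp
                (f := fun ρ : ℝ => ((ω : Vel d) - ε • (σ : Vel d), ρ)) (by fun_prop)
            rw [lintegral_tsum fun k => ((hm k).const_mul _).aemeasurable]
            exact tsum_congr fun k => lintegral_const_mul _ (hm k)
          simp_rw [this]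
          have hm : ∀ k : ℕ, Measurable fun σ : Sph d => ∫⁻ ρ in Ioi (0 : ℝ),
              slabDensity β (2 ^ (k + 1)) a v ((ω : Vel d) - ε • (σ : Vel d)) ρ :=
            fun k => (hm2 k).comp (f := fun σ : Sph d => (ω, σ)) (by fun_prop)
          rw [lintegral_tsum fun k => ((hm k).const_mul _).aemeasurable]
          exact tsum_congr fun k => lintegral_const_mul _ (hm k)
        simp_rw [hsw]
        rw [lintegral_tsum fun k => ((hm1 k).const_mul _).aemeasurable]
        exact tsum_congr fun k => lintegral_const_mul _ (hm1 k)
    _ ≤ ∑' k : ℕ, C * ENNReal.ofReal (2 ^ d) * ENNReal.ofReal (a ^ (1 - β)) *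
          ENNReal.ofReal (q ^ k) := by
        refine ENNReal.tsum_le_tsum fun k => ?_
        grw [hslab (2 ^ (k + 1)) v ε (one_le_pow₀ one_le_two) hε]
        have e : (2 ^ k : ℝ) ^ (-β) * ((2 ^ (k + 1)) ^ d * a ^ (1 - β)) =
            2 ^ d * a ^ (1 - β) * q ^ k := by
          have h1 : (2 ^ k : ℝ) ^ (-β) = (2 ^ (-β)) ^ k := by
            rw [← Real.rpow_natCast, ← Real.rpow_mul two_pos.le, mul_comm,
              Real.rpow_mul two_pos.le, Real.rpow_natCast]
          have h2 : q = 2 ^ d * 2 ^ (-β) := by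
            rw [hq, sub_eq_add_neg, Real.rpow_add two_pos, Real.rpow_natCast]
          rw [h1, h2, mul_pow, pow_succ, mul_pow, ← pow_mul, ← pow_mul, mul_comm k d]
          ring
        calc _ = C * ENNReal.ofReal ((2 ^ k : ℝ) ^ (-β) * ((2 ^ (k + 1)) ^ d * a ^ (1 - β))) := by
              rw [ENNReal.ofReal_mul (p := (2 ^ k : ℝ) ^ (-β)) (by positivity), ha]; ring
          _ = C * ENNReal.ofReal (2 ^ d) * ENNReal.ofReal (a ^ (1 - β)) *
              ENNReal.ofReal (q ^ k) := by
              rw [e, ENNReal.ofReal_mul (by positivity), ENNReal.ofReal_mul (by positivity)]; ring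
          _ ≤ _ := le_rfl
    _ = _ := by rw [ENNReal.tsum_mul_left]; ring

/-- Energy conservation bounds one of the two weights by a multiple of (⟨v⟩ + |v - v_*|)^{-β}. The
two possibilities for the remaining weight are the cases ε = 1 and ε = -1 of the previous estimate.
-/
lemma lintegral_gain_kernel_le (hd : 0 < d) {β : ℝ} (hβ : (d : ℝ) + 1 < β) :
    ∃ K : ℝ≥0∞, K < ∞ ∧ ∀ v : Vel d,
      ∫⁻ z, ENNReal.ofReal (‖v - z.1‖ * (bracket (vPre v z.1 z.2) ^ (-β) *
        bracket (vsPre v z.1 z.2) ^ (-β))) ∂(collMeasure d) ≤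
      K * ENNReal.ofReal (bracket v ^ (1 - β)) := by
  obtain ⟨K, hK, hhalf⟩ := lintegral_gain_kernel_half_le hd hβ
  have hd0 : (0 : ℝ) ≤ d := d.cast_nonneg
  refine ⟨ENNReal.ofReal (4 ^ β) * (2 * K), ENNReal.mul_lt_top ENNReal.ofReal_lt_top
    (ENNReal.mul_lt_top (by simp) hK), fun v => ?_⟩
  set S := (volume : Measure (Vel d)).toSphere
  set P : ℝ → Vel d → Sph d → ℝ≥0∞ := fun ε u σ =>
    ENNReal.ofReal (‖u‖ * (bracket v + ‖u‖) ^ (-β)) *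
      ENNReal.ofReal (bracket (v - (1 / 2 : ℝ) • u + (ε * ‖u‖ / 2) • (σ : Vel d)) ^ (-β)) with hP
  have hPm : ∀ ε, Measurable (Function.uncurry (P ε)) := by
    intro ε
    have : Measurable fun z : Vel d × Sph d =>
        bracket (v - (1 / 2 : ℝ) • z.1 + (ε * ‖z.1‖ / 2) • (z.2 : Vel d)) :=
      measurable_bracket.comp (by fun_prop)
    simp only [hP, Function.uncurry_def]
    fun_prop
  have hpt : ∀ (u : Vel d) (σ : Sph d), ENNReal.ofReal (‖v - (v - u)‖ *
      (bracket (vPre v (v - u) σ) ^ (-β) * bracket (vsPre v (v - u) σ) ^ (-β))) ≤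
      ENNReal.ofReal (4 ^ β) * (P 1 u σ + P (-1) u σ) := by
    intro u σ
    have h1 := rpow_neg_mul_rpow_neg_le (bracket_pos (vPre v (v - u) σ))
      (bracket_pos (vsPre v (v - u) σ)) (s := bracket v + ‖u‖)
      (by have := bracket_pos v; positivity) (by linarith : 0 ≤ β)
      (by simpa using bracket_add_norm_sub_sq_le v (v - u) σ)
    have e1 : vPre v (v - u) σ = v - (1 / 2 : ℝ) • u + (1 * ‖u‖ / 2) • (σ : Vel d) := by
      unfold vPre; rw [sub_sub_cancel]; module
    have e2 : vsPre v (v - u) σ = v - (1 / 2 : ℝ) • u + (-1 * ‖u‖ / 2) • (σ : Vel d) := by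
      unfold vsPre; rw [sub_sub_cancel]; module
    have hs : 0 ≤ bracket v + ‖u‖ := by have := bracket_pos v; positivity
    have hx := (Real.rpow_nonneg (bracket_pos (vPre v (v - u) σ)).le (-β))
    have hy := (Real.rpow_nonneg (bracket_pos (vsPre v (v - u) σ)).le (-β))
    rw [sub_sub_cancel]
    simp only [hP]
    rw [← e1, ← e2, ← mul_add, ← ENNReal.ofReal_add hx hy, ← ENNReal.ofReal_mul (by positivity),
      ← ENNReal.ofReal_mul (by positivity)]
    refine ENNReal.ofReal_le_ofReal ?_
    calc _ ≤ ‖u‖ * (4 ^ β * (bracket v + ‖u‖) ^ (-β) * (bracket (vPre v (v - u) σ) ^ (-β) +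
          bracket (vsPre v (v - u) σ) ^ (-β))) := by gcongr
      _ = _ := by ring
  have hm : Measurable fun z : Vel d × Sph d => ENNReal.ofReal (‖v - z.1‖ *
      (bracket (vPre v z.1 z.2) ^ (-β) * bracket (vsPre v z.1 z.2) ^ (-β))) := by
    have h1 : Measurable fun z : Vel d × Sph d => bracket (vPre v z.1 z.2) :=
      measurable_bracket.comp
        (measurable_vPre.comp (f := fun z : Vel d × Sph d => (v, z)) measurable_prodMk_left)
    have h2 : Measurable fun z : Vel d × Sph d => bracket (vsPre v z.1 z.2) :=
      measurable_bracket.comp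
        (measurable_vsPre.comp (f := fun z : Vel d × Sph d => (v, z)) measurable_prodMk_left)
    fun_prop
  have hshift := lintegral_sub_left_eq_self (μ := (volume : Measure (Vel d)))
    (fun w : Vel d => ∫⁻ σ : Sph d, ENNReal.ofReal (‖v - w‖ *
      (bracket (vPre v w σ) ^ (-β) * bracket (vsPre v w σ) ^ (-β))) ∂S) v
  rw [collMeasure, lintegral_prod _ hm.aemeasurable]
  calc _ = _ := hshift.symm
    _ ≤ ∫⁻ u, (∫⁻ σ, ENNReal.ofReal (4 ^ β) * (P 1 u σ + P (-1) u σ) ∂S) := by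
        exact lintegral_mono fun u => lintegral_mono fun σ => hpt u σ
    _ = ENNReal.ofReal (4 ^ β) * ((∫⁻ u, (∫⁻ σ, P 1 u σ ∂S)) + ∫⁻ u, (∫⁻ σ, P (-1) u σ ∂S)) := by
        have hm1 : Measurable fun u => ∫⁻ σ, P 1 u σ ∂S := (hPm 1).lintegral_prod_right'
        rw [← lintegral_add_left hm1, ← lintegral_const_mul' _ _ ENNReal.ofReal_ne_top]
        refine lintegral_congr fun u => ?_
        rw [lintegral_const_mul' _ _ ENNReal.ofReal_ne_top,
          lintegral_add_left ((hPm 1).of_uncurry_left)]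
    _ ≤ ENNReal.ofReal (4 ^ β) * (K * ENNReal.ofReal (bracket v ^ (1 - β)) +
          K * ENNReal.ofReal (bracket v ^ (1 - β))) := by
        gcongr
        · exact hhalf v 1 (Or.inl rfl)
        · exact hhalf v (-1) (Or.inr rfl)
    _ = _ := by ring

/-- The relative speed is at most 2⟨v⟩⟨v_*⟩, and ⟨v_*⟩^{1-β} is integrable because β - 1 > d. -/
lemma lintegral_loss_kernel_le {β : ℝ} (hβ : (d : ℝ) + 1 < β) :
    ∃ K : ℝ≥0∞, K < ∞ ∧ ∀ v : Vel d,
      ∫⁻ z, ENNReal.ofReal (‖v - z.1‖ * (bracket v ^ (-β) * bracket z.1 ^ (-β)))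
        ∂(collMeasure d) ≤ K * ENNReal.ofReal (bracket v ^ (1 - β)) := by
  have hint := integrable_rpow_neg_one_add_norm_sq (E := Vel d) (μ := volume) (r := β - 1)
    (by rw [finrank_euclideanSpace, Fintype.card_fin]; linarith)
  have hpow : ∀ w : Vel d, (1 + ‖w‖ ^ 2) ^ (-(β - 1) / 2) = bracket w ^ (1 - β) := by
    intro w
    rw [← bracket_sq, ← Real.rpow_natCast, ← Real.rpow_mul (bracket_pos w).le]
    congr 1; push_cast; ring
  simp_rw [hpow] at hint
  refine ⟨ENNReal.ofReal 2 * ((∫⁻ w : Vel d, ENNReal.ofReal (bracket w ^ (1 - β))) * sphereMass d),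
    ENNReal.mul_lt_top (by simp) (ENNReal.mul_lt_top ?_ sphereMass_lt_top), fun v => ?_⟩
  · rw [← ofReal_integral_eq_lintegral_ofReal hint
      (ae_of_all _ fun w => Real.rpow_nonneg (bracket_pos w).le _)]
    exact ENNReal.ofReal_lt_top
  have hm : Measurable fun w : Vel d => ENNReal.ofReal (bracket w ^ (1 - β)) := by
    have := measurable_bracket (d := d)
    fun_prop
  calc _ ≤ ∫⁻ z : Vel d × Sph d, ENNReal.ofReal 2 * ENNReal.ofReal (bracket v ^ (1 - β)) *
        (ENNReal.ofReal (bracket z.1 ^ (1 - β)) * 1) ∂(collMeasure d) := by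
        refine lintegral_mono fun z => ?_
        dsimp only
        rw [mul_one, ← ENNReal.ofReal_mul (by norm_num),
          ← ENNReal.ofReal_mul (mul_nonneg (by norm_num) (Real.rpow_nonneg (bracket_pos v).le _))]
        refine ENNReal.ofReal_le_ofReal ?_
        have h1 : ‖v - z.1‖ ≤ 2 * (bracket v * bracket z.1) := by
          have h1 := norm_le_bracket v
          have h2 := norm_le_bracket z.1
          have h3 := one_le_bracket v
          have h4 := one_le_bracket z.1
          have h5 := norm_sub_le v z.1
          nlinarith
        have e : ∀ w : Vel d, bracket w ^ (1 - β) = bracket w * bracket w ^ (-β) := by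
          intro w
          rw [sub_eq_add_neg, Real.rpow_add (bracket_pos w), Real.rpow_one]
        rw [e, e]
        have hx := (Real.rpow_nonneg (bracket_pos v).le (-β))
        have hy := (Real.rpow_nonneg (bracket_pos z.1).le (-β))
        calc _ ≤ 2 * (bracket v * bracket z.1) * (bracket v ^ (-β) * bracket z.1 ^ (-β)) := by
              gcongr
          _ = _ := by ring
    _ = _ := by
        have hm' : Measurable fun z : Vel d × Sph d =>
            ENNReal.ofReal (bracket z.1 ^ (1 - β)) * 1 := (hm.comp measurable_fst).mul_const 1
        rw [lintegral_const_mul _ hm', collMeasure,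
          lintegral_prod_mul hm.aemeasurable aemeasurable_const, lintegral_one, sphereMass]
        ring

end Boltzmann

/-! ### The L^p estimate of the scalar collision integral. -/

namespace Boltzmann

open Set Metric

variable {d : ℕ}

/-- The power `⟨v⟩^a` of the bracket, with values in `[0, ∞]`. -/
def wt (a : ℝ) (v : Vel d) : ℝ≥0∞ := ENNReal.ofReal (bracket v ^ a)

lemma wt_ne_top (a : ℝ) (v : Vel d) : wt a v ≠ ∞ := ENNReal.ofReal_ne_top

lemma wt_ne_zero (a : ℝ) (v : Vel d) : wt a v ≠ 0 := by
  have := Real.rpow_pos_of_pos (bracket_pos v) a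
  simpa [wt] using this

lemma wt_zero (v : Vel d) : wt 0 v = 1 := by simp [wt]

lemma wt_add (a b : ℝ) (v : Vel d) : wt (a + b) v = wt a v * wt b v := by
  rw [wt, Real.rpow_add (bracket_pos v),
    ENNReal.ofReal_mul (Real.rpow_nonneg (bracket_pos v).le _)]
  rfl

lemma wt_rpow (a r : ℝ) (v : Vel d) : wt a v ^ r = wt (a * r) v := by
  rw [wt, wt, ENNReal.ofReal_rpow_of_pos (Real.rpow_pos_of_pos (bracket_pos v) a),
    ← Real.rpow_mul (bracket_pos v).le]

@[fun_prop]
lemma measurable_wt (a : ℝ) : Measurable (wt (d := d) a) := by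
  have := measurable_bracket (d := d)
  unfold wt
  fun_prop

/-- The properties of the maps `(v, v_*, σ) ↦ (v', v_*')` and `(v, v_*, σ) ↦ (v, v_*)` used in the
estimates of the gain and loss parts. -/
structure IsCollisionMap (T : Vel d × Vel d × Sph d → Vel d × Vel d) : Prop where
  measurable : Measurable T
  lintegral_comp : ∀ H : Vel d × Vel d → ℝ≥0∞, Measurable H →
    ∫⁻ z, H (T z) ∂(volume.prod (collMeasure d)) =
      sphereMass d * ∫⁻ z, H z ∂((volume : Measure (Vel d)).prod volume)
  norm_sub : ∀ z, ‖(T z).1 - (T z).2‖ = ‖z.1 - z.2.1‖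
  bracket_le : ∀ z, bracket z.1 ≤ bracket (T z).1 * bracket (T z).2
  kernel : ∀ β : ℝ, (d : ℝ) + 1 < β → ∃ K : ℝ≥0∞, K < ∞ ∧ ∀ v : Vel d,
    ∫⁻ z, ‖v - z.1‖ₑ * (wt (-β) (T (v, z)).1 * wt (-β) (T (v, z)).2) ∂(collMeasure d) ≤
      K * wt (1 - β) v

lemma ofReal_mul_bracket (v : Vel d) (w x y : Vel d) (a b : ℝ) :
    ENNReal.ofReal (‖v - w‖ * (bracket x ^ a * bracket y ^ b)) =
      ‖v - w‖ₑ * (wt a x * wt b y) := by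
  have h1 := Real.rpow_nonneg (bracket_pos x).le a
  rw [ENNReal.ofReal_mul (norm_nonneg _), ENNReal.ofReal_mul h1, ofReal_norm]
  rfl

lemma isCollisionMap_collMap (hd : 0 < d) : IsCollisionMap (collMap (d := d)) where
  measurable := measurable_collMap
  lintegral_comp := lintegral_collMap hd
  norm_sub z := norm_vPre_sub_vsPre _ _ _
  -- By energy conservation ⟨v⟩² ≤ 1 + |v'|² + |v_*'|² ≤ ⟨v'⟩²⟨v_*'⟩².
  bracket_le z := by
    have h := energy_conservation z.1 z.2.1 z.2.2
    simp only [collMap, bracket]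
    rw [← Real.sqrt_mul (by positivity)]
    refine Real.sqrt_le_sqrt ?_
    nlinarith [sq_nonneg ‖z.2.1‖, mul_nonneg (sq_nonneg ‖vPre z.1 z.2.1 z.2.2‖)
      (sq_nonneg ‖vsPre z.1 z.2.1 z.2.2‖)]
  kernel β hβ := by
    obtain ⟨K, hK, h⟩ := lintegral_gain_kernel_le hd hβ
    simp_rw [ofReal_mul_bracket] at h
    exact ⟨K, hK, h⟩

/-- The map `(v, v_*, σ) ↦ (v, v_*)`. -/
def lossMap (z : Vel d × Vel d × Sph d) : Vel d × Vel d := (z.1, z.2.1)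

lemma isCollisionMap_lossMap : IsCollisionMap (lossMap (d := d)) where
  measurable := by unfold lossMap; fun_prop
  lintegral_comp H hH := by
    have h1 : Measurable fun z : Vel d × Vel d × Sph d => H (lossMap z) :=
      hH.comp (by unfold lossMap; fun_prop)
    rw [lintegral_prod _ h1.aemeasurable, lintegral_prod _ hH.aemeasurable,
      ← lintegral_const_mul _ hH.lintegral_prod_right']
    refine lintegral_congr fun v => ?_
    have h2 : Measurable fun y : Vel d × Sph d => H (v, y.1) := hH.comp (by fun_prop)
    have h3 : Measurable fun w : Vel d => H (v, w) := hH.comp (by fun_prop)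
    simp only [lossMap]
    rw [collMeasure, lintegral_prod _ h2.aemeasurable]
    simp only [lintegral_const]
    rw [lintegral_mul_const _ h3, mul_comm]
    rfl
  norm_sub z := rfl
  bracket_le z := le_mul_of_one_le_right (bracket_pos _).le (one_le_bracket _)
  kernel β hβ := by
    obtain ⟨K, hK, h⟩ := lintegral_loss_kernel_le hβ
    simp_rw [ofReal_mul_bracket] at h
    exact ⟨K, hK, h⟩

namespace IsCollisionMap

variable {T : Vel d × Vel d × Sph d → Vel d × Vel d}

/-- By the change of variables the preimage of a null set is null. This allows functions known only
almost everywhere to be composed with T. -/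
lemma quasiMeasurePreserving (hT : IsCollisionMap T) :
    Measure.QuasiMeasurePreserving T (volume.prod (collMeasure d))
      ((volume : Measure (Vel d)).prod volume) := by
  refine ⟨hT.measurable, Measure.AbsolutelyContinuous.mk fun s hs h0 => ?_⟩
  rw [Measure.map_apply hT.measurable hs, ← lintegral_indicator_one (hT.measurable hs)]
  have := hT.lintegral_comp (s.indicator 1) (measurable_one.indicator hs)
  rw [lintegral_indicator_one hs, h0, mul_zero] at this
  exact this

lemma quasiMeasurePreserving_fst (hT : IsCollisionMap T) :
    Measure.QuasiMeasurePreserving (fun z => (T z).1) (volume.prod (collMeasure d))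
      (volume : Measure (Vel d)) := Measure.quasiMeasurePreserving_fst.comp hT.quasiMeasurePreserving

lemma quasiMeasurePreserving_snd (hT : IsCollisionMap T) :
    Measure.QuasiMeasurePreserving (fun z => (T z).2) (volume.prod (collMeasure d))
      (volume : Measure (Vel d)) := Measure.quasiMeasurePreserving_snd.comp hT.quasiMeasurePreserving

lemma wt_le (hT : IsCollisionMap T) {a : ℝ} (ha : 0 ≤ a) (z : Vel d × Vel d × Sph d) :
    wt a z.1 ≤ wt a (T z).1 * wt a (T z).2 := by
  unfold wt
  rw [← ENNReal.ofReal_mul (Real.rpow_nonneg (bracket_pos _).le _),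
    ← Real.mul_rpow (bracket_pos _).le (bracket_pos _).le]
  exact ENNReal.ofReal_le_ofReal (Real.rpow_le_rpow (bracket_pos _).le (hT.bracket_le z) ha)

end IsCollisionMap

/-- The collision integral `∫ |v - v_*| φ ψ` of nonnegative functions along a collision map. -/
def collInt (T : Vel d × Vel d × Sph d → Vel d × Vel d) (φ ψ : Vel d → ℝ≥0∞) (v : Vel d) : ℝ≥0∞ :=
  ∫⁻ z, ‖v - z.1‖ₑ * (φ (T (v, z)).1 * ψ (T (v, z)).2) ∂(collMeasure d)

lemma measurable_collInt {T : Vel d × Vel d × Sph d → Vel d × Vel d} (hT : IsCollisionMap T)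
    {φ ψ : Vel d → ℝ≥0∞} (hφ : Measurable φ) (hψ : Measurable ψ) : Measurable (collInt T φ ψ) := by
  have := hT.measurable
  refine Measurable.lintegral_prod_right' (f := fun z : Vel d × Vel d × Sph d =>
    ‖z.1 - z.2.1‖ₑ * (φ (T z).1 * ψ (T z).2)) ?_
  fun_prop

lemma collInt_congr_ae {T : Vel d × Vel d × Sph d → Vel d × Vel d} (hT : IsCollisionMap T)
    {φ φ' ψ ψ' : Vel d → ℝ≥0∞} (hφ : φ =ᵐ[volume] φ') (hψ : ψ =ᵐ[volume] ψ') :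
    collInt T φ ψ =ᵐ[volume] collInt T φ' ψ' := by
  have h1 := hT.quasiMeasurePreserving_fst.ae hφ
  have h2 := hT.quasiMeasurePreserving_snd.ae hψ
  filter_upwards [Measure.ae_ae_of_ae_prod h1, Measure.ae_ae_of_ae_prod h2] with v hv1 hv2
  refine lintegral_congr_ae ?_
  filter_upwards [hv1, hv2] with z hz1 hz2
  rw [hz1, hz2]

/-- Hölder's inequality with respect to the measure `|v - v_*| dσ dv_*`. -/
lemma collInt_mul_wt_rpow_le {T : Vel d × Vel d × Sph d → Vel d × Vel d} (hT : IsCollisionMap T)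
    {P α : ℝ} (hP : 1 ≤ P) (hα : 2 + (d : ℝ) * (1 - P⁻¹) < α) :
    ∃ K : ℝ≥0∞, K < ∞ ∧ ∀ φ ψ : Vel d → ℝ≥0∞, Measurable φ → Measurable ψ → ∀ v,
      (collInt T φ ψ v * wt (α - (1 - P⁻¹)) v) ^ P ≤
        K * collInt T (fun v => (φ v * wt α v) ^ P) (fun v => (ψ v * wt α v) ^ P) v := by
  have hTm := hT.measurable
  have hP0 : 0 < P := by linarith
  -- For P = 1 the conjugate exponent is infinite; ⟨v⟩ ≤ ⟨v'⟩⟨v_*'⟩ distributes the weight and no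
  -- kernel bound is needed.
  rcases hP.eq_or_lt with rfl | hP1
  · refine ⟨1, by simp, fun φ ψ hφ hψ v => ?_⟩
    simp only [inv_one, sub_self, sub_zero, ENNReal.rpow_one, one_mul]
    rw [collInt, ← lintegral_mul_const' _ _ (wt_ne_top _ _)]
    refine lintegral_mono fun z => ?_
    have hα0 : 0 ≤ α := by norm_num at hα; linarith
    grw [hT.wt_le hα0 (v, z)]
    exact le_of_eq (by ring)
  · have hconj : P.HolderConjugate (P / (P - 1)) := Real.HolderConjugate.conjExponent hP1
    set P' := P / (P - 1) with hP'
    have hP'0 : 0 < P' := hconj.symm.pos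
    have hinv : 1 - P⁻¹ = P'⁻¹ := by linarith [hconj.inv_add_inv_eq_one]
    have hP'1 : 1 < P' := hconj.symm.lt
    -- The kernel bound is used with β = αP', which exceeds 2P' + d by the hypothesis on α.
    have hβ : (d : ℝ) + 1 < α * P' := by
      have : (2 + (d : ℝ) * P'⁻¹) * P' < α * P' := by
        rw [← hinv]; gcongr
      have e : (2 + (d : ℝ) * P'⁻¹) * P' = 2 * P' + d := by field_simp
      linarith
    obtain ⟨K, hK, hker⟩ := hT.kernel _ hβ
    refine ⟨K ^ (P / P'), ENNReal.rpow_lt_top_of_nonneg (by positivity) hK.ne,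
      fun φ ψ hφ hψ v => ?_⟩
    -- The relative speed is shared as powers 1/P and 1/P'. The weights ⟨·⟩^α go with the data, the
    -- weights ⟨·⟩^{-α} into the factor whose P'-th power is the kernel.
    set F : Vel d × Sph d → ℝ≥0∞ := fun z => ‖v - z.1‖ₑ ^ P⁻¹ *
      ((φ (T (v, z)).1 * wt α (T (v, z)).1) * (ψ (T (v, z)).2 * wt α (T (v, z)).2)) with hF
    set G : Vel d × Sph d → ℝ≥0∞ := fun z => ‖v - z.1‖ₑ ^ P'⁻¹ *
      (wt (-α) (T (v, z)).1 * wt (-α) (T (v, z)).2) with hG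
    have hTv : Measurable fun z => T (v, z) := hTm.comp measurable_prodMk_left
    have hFm : Measurable F := by fun_prop
    have hGm : Measurable G := by fun_prop
    have h1 : collInt T φ ψ v = ∫⁻ z, (F * G) z ∂(collMeasure d) := by
      refine lintegral_congr fun z => ?_
      have e1 : ‖v - z.1‖ₑ = ‖v - z.1‖ₑ ^ P⁻¹ * ‖v - z.1‖ₑ ^ P'⁻¹ := by
        rw [← ENNReal.rpow_add_of_nonneg _ _ (by positivity) (by positivity),
          hconj.inv_add_inv_eq_one, ENNReal.rpow_one]
      have e2 : ∀ w : Vel d, wt α w * wt (-α) w = 1 := by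
        intro w; rw [← wt_add, add_neg_cancel, wt_zero]
      calc _ = ‖v - z.1‖ₑ * ((φ (T (v, z)).1 * (wt α (T (v, z)).1 * wt (-α) (T (v, z)).1)) *
            (ψ (T (v, z)).2 * (wt α (T (v, z)).2 * wt (-α) (T (v, z)).2))) := by
            rw [e2, e2, mul_one, mul_one]
        _ = _ := by
            conv_lhs => rw [e1]
            simp only [Pi.mul_apply, hF, hG]
            ring
    have h2 := ENNReal.lintegral_mul_le_Lp_mul_Lq (collMeasure d) hconj hFm.aemeasurable
      hGm.aemeasurable
    have hFp : ∀ z, F z ^ P = ‖v - z.1‖ₑ * ((φ (T (v, z)).1 * wt α (T (v, z)).1) ^ P *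
        (ψ (T (v, z)).2 * wt α (T (v, z)).2) ^ P) := by
      intro z
      simp only [hF]
      rw [ENNReal.mul_rpow_of_nonneg _ _ hP0.le, ENNReal.mul_rpow_of_nonneg _ _ hP0.le,
        ← ENNReal.rpow_mul, inv_mul_cancel₀ hP0.ne', ENNReal.rpow_one]
    have hGp : ∀ z, G z ^ P' = ‖v - z.1‖ₑ * (wt (-(α * P')) (T (v, z)).1 *
        wt (-(α * P')) (T (v, z)).2) := by
      intro z
      simp only [hG]
      rw [ENNReal.mul_rpow_of_nonneg _ _ hP'0.le, ENNReal.mul_rpow_of_nonneg _ _ hP'0.le,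
        ← ENNReal.rpow_mul, inv_mul_cancel₀ hP'0.ne', ENNReal.rpow_one, wt_rpow, wt_rpow, neg_mul]
    simp_rw [hFp, hGp] at h2
    rw [← h1] at h2
    change collInt T φ ψ v ≤ (collInt T (fun v => (φ v * wt α v) ^ P)
      (fun v => (ψ v * wt α v) ^ P) v) ^ (1 / P) * _ at h2
    grw [hker v] at h2
    rw [hinv]
    set J := collInt T (fun v => (φ v * wt α v) ^ P) (fun v => (ψ v * wt α v) ^ P) v
    calc (collInt T φ ψ v * wt (α - P'⁻¹) v) ^ P
        ≤ (J ^ (1 / P) * (K * wt (1 - α * P') v) ^ (1 / P') * wt (α - P'⁻¹) v) ^ P := by gcongr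
      _ = (J ^ (1 / P) * K ^ (1 / P')) ^ P := by
          congr 1
          rw [ENNReal.mul_rpow_of_nonneg _ _ (by positivity), wt_rpow, mul_assoc, mul_assoc,
            ← wt_add]
          -- The weight ⟨v⟩^{α - 1/P'} cancels the P'-th root of the kernel decay exactly.
          have : (1 - α * P') * (1 / P') + (α - P'⁻¹) = 0 := by field_simp; ring
          rw [this, wt_zero, mul_one]
      _ = K ^ (P / P') * J := by
          rw [ENNReal.mul_rpow_of_nonneg _ _ hP0.le, ← ENNReal.rpow_mul, ← ENNReal.rpow_mul,
            one_div_mul_cancel hP0.ne', ENNReal.rpow_one, mul_comm, one_div_mul_eq_div]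

/-- Since T preserves the relative speed, the change of variables removes it, and |v - v_*| ≤ ⟨v⟩ +
⟨v_*⟩ splits the double integral into products. -/
lemma lintegral_collInt_le {T : Vel d × Vel d × Sph d → Vel d × Vel d} (hT : IsCollisionMap T)
    {Φ Ψ : Vel d → ℝ≥0∞} (hΦ : Measurable Φ) (hΨ : Measurable Ψ) :
    ∫⁻ v, collInt T Φ Ψ v ≤ sphereMass d *
      ((∫⁻ v, Φ v * wt 1 v) * (∫⁻ v, Ψ v) + (∫⁻ v, Φ v) * (∫⁻ v, Ψ v * wt 1 v)) := by
  have hTm := hT.measurable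
  have hm : Measurable fun z : Vel d × Vel d × Sph d =>
      ‖z.1 - z.2.1‖ₑ * (Φ (T z).1 * Ψ (T z).2) := by fun_prop
  have h1 : ∫⁻ v, collInt T Φ Ψ v = ∫⁻ z, ‖(T z).1 - (T z).2‖ₑ * (Φ (T z).1 * Ψ (T z).2)
      ∂(volume.prod (collMeasure d)) := by
    have : ∀ z, ‖(T z).1 - (T z).2‖ₑ = ‖z.1 - z.2.1‖ₑ := fun z => by
      rw [← ofReal_norm, ← ofReal_norm, hT.norm_sub z]
    simp_rw [this]
    rw [lintegral_prod _ hm.aemeasurable]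
    rfl
  rw [h1, hT.lintegral_comp (fun y => ‖y.1 - y.2‖ₑ * (Φ y.1 * Ψ y.2)) (by fun_prop)]
  gcongr
  have hw : ∀ w : Vel d, ‖w‖ₑ ≤ wt 1 w := by
    intro w
    rw [wt, Real.rpow_one, ← ofReal_norm]
    exact ENNReal.ofReal_le_ofReal (norm_le_bracket w)
  calc ∫⁻ y, ‖y.1 - y.2‖ₑ * (Φ y.1 * Ψ y.2) ∂((volume : Measure (Vel d)).prod volume)
      ≤ ∫⁻ y, ((Φ y.1 * wt 1 y.1) * Ψ y.2 + Φ y.1 * (Ψ y.2 * wt 1 y.2))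
          ∂((volume : Measure (Vel d)).prod volume) := by
        refine lintegral_mono fun y => ?_
        dsimp only
        grw [enorm_sub_le, hw y.1, hw y.2]
        exact le_of_eq (by ring)
    _ = _ := by
        rw [lintegral_add_left (by fun_prop),
          lintegral_prod_mul (f := fun v => Φ v * wt 1 v) (by fun_prop) (by fun_prop),
          lintegral_prod_mul (g := fun v => Ψ v * wt 1 v) (by fun_prop) (by fun_prop)]

lemma eLpNorm_eq_lintegral_rpow {p : ℝ≥0∞} (h0 : p ≠ 0) (h1 : p ≠ ∞) (f : Vel d → ℝ≥0∞) :
    eLpNorm f p volume = (∫⁻ v, f v ^ p.toReal) ^ (p.toReal)⁻¹ := by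
  rw [eLpNorm_eq_lintegral_rpow_enorm_toReal h0 h1, one_div]
  simp

/-- For p < ∞ the pointwise Hölder bound is integrated in v. The factor ⟨v⟩ from the relative speed
falls on one of the two functions and becomes ⟨v⟩^{1/p} after the p-th root. For p = ∞ the essential
suprema come out of the integral and the kernel bound with β = α remains. -/
theorem eLpNorm_collInt_le {T : Vel d × Vel d × Sph d → Vel d × Vel d} (hT : IsCollisionMap T)
    {p p' : ℝ≥0∞} (hp : ENNReal.HolderConjugate p p') {α : ℝ}
    (hα : 2 + (d : ℝ) * (p'⁻¹).toReal < α) :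
    ∃ C : ℝ≥0∞, C < ∞ ∧ ∀ φ ψ : Vel d → ℝ≥0∞, AEMeasurable φ → AEMeasurable ψ →
      eLpNorm (fun v => collInt T φ ψ v * wt (α - (p'⁻¹).toReal) v) p volume ≤
        C * (eLpNorm (fun v => φ v * wt α v) p volume *
            eLpNorm (fun v => ψ v * wt (α + (p⁻¹).toReal) v) p volume +
          eLpNorm (fun v => φ v * wt (α + (p⁻¹).toReal) v) p volume *
            eLpNorm (fun v => ψ v * wt α v) p volume) := by
  have hsum := hp.inv_add_inv_eq_one
  -- Both sides depend only on the almost-everywhere classes of φ and ψ, so measurable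
  -- representatives suffice.
  suffices H : ∃ C : ℝ≥0∞, C < ∞ ∧ ∀ φ ψ : Vel d → ℝ≥0∞, Measurable φ → Measurable ψ →
      eLpNorm (fun v => collInt T φ ψ v * wt (α - (p'⁻¹).toReal) v) p volume ≤
        C * (eLpNorm (fun v => φ v * wt α v) p volume *
            eLpNorm (fun v => ψ v * wt (α + (p⁻¹).toReal) v) p volume +
          eLpNorm (fun v => φ v * wt (α + (p⁻¹).toReal) v) p volume *
            eLpNorm (fun v => ψ v * wt α v) p volume) by
    obtain ⟨C, hC, h⟩ := H
    refine ⟨C, hC, fun φ ψ hφ hψ => ?_⟩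
    have h1 := h (hφ.mk φ) (hψ.mk ψ) hφ.measurable_mk hψ.measurable_mk
    have e1 : ∀ (χ : Vel d → ℝ≥0∞) (hχ : AEMeasurable χ) (a : ℝ),
        eLpNorm (fun v => hχ.mk χ v * wt a v) p volume =
          eLpNorm (fun v => χ v * wt a v) p volume := by
      intro χ hχ a
      refine eLpNorm_congr_ae ?_
      filter_upwards [hχ.ae_eq_mk] with v hv
      rw [hv]
    have e2 : eLpNorm (fun v => collInt T (hφ.mk φ) (hψ.mk ψ) v * wt (α - (p'⁻¹).toReal) v) p
        volume = eLpNorm (fun v => collInt T φ ψ v * wt (α - (p'⁻¹).toReal) v) p volume := by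
      refine eLpNorm_congr_ae ?_
      filter_upwards [collInt_congr_ae hT hφ.ae_eq_mk hψ.ae_eq_mk] with v hv
      rw [hv]
    simpa only [e1, e2] using h1
  rcases eq_or_ne p ∞ with rfl | hpt
  · have hp'1 : p'⁻¹ = 1 := by simpa using hsum
    simp only [hp'1, ENNReal.toReal_one, mul_one, ENNReal.inv_top, ENNReal.toReal_zero,
      add_zero] at hα ⊢
    obtain ⟨K, hK, hker⟩ := hT.kernel α (by linarith)
    refine ⟨K, hK, fun φ ψ hφ hψ => ?_⟩
    set A := eLpNorm (fun v => φ v * wt α v) ∞ volume with hA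
    set B := eLpNorm (fun v => ψ v * wt α v) ∞ volume with hB
    have hφA : ∀ᵐ v, φ v ≤ A * wt (-α) v := by
      filter_upwards [enorm_ae_le_eLpNormEssSup (fun v => φ v * wt α v) volume] with v hv
      rw [eLpNorm_exponent_top] at hA
      calc φ v = φ v * wt α v * wt (-α) v := by
            rw [mul_assoc, ← wt_add, add_neg_cancel, wt_zero, mul_one]
        _ ≤ _ := by gcongr; rw [hA]; exact hv
    have hψB : ∀ᵐ v, ψ v ≤ B * wt (-α) v := by
      filter_upwards [enorm_ae_le_eLpNormEssSup (fun v => ψ v * wt α v) volume] with v hv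
      rw [eLpNorm_exponent_top] at hB
      calc ψ v = ψ v * wt α v * wt (-α) v := by
            rw [mul_assoc, ← wt_add, add_neg_cancel, wt_zero, mul_one]
        _ ≤ _ := by gcongr; rw [hB]; exact hv
    have h1 := hT.quasiMeasurePreserving_fst.ae hφA
    have h2 := hT.quasiMeasurePreserving_snd.ae hψB
    -- Since 1/∞ = 0, the two terms of the bound coincide and one is enough.
    refine le_trans ?_ (mul_le_mul_right (le_self_add (a := A * B)) K)
    rw [eLpNorm_exponent_top]
    refine eLpNormEssSup_le_of_ae_enorm_bound ?_
    filter_upwards [Measure.ae_ae_of_ae_prod h1, Measure.ae_ae_of_ae_prod h2] with v hv1 hv2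
    simp only [enorm_eq_self]
    have h3 : collInt T φ ψ v ≤ A * B * (K * wt (1 - α) v) := by
      calc collInt T φ ψ v ≤ ∫⁻ z, A * B * (‖v - z.1‖ₑ * (wt (-α) (T (v, z)).1 *
            wt (-α) (T (v, z)).2)) ∂(collMeasure d) := by
            refine lintegral_mono_ae ?_
            filter_upwards [hv1, hv2] with z hz1 hz2
            grw [hz1, hz2]
            exact le_of_eq (by ring)
        _ = A * B * ∫⁻ z, (‖v - z.1‖ₑ * (wt (-α) (T (v, z)).1 *
            wt (-α) (T (v, z)).2)) ∂(collMeasure d) := by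
            have hTv : Measurable fun z => T (v, z) := hT.measurable.comp measurable_prodMk_left
            have hv1 : Measurable fun z : Vel d × Sph d => ‖v - z.1‖ₑ := by fun_prop
            exact lintegral_const_mul _ (hv1.mul
              (((measurable_wt _).comp hTv.fst).mul ((measurable_wt _).comp hTv.snd)))
        _ ≤ _ := by grw [hker v]
    grw [h3]
    rw [mul_assoc, mul_assoc K, ← wt_add]
    rw [show 1 - α + (α - 1) = 0 by ring, wt_zero, mul_one, mul_comm]
  · have hp0 : p ≠ 0 := by
      rintro rfl
      simp at hsum
    have hp1 : 1 ≤ p := by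
      rw [← ENNReal.inv_le_one, ← hsum]; exact le_self_add
    set P := p.toReal with hP
    have hP1 : 1 ≤ P := by
      rw [hP, ← ENNReal.toReal_one]
      exact ENNReal.toReal_mono hpt hp1
    have hP0 : 0 < P := by linarith
    have ep : (p⁻¹).toReal = P⁻¹ := ENNReal.toReal_inv p
    have ep' : (p'⁻¹).toReal = 1 - P⁻¹ := by
      have h1 : p'⁻¹ ≠ ∞ := by
        intro h; rw [h] at hsum; simp at hsum
      have h2 : p⁻¹ ≠ ∞ := by simpa using hp0
      have := congrArg ENNReal.toReal hsum
      rw [ENNReal.toReal_add h2 h1, ep, ENNReal.toReal_one] at this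
      linarith
    rw [ep'] at hα ⊢
    rw [ep]
    obtain ⟨K, hK, hpt'⟩ := collInt_mul_wt_rpow_le hT hP1 hα
    refine ⟨(K * sphereMass d) ^ P⁻¹, ENNReal.rpow_lt_top_of_nonneg (by positivity)
      (ENNReal.mul_lt_top hK sphereMass_lt_top).ne, fun φ ψ hφ hψ => ?_⟩
    simp only [eLpNorm_eq_lintegral_rpow hp0 hpt, ← hP]
    have hΦ : Measurable fun v => (φ v * wt α v) ^ P := by fun_prop
    have hΨ : Measurable fun v => (ψ v * wt α v) ^ P := by fun_prop
    have e : ∀ (χ : Vel d → ℝ≥0∞), (∫⁻ v, (χ v * wt α v) ^ P * wt 1 v) =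
        ∫⁻ v, (χ v * wt (α + P⁻¹) v) ^ P := by
      intro χ
      refine lintegral_congr fun v => ?_
      rw [wt_add, ← mul_assoc, ENNReal.mul_rpow_of_nonneg _ (wt P⁻¹ v) hP0.le, wt_rpow,
        inv_mul_cancel₀ hP0.ne']
    have h1 : ∫⁻ v, (collInt T φ ψ v * wt (α - (1 - P⁻¹)) v) ^ P ≤ K * (sphereMass d *
        ((∫⁻ v, (φ v * wt (α + P⁻¹) v) ^ P) * (∫⁻ v, (ψ v * wt α v) ^ P) +
          (∫⁻ v, (φ v * wt α v) ^ P) * (∫⁻ v, (ψ v * wt (α + P⁻¹) v) ^ P))) := by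
      have h2 := lintegral_collInt_le hT hΦ hΨ
      rw [e, e] at h2
      calc _ ≤ ∫⁻ v, K * collInt T (fun v => (φ v * wt α v) ^ P)
            (fun v => (ψ v * wt α v) ^ P) v := lintegral_mono fun v => hpt' φ ψ hφ hψ v
        _ = K * ∫⁻ v, collInt T (fun v => (φ v * wt α v) ^ P)
            (fun v => (ψ v * wt α v) ^ P) v := lintegral_const_mul _ (measurable_collInt hT hΦ hΨ)
        _ ≤ _ := by grw [h2]
    have hPi : 0 ≤ P⁻¹ := by positivity
    grw [h1]
    rw [← mul_assoc, ENNReal.mul_rpow_of_nonneg _ _ hPi]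
    gcongr
    -- The power 1/P ≤ 1 is subadditive.
    refine (ENNReal.rpow_add_le_add_rpow _ _ hPi (inv_le_one_of_one_le₀ hP1)).trans ?_
    rw [ENNReal.mul_rpow_of_nonneg _ _ hPi, ENNReal.mul_rpow_of_nonneg _ _ hPi, add_comm]

end Boltzmann

/-! ### The lower bound for the collision frequency. -/

namespace Boltzmann

open Set Metric

variable {d : ℕ}

lemma maxwellian_pos (v : Vel d) : 0 < maxwellian v := by
  unfold maxwellian; positivity

lemma maxwellian_neg (v : Vel d) : maxwellian (-v) = maxwellian v := by
  simp [maxwellian]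

/-- The inequality y^n/n! ≤ e^y with n = d + 2 and y = (1 + |v|²)/2 dominates the Gaussian by a
negative power of 1 + |v|²; one of the d + 2 powers absorbs the bracket and the others are
integrable. -/
lemma integrable_maxwellian_mul_bracket :
    Integrable fun v : Vel d => maxwellian v * bracket v := by
  have h := integrable_rpow_neg_one_add_norm_sq (E := Vel d) (μ := volume) (r := 2 * (d + 1))
    (by rw [finrank_euclideanSpace, Fintype.card_fin]; linarith [d.cast_nonneg (α := ℝ)])
  obtain ⟨C, hC⟩ : ∃ C : ℝ, ∀ t : ℝ, 0 ≤ t → (1 + t) ^ (d + 2) * Real.exp (-t / 2) ≤ C := by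
    refine ⟨(d + 2).factorial * 2 ^ (d + 2) * Real.exp (1 / 2), fun t ht => ?_⟩
    have h1 := Real.pow_div_factorial_le_exp ((1 + t) / 2) (by positivity) (d + 2)
    rw [div_le_iff₀ (by positivity), div_pow, div_le_iff₀ (by positivity)] at h1
    calc (1 + t) ^ (d + 2) * Real.exp (-t / 2)
        ≤ (Real.exp ((1 + t) / 2) * (d + 2).factorial * 2 ^ (d + 2)) * Real.exp (-t / 2) := by
          gcongr
      _ = (d + 2).factorial * 2 ^ (d + 2) * (Real.exp ((1 + t) / 2) * Real.exp (-t / 2)) := by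
          ring
      _ = _ := by rw [← Real.exp_add]; ring_nf
  refine (h.const_mul ((2 * Real.pi) ^ (-(d : ℝ) / 2) * C)).mono' ?_ (ae_of_all _ fun v => ?_)
  · have := measurable_bracket (d := d)
    unfold maxwellian
    exact Measurable.aestronglyMeasurable (by fun_prop)
  · have hb := bracket_pos v
    rw [Real.norm_of_nonneg (mul_pos (maxwellian_pos v) hb).le, maxwellian, mul_assoc, mul_assoc]
    refine mul_le_mul_of_nonneg_left ?_ (by positivity)
    have h1 := hC (‖v‖ ^ 2) (by positivity)
    have h2 : bracket v ≤ 1 + ‖v‖ ^ 2 := by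
      rw [← bracket_sq]; nlinarith [one_le_bracket v]
    have h3 : (1 + ‖v‖ ^ 2) ^ (-(2 * ((d : ℝ) + 1)) / 2) = ((1 + ‖v‖ ^ 2) ^ (d + 1))⁻¹ := by
      rw [← Real.rpow_natCast _ (d + 1), ← Real.rpow_neg (by positivity)]
      congr 1; push_cast; ring
    rw [h3, ← div_eq_mul_inv, le_div_iff₀ (by positivity)]
    calc Real.exp (-‖v‖ ^ 2 / 2) * bracket v * (1 + ‖v‖ ^ 2) ^ (d + 1)
        ≤ Real.exp (-‖v‖ ^ 2 / 2) * (1 + ‖v‖ ^ 2) * (1 + ‖v‖ ^ 2) ^ (d + 1) := by gcongr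
      _ = (1 + ‖v‖ ^ 2) ^ (d + 2) * Real.exp (-‖v‖ ^ 2 / 2) := by ring
      _ ≤ C := h1

lemma measurable_maxwellian : Measurable (maxwellian (d := d)) := by
  unfold maxwellian; fun_prop

lemma integrable_maxwellian_mul_norm_sub (v : Vel d) :
    Integrable fun w : Vel d => maxwellian w * ‖v - w‖ := by
  have hm := measurable_maxwellian (d := d)
  refine (integrable_maxwellian_mul_bracket.const_mul (2 * bracket v)).mono'
    (Measurable.aestronglyMeasurable (by fun_prop)) (ae_of_all _ fun w => ?_)
  have h0 := maxwellian_pos w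
  rw [Real.norm_of_nonneg (by positivity)]
  have h1 := norm_le_bracket v
  have h2 := norm_le_bracket w
  have h3 := one_le_bracket v
  have h4 := one_le_bracket w
  have h5 : ‖v - w‖ ≤ 2 * bracket v * bracket w := (norm_sub_le v w).trans (by nlinarith)
  calc _ ≤ maxwellian w * (2 * bracket v * bracket w) := by gcongr
    _ = _ := by ring

/-- As M is even, 2ν(v) is the integral of M(w)(|v - w| + |v + w|). The parenthesis is at least 2|v|
and at least 2|w|, so ν(v) is at least m₀|v| and at least m₁, the moments of M of order 0 and 1. -/
lemma exists_mul_bracket_le_collFreq (hd : 0 < d) :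
    ∃ c : ℝ, 0 < c ∧ ∀ v : Vel d, c * bracket v ≤ collFreq v := by
  have : Nonempty (Fin d) := ⟨⟨0, hd⟩⟩
  have hm := measurable_maxwellian (d := d)
  have hi0 : Integrable fun w : Vel d => maxwellian w := by
    refine integrable_maxwellian_mul_bracket.mono' hm.aestronglyMeasurable
      (ae_of_all _ fun w => ?_)
    rw [Real.norm_of_nonneg (maxwellian_pos w).le]
    exact le_mul_of_one_le_right (maxwellian_pos w).le (one_le_bracket w)
  have hi1 : Integrable fun w : Vel d => maxwellian w * ‖w‖ := by
    simpa using integrable_maxwellian_mul_norm_sub (0 : Vel d)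
  set m₀ := ∫ w : Vel d, maxwellian w with hm₀
  set m₁ := ∫ w : Vel d, maxwellian w * ‖w‖ with hm₁
  have h0 : 0 < m₀ := by
    rw [hm₀, integral_pos_iff_support_of_nonneg (fun w => (maxwellian_pos w).le) hi0]
    have : Function.support (fun w : Vel d => maxwellian w) = univ :=
      eq_univ_of_forall fun w => (maxwellian_pos w).ne'
    rw [this]
    simp
  have h1 : 0 < m₁ := by
    rw [hm₁, integral_pos_iff_support_of_nonneg
      (fun w => mul_nonneg (maxwellian_pos w).le (norm_nonneg w)) hi1]
    have : Function.support (fun w : Vel d => maxwellian w * ‖w‖) = {0}ᶜ := by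
      ext w; simp [(maxwellian_pos w).ne']
    rw [this, measure_compl (measurableSet_singleton _) (by simp)]
    simp
  have hsym : ∀ v : Vel d, ∫ w, maxwellian w * ‖v + w‖ = collFreq v := by
    intro v
    rw [collFreq, ← integral_neg_eq_self]
    simp [maxwellian_neg, sub_eq_add_neg]
  have hip : ∀ v : Vel d, Integrable fun w : Vel d => maxwellian w * ‖v + w‖ := by
    intro v
    have := (integrable_maxwellian_mul_norm_sub v).comp_neg
    simpa [maxwellian_neg] using this
  have hlow0 : ∀ v : Vel d, m₀ * ‖v‖ ≤ collFreq v := by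
    intro v
    have : ∫ w : Vel d, 2 * ‖v‖ * maxwellian w ≤
        ∫ w : Vel d, (maxwellian w * ‖v - w‖ + maxwellian w * ‖v + w‖) := by
      refine integral_mono (hi0.const_mul _)
        ((integrable_maxwellian_mul_norm_sub v).add (hip v)) fun w => ?_
      have h2 : 2 * ‖v‖ ≤ ‖v - w‖ + ‖v + w‖ := by
        have := norm_add_le (v - w) (v + w)
        have e : v - w + (v + w) = (2 : ℝ) • v := by module
        rw [e, norm_smul] at this
        simpa using this
      have := maxwellian_pos w
      simp only
      nlinarith
    rw [integral_const_mul, integral_add (integrable_maxwellian_mul_norm_sub v) (hip v),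
      hsym, ← collFreq] at this
    linarith
  have hlow1 : ∀ v : Vel d, m₁ ≤ collFreq v := by
    intro v
    have : ∫ w : Vel d, 2 * (maxwellian w * ‖w‖) ≤
        ∫ w : Vel d, (maxwellian w * ‖v - w‖ + maxwellian w * ‖v + w‖) := by
      refine integral_mono (hi1.const_mul _)
        ((integrable_maxwellian_mul_norm_sub v).add (hip v)) fun w => ?_
      have h2 : 2 * ‖w‖ ≤ ‖v - w‖ + ‖v + w‖ := by
        have := norm_sub_le (v + w) (v - w)
        have e : v + w - (v - w) = (2 : ℝ) • w := by module
        rw [e, norm_smul] at this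
        simpa [add_comm] using this
      have := maxwellian_pos w
      simp only
      nlinarith
    rw [integral_const_mul, integral_add (integrable_maxwellian_mul_norm_sub v) (hip v),
      hsym, ← collFreq] at this
    linarith
  -- Both m|v| and m, for m the smaller moment, lie below ν(v), hence so does half their sum, and
  -- ⟨v⟩ ≤ 1 + |v|.
  refine ⟨min m₀ m₁ / 2, by positivity, fun v => ?_⟩
  have h2 := hlow0 v
  have h3 := hlow1 v
  have h4 := bracket_le_one_add_norm v
  have h5 : min m₀ m₁ * ‖v‖ ≤ m₀ * ‖v‖ := by gcongr; exact min_le_left _ _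
  have h6 := min_le_right m₀ m₁
  have h7 : 0 < min m₀ m₁ := by positivity
  nlinarith

lemma collFreq_nonneg (v : Vel d) : 0 ≤ collFreq v :=
  integral_nonneg fun w => mul_nonneg (maxwellian_pos w).le (norm_nonneg _)

end Boltzmann

/-! ### Minkowski's integral inequality in L². -/

section Minkowski

variable {X Z : Type*} [MeasurableSpace X] [MeasurableSpace Z]

lemma lintegral_mul_le_sqrt_mul_sqrt {μ : Measure X} {f g : X → ℝ≥0∞} (hf : AEMeasurable f μ)
    (hg : AEMeasurable g μ) :
    ∫⁻ x, f x * g x ∂μ ≤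
      (∫⁻ x, f x ^ 2 ∂μ) ^ (1 / 2 : ℝ) * (∫⁻ x, g x ^ 2 ∂μ) ^ (1 / 2 : ℝ) := by
  have := ENNReal.lintegral_mul_le_Lp_mul_Lq μ Real.HolderConjugate.two_two hf hg
  simpa using this

lemma rpow_half_sq (a : ℝ≥0∞) : (a ^ (1 / 2 : ℝ)) ^ 2 = a := by
  rw [← ENNReal.rpow_natCast, ← ENNReal.rpow_mul]; norm_num

lemma sq_rpow_half (a : ℝ≥0∞) : (a ^ 2) ^ (1 / 2 : ℝ) = a := by
  rw [← ENNReal.rpow_natCast, ← ENNReal.rpow_mul]; norm_num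

/-- Minkowski's integral inequality in `L²`. -/
theorem sqrt_lintegral_lintegral_sq_le {μ : Measure X} {ν : Measure Z} [SFinite μ] [SFinite ν]
    {f : X × Z → ℝ≥0∞} (hf : AEMeasurable f (μ.prod ν)) :
    (∫⁻ x, (∫⁻ z, f (x, z) ∂ν) ^ 2 ∂μ) ^ (1 / 2 : ℝ) ≤
      ∫⁻ z, (∫⁻ x, f (x, z) ^ 2 ∂μ) ^ (1 / 2 : ℝ) ∂ν := by
  wlog hm : Measurable f generalizing f
  · have h := this (f := hf.mk f) hf.measurable_mk.aemeasurable hf.measurable_mk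
    have h1 := Measure.ae_ae_of_ae_prod hf.ae_eq_mk
    have h2 := Measure.ae_ae_of_ae_prod
      (Measure.measurePreserving_swap.quasiMeasurePreserving.ae hf.ae_eq_mk :
        ∀ᵐ z ∂(ν.prod μ), f z.swap = hf.mk f z.swap)
    have e1 : ∫⁻ x, (∫⁻ z, f (x, z) ∂ν) ^ 2 ∂μ = ∫⁻ x, (∫⁻ z, hf.mk f (x, z) ∂ν) ^ 2 ∂μ := by
      refine lintegral_congr_ae ?_
      filter_upwards [h1] with x hx
      rw [lintegral_congr_ae hx]
    have e2 : ∫⁻ z, (∫⁻ x, f (x, z) ^ 2 ∂μ) ^ (1 / 2 : ℝ) ∂ν =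
        ∫⁻ z, (∫⁻ x, hf.mk f (x, z) ^ 2 ∂μ) ^ (1 / 2 : ℝ) ∂ν := by
      refine lintegral_congr_ae ?_
      filter_upwards [h2] with z hz
      congr 1
      refine lintegral_congr_ae ?_
      filter_upwards [hz] with x hx
      simp only [Prod.swap_prod_mk] at hx
      rw [hx]
    rwa [e1, e2]
  set N : Z → ℝ≥0∞ := fun z => (∫⁻ x, f (x, z) ^ 2 ∂μ) ^ (1 / 2 : ℝ) with hN
  have hNm : Measurable N := by
    have : Measurable fun z => ∫⁻ x, f (x, z) ^ 2 ∂μ :=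
      (hm.pow_const 2).lintegral_prod_left'
    fun_prop
  -- The square is expanded into a double integral in z and z', and the x integral, taken first, is
  -- bounded by the Cauchy–Schwarz inequality. No finiteness is needed.
  have key : ∫⁻ x, (∫⁻ z, f (x, z) ∂ν) ^ 2 ∂μ ≤ (∫⁻ z, N z ∂ν) ^ 2 := by
    calc ∫⁻ x, (∫⁻ z, f (x, z) ∂ν) ^ 2 ∂μ
        = ∫⁻ x, ∫⁻ z, ∫⁻ z', f (x, z) * f (x, z') ∂ν ∂ν ∂μ := by
          refine lintegral_congr fun x => ?_
          have h1 : Measurable fun z => f (x, z) := hm.comp measurable_prodMk_left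
          rw [sq, ← lintegral_mul_const _ h1]
          exact lintegral_congr fun z => (lintegral_const_mul _ h1).symm
      _ = ∫⁻ z, ∫⁻ z', ∫⁻ x, f (x, z) * f (x, z') ∂μ ∂ν ∂ν := by
          have h2 : Measurable fun q : (X × Z) × Z => f (q.1.1, q.1.2) * f (q.1.1, q.2) :=
            (hm.comp (by fun_prop)).mul (hm.comp (by fun_prop))
          rw [lintegral_lintegral_swap h2.lintegral_prod_right'.aemeasurable]
          refine lintegral_congr fun z => ?_
          refine lintegral_lintegral_swap (f := fun x z' => f (x, z) * f (x, z')) ?_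
          exact ((hm.comp (by fun_prop)).mul (hm.comp (by fun_prop))).aemeasurable
      _ ≤ ∫⁻ z, ∫⁻ z', N z * N z' ∂ν ∂ν := by
          refine lintegral_mono fun z => lintegral_mono fun z' => ?_
          exact lintegral_mul_le_sqrt_mul_sqrt
            (hm.comp (by fun_prop : Measurable fun x => (x, z))).aemeasurable
            (hm.comp (by fun_prop : Measurable fun x => (x, z'))).aemeasurable
      _ = (∫⁻ z, N z ∂ν) ^ 2 := by
          simp_rw [lintegral_const_mul _ hNm]
          rw [lintegral_mul_const _ hNm, sq]
  calc _ ≤ ((∫⁻ z, N z ∂ν) ^ 2) ^ (1 / 2 : ℝ) := by gcongr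
    _ = _ := sq_rpow_half _

end Minkowski

/-! ### Weighted L² norms as countable suprema of functionals. -/

section Dual

/-- A dense sequence of the closed unit ball works: a bound on |⟨y, g⟩| extends from it to the whole
ball by continuity, in particular to g/‖g‖. -/
lemma exists_norming_sequence (H : Type*) [NormedAddCommGroup H] [InnerProductSpace ℂ H]
    [SecondCountableTopology H] :
    ∃ ψ : ℕ → H, ∀ g : H, ‖g‖ₑ = ⨆ k, ‖inner ℂ (ψ k) g‖ₑ := by
  let B := Metric.closedBall (0 : H) 1
  have : Nonempty B := ⟨⟨0, by simp [B]⟩⟩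
  refine ⟨fun k => (TopologicalSpace.denseSeq B k : H), fun g => le_antisymm ?_ ?_⟩
  · set M := ⨆ k, ‖inner ℂ (TopologicalSpace.denseSeq B k : H) g‖ₑ with hM
    have h1 : ∀ y : B, ‖inner ℂ (y : H) g‖ₑ ≤ M := by
      refine fun y => (TopologicalSpace.denseRange_denseSeq B).induction_on
        (p := fun y : B => ‖inner ℂ (y : H) g‖ₑ ≤ M) y ?_ ?_
      · refine isClosed_le ?_ continuous_const
        exact continuous_enorm.comp (continuous_subtype_val.inner continuous_const)
      · intro k
        exact le_iSup (fun k => ‖inner ℂ (TopologicalSpace.denseSeq B k : H) g‖ₑ) k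
    rcases eq_or_ne g 0 with rfl | hg
    · simp
    · have hgn : 0 < ‖g‖ := norm_pos_iff.2 hg
      have hmem : ((‖g‖⁻¹ : ℝ) : ℂ) • g ∈ B := by
        rw [mem_closedBall_zero_iff, norm_smul, Complex.norm_real, norm_inv, norm_norm,
          inv_mul_cancel₀ hgn.ne']
      have h2 := h1 ⟨_, hmem⟩
      have h3 : ‖inner ℂ (((‖g‖⁻¹ : ℝ) : ℂ) • g) g‖ = ‖g‖ := by
        rw [inner_smul_left, inner_self_eq_norm_sq_to_K, norm_mul, RCLike.norm_conj,
          Complex.norm_real, norm_inv, norm_norm]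
        simp
        field_simp
      rwa [← ofReal_norm, h3, ofReal_norm] at h2
  · refine iSup_le fun k => ?_
    have h1 : ‖(TopologicalSpace.denseSeq B k : H)‖ ≤ 1 :=
      mem_closedBall_zero_iff.1 (TopologicalSpace.denseSeq B k).2
    rw [← ofReal_norm, ← ofReal_norm]
    refine ENNReal.ofReal_le_ofReal ((norm_inner_le_norm _ _).trans ?_)
    exact mul_le_of_le_one_left (norm_nonneg _) h1

variable {X K : Type*} [MeasurableSpace X] [MeasurableSpace K]

lemma eLpNorm_two_eq {μ : Measure K} {E : Type*} [NormedAddCommGroup E] (f : K → E) :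
    eLpNorm f 2 μ = (∫⁻ ξ, ‖f ξ‖ₑ ^ 2 ∂μ) ^ (1 / 2 : ℝ) := by
  rw [eLpNorm_eq_lintegral_rpow_enorm_toReal (by simp) (by simp)]
  simp

lemma iSup_ofReal_min_sq {b : ℝ} (hb : 0 ≤ b) :
    ⨆ n : ℕ, ENNReal.ofReal (min (√b) n ^ 2) = ENNReal.ofReal b := by
  refine le_antisymm (iSup_le fun n => ENNReal.ofReal_le_ofReal ?_) ?_
  · calc min (√b) n ^ 2 ≤ √b ^ 2 := by
          gcongr
          exact min_le_left _ _
      _ = b := Real.sq_sqrt hb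
  · obtain ⟨n, hn⟩ := exists_nat_ge (√b)
    refine le_iSup_of_le n ?_
    rw [min_eq_left hn, Real.sq_sqrt hb]

/-- A weighted `L²` norm of the image of an isometry is the supremum of countably many
linear functionals. -/
theorem exists_dual_family {vol : Measure X} {μ : Measure K}
    [SecondCountableTopology (Lp ℂ 2 μ)] (F : Lp ℂ 2 vol →ₗᵢ[ℂ] Lp ℂ 2 μ) {b : K → ℝ}
    (hb : Measurable b) (hb0 : ∀ ξ, 0 ≤ b ξ) :
    ∃ χ : ℕ × ℕ → X → ℂ, (∀ k, MemLp (χ k) 2 vol) ∧ ∀ u : Lp ℂ 2 vol,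
      (∫⁻ ξ, ENNReal.ofReal (b ξ) * ‖F u ξ‖ₑ ^ 2 ∂μ) ^ (1 / 2 : ℝ) =
        ⨆ k, ‖∫ x, χ k x * u x ∂vol‖ₑ := by
  obtain ⟨ψ, hψ⟩ := exists_norming_sequence (Lp ℂ 2 μ)
  -- Multiplication by √b need not preserve L². Its truncations at n do, and monotone convergence
  -- recovers the weighted norm as a supremum over n.
  set w : ℕ → K → ℝ := fun n ξ => min (√(b ξ)) n with hw
  have hwm : ∀ n, Measurable (w n) := fun n => by simp only [hw]; fun_prop
  have hw0 : ∀ n ξ, 0 ≤ w n ξ := fun n ξ => le_min (Real.sqrt_nonneg _) n.cast_nonneg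
  have hmul : ∀ n (g : Lp ℂ 2 μ), MemLp (fun ξ => (w n ξ : ℂ) * g ξ) 2 μ := by
    intro n g
    refine (Lp.memLp g).of_le_mul (c := n) ?_ (ae_of_all _ fun ξ => ?_)
    · exact (Complex.measurable_ofReal.comp (hwm n)).aestronglyMeasurable.mul
        (Lp.aestronglyMeasurable g)
    · rw [norm_mul, Complex.norm_real, Real.norm_of_nonneg (hw0 n ξ)]
      gcongr
      exact min_le_right _ _
  -- Since the truncated weight is real, pairing w_n F u with ψ_k amounts to pairing u with F*(w_n
  -- ψ_k).
  set φ : ℕ × ℕ → Lp ℂ 2 vol := fun k =>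
    F.toContinuousLinearMap.adjoint ((hmul k.1 (ψ k.2)).toLp _) with hφ
  refine ⟨fun k x => starRingEnd ℂ (φ k x), fun k => (Lp.memLp (φ k)).star, fun u => ?_⟩
  have hpair : ∀ n k, ∫ x, starRingEnd ℂ (φ (n, k) x) * u x ∂vol =
      inner ℂ (ψ k) ((hmul n (F u)).toLp _) := by
    intro n k
    have h1 : ∫ x, starRingEnd ℂ (φ (n, k) x) * u x ∂vol = inner ℂ (φ (n, k)) u := by
      rw [L2.inner_def]
      simp [mul_comm]
    rw [h1, hφ]
    simp only
    rw [ContinuousLinearMap.adjoint_inner_left, L2.inner_def, L2.inner_def]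
    refine integral_congr_ae ?_
    filter_upwards [(hmul n (ψ k)).coeFn_toLp, (hmul n (F u)).coeFn_toLp] with ξ h2 h3
    rw [h2, h3]
    simp
    ring
  have hnorm : ∀ n, ‖(hmul n (F u)).toLp _‖ₑ =
      (∫⁻ ξ, ENNReal.ofReal (w n ξ ^ 2) * ‖F u ξ‖ₑ ^ 2 ∂μ) ^ (1 / 2 : ℝ) := by
    intro n
    rw [Lp.enorm_toLp, eLpNorm_two_eq]
    congr 1
    refine lintegral_congr fun ξ => ?_
    rw [enorm_mul, mul_pow, ENNReal.ofReal_pow (hw0 n ξ)]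
    congr 2
    rw [← ofReal_norm, Complex.norm_real, Real.norm_of_nonneg (hw0 n ξ)]
  have hFm : AEMeasurable (fun ξ => ‖F u ξ‖ₑ ^ 2) μ :=
    (Lp.aestronglyMeasurable (F u)).enorm.pow_const 2
  have hmono : ∀ ξ, Monotone fun n => ENNReal.ofReal (w n ξ ^ 2) * ‖F u ξ‖ₑ ^ 2 := by
    intro ξ m n hmn
    have := hw0 m ξ
    dsimp only
    gcongr
    exact min_le_min le_rfl (Nat.cast_le.2 hmn)
  have hsup : ∫⁻ ξ, ENNReal.ofReal (b ξ) * ‖F u ξ‖ₑ ^ 2 ∂μ =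
      ⨆ n, ∫⁻ ξ, ENNReal.ofReal (w n ξ ^ 2) * ‖F u ξ‖ₑ ^ 2 ∂μ := by
    have hm : ∀ n, AEMeasurable (fun ξ => ENNReal.ofReal (w n ξ ^ 2) * ‖F u ξ‖ₑ ^ 2) μ :=
      fun n => (((hwm n).pow_const 2).ennreal_ofReal).aemeasurable.mul hFm
    rw [← lintegral_iSup' hm (ae_of_all _ hmono)]
    refine lintegral_congr fun ξ => ?_
    rw [← ENNReal.iSup_mul, iSup_ofReal_min_sq (hb0 ξ)]
  rw [hsup, iSup_prod]
  have h := (ENNReal.orderIsoRpow (1 / 2) (by norm_num)).map_iSup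
    (fun n => ∫⁻ ξ, ENNReal.ofReal (w n ξ ^ 2) * ‖F u ξ‖ₑ ^ 2 ∂μ)
  simp only [ENNReal.orderIsoRpow_apply] at h
  rw [h]
  refine iSup_congr fun n => ?_
  rw [← hnorm, hψ]
  exact iSup_congr fun k => by rw [hpair]

end Dual

/-! ### Products in weighted Fourier spaces. -/

section Algebra

variable {X K : Type*} [MeasurableSpace X] [MeasurableSpace K] [AddCommGroup K]
  [MeasurableAdd₂ K] [MeasurableNeg K]

/-- Young's inequality `L² * L¹ ⊆ L²`. -/
lemma sqrt_lintegral_conv_sq_le (μ : Measure K) [SFinite μ] [μ.IsAddLeftInvariant]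
    {A B : K → ℝ≥0∞} (hA : Measurable A) (hB : Measurable B) :
    (∫⁻ ξ, (∫⁻ η, A (ξ - η) * B η ∂μ) ^ 2 ∂μ) ^ (1 / 2 : ℝ) ≤
      (∫⁻ ξ, A ξ ^ 2 ∂μ) ^ (1 / 2 : ℝ) * ∫⁻ η, B η ∂μ := by
  have hm : Measurable fun z : K × K => A (z.1 - z.2) * B z.2 := by fun_prop
  refine (sqrt_lintegral_lintegral_sq_le (f := fun z : K × K => A (z.1 - z.2) * B z.2)
    hm.aemeasurable).trans ?_
  rw [← lintegral_const_mul _ hB]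
  refine lintegral_mono fun η => le_of_eq ?_
  simp only [mul_pow]
  rw [lintegral_mul_const _ (by fun_prop),
    lintegral_sub_right_eq_self (fun ξ => A ξ ^ 2) η,
    ENNReal.mul_rpow_of_nonneg _ _ (by norm_num), sq_rpow_half]

/-- The product of two functions in a weighted `L²` space on the Fourier side, when the square root
`β` of the weight is quasi-subadditive and `β⁻¹` is square integrable. The hypothesis `hJ` says that
`F` inverts the synthesis operator `G ↦ ∫ G(ξ) e_ξ dξ`. -/
theorem weighted_fourier_mul {vol : Measure X} {μ : Measure K} [SFinite μ]
    [μ.IsAddLeftInvariant] [μ.IsNegInvariant] (F : Lp ℂ 2 vol →ₗᵢ[ℂ] Lp ℂ 2 μ) (e : K → X → ℂ)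
    (hem : ∀ x, Measurable fun ξ => e ξ x) (hen : ∀ ξ x, ‖e ξ x‖ = 1)
    (hea : ∀ ξ η x, e (ξ + η) x = e ξ x * e η x)
    (hJ : ∀ G : K → ℂ, Integrable G μ → ∀ hG : MemLp G 2 μ,
      ∃ hu : MemLp (fun x => ∫ ξ, G ξ * e ξ x ∂μ) 2 vol, F (hu.toLp _) = hG.toLp G)
    {β : K → ℝ≥0∞} (hβ : Measurable β) (hβ1 : ∀ ξ, 1 ≤ β ξ) (hβt : ∀ ξ, β ξ ≠ ∞) {C₀ : ℝ≥0∞}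
    (hβs : ∀ ξ η, β (ξ + η) ≤ C₀ * (β ξ + β η)) (hC₀ : C₀ ≠ ∞)
    (hβi : ∫⁻ ξ, (β ξ)⁻¹ ^ 2 ∂μ ≠ ∞) (u w : Lp ℂ 2 vol)
    (hu : ∫⁻ ξ, (β ξ * ‖F u ξ‖ₑ) ^ 2 ∂μ ≠ ∞) (hw : ∫⁻ ξ, (β ξ * ‖F w ξ‖ₑ) ^ 2 ∂μ ≠ ∞) :
    ∃ h : MemLp (fun x => u x * w x) 2 vol,
      (∫⁻ ξ, (β ξ * ‖F (h.toLp _) ξ‖ₑ) ^ 2 ∂μ) ^ (1 / 2 : ℝ) ≤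
        2 * C₀ * (∫⁻ ξ, (β ξ)⁻¹ ^ 2 ∂μ) ^ (1 / 2 : ℝ) *
          ((∫⁻ ξ, (β ξ * ‖F u ξ‖ₑ) ^ 2 ∂μ) ^ (1 / 2 : ℝ) *
            (∫⁻ ξ, (β ξ * ‖F w ξ‖ₑ) ^ 2 ∂μ) ^ (1 / 2 : ℝ)) := by
  set S := (∫⁻ ξ, (β ξ)⁻¹ ^ 2 ∂μ) ^ (1 / 2 : ℝ) with hS
  have hSt : S ≠ ∞ := ENNReal.rpow_ne_top_of_nonneg (by norm_num) hβi
  -- Cauchy–Schwarz against β⁻¹; this is where s > d/2 will enter.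
  have hL1 : ∀ u : Lp ℂ 2 vol, ∫⁻ ξ, ‖F u ξ‖ₑ ∂μ ≤
      S * (∫⁻ ξ, (β ξ * ‖F u ξ‖ₑ) ^ 2 ∂μ) ^ (1 / 2 : ℝ) := by
    intro u
    have hm : Measurable fun ξ => ‖F u ξ‖ₑ := (Lp.stronglyMeasurable (F u)).enorm
    refine le_trans (le_of_eq ?_) (lintegral_mul_le_sqrt_mul_sqrt (f := fun ξ => (β ξ)⁻¹)
      (g := fun ξ => β ξ * ‖F u ξ‖ₑ) hβ.inv.aemeasurable (hβ.mul hm).aemeasurable)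
    refine lintegral_congr fun ξ => ?_
    rw [← mul_assoc, ENNReal.inv_mul_cancel (one_pos.trans_le (hβ1 ξ)).ne' (hβt ξ), one_mul]
  have hint : ∀ u : Lp ℂ 2 vol, ∫⁻ ξ, (β ξ * ‖F u ξ‖ₑ) ^ 2 ∂μ ≠ ∞ → Integrable (F u) μ := by
    intro u hu
    refine ⟨Lp.aestronglyMeasurable _, (hL1 u).trans_lt ?_⟩
    exact ENNReal.mul_lt_top hSt.lt_top
      (ENNReal.rpow_lt_top_of_nonneg (by norm_num) hu)
  -- Fourier inversion: F is injective and takes the same value at u and at the synthesis of F u.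
  have hinv : ∀ u : Lp ℂ 2 vol, Integrable (F u) μ →
      ∀ᵐ x ∂vol, u x = ∫ ξ, F u ξ * e ξ x ∂μ := by
    intro u hi
    obtain ⟨h1, h2⟩ := hJ (F u) hi (Lp.memLp (F u))
    rw [Lp.toLp_coeFn] at h2
    have h3 := F.injective h2
    have h4 := h1.coeFn_toLp
    rw [h3] at h4
    exact h4
  have hiu := hint u hu
  have hiw := hint w hw
  set U : K → ℂ := ⇑(F u) with hU
  set W : K → ℂ := ⇑(F w) with hW
  have hUm : Measurable U := (Lp.stronglyMeasurable (F u)).measurable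
  have hWm : Measurable W := (Lp.stronglyMeasurable (F w)).measurable
  -- The convolution of U and W is the candidate for the transform of the product.
  set G : K → ℂ := fun ξ => ∫ η, U η * W (ξ - η) ∂μ with hG
  have hGi : Integrable G μ :=
    (hiu.convolution_integrand (ContinuousLinearMap.mul ℂ ℂ) hiw).integral_prod_left
  -- Quasi-subadditivity puts the weight on one of the two factors. After η ↦ ξ - η in one term,
  -- both are convolutions of a weighted function in L² with an unweighted one in L¹, ready for
  -- Young's inequality.
  have hpt : ∀ ξ, β ξ * ‖G ξ‖ₑ ≤ C₀ * (∫⁻ η, (β (ξ - η) * ‖U (ξ - η)‖ₑ) * ‖W η‖ₑ ∂μ) +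
      C₀ * ∫⁻ η, (β (ξ - η) * ‖W (ξ - η)‖ₑ) * ‖U η‖ₑ ∂μ := by
    intro ξ
    have h1 : ‖G ξ‖ₑ ≤ ∫⁻ η, ‖U η‖ₑ * ‖W (ξ - η)‖ₑ ∂μ := by
      refine (enorm_integral_le_lintegral_enorm _).trans (le_of_eq ?_)
      exact lintegral_congr fun η => enorm_mul _ _
    have h2 : ∫⁻ η, (β (ξ - η) * ‖U (ξ - η)‖ₑ) * ‖W η‖ₑ ∂μ =
        ∫⁻ η, (β η * ‖U η‖ₑ) * ‖W (ξ - η)‖ₑ ∂μ := by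
      rw [← lintegral_sub_left_eq_self _ ξ]
      simp only [sub_sub_cancel]
    rw [h2, ← mul_add, ← lintegral_add_left (by fun_prop), ← lintegral_const_mul' _ _ hC₀]
    grw [h1]
    rw [← lintegral_const_mul' _ _ (hβt ξ)]
    refine lintegral_mono fun η => ?_
    have h3 := hβs η (ξ - η)
    rw [add_sub_cancel] at h3
    dsimp only
    grw [h3]
    exact le_of_eq (by ring)
  have hAU : Measurable fun ξ => β ξ * ‖U ξ‖ₑ := by fun_prop
  have hAW : Measurable fun ξ => β ξ * ‖W ξ‖ₑ := by fun_prop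
  set Nu := (∫⁻ ξ, (β ξ * ‖U ξ‖ₑ) ^ 2 ∂μ) ^ (1 / 2 : ℝ) with hNu
  set Nw := (∫⁻ ξ, (β ξ * ‖W ξ‖ₑ) ^ 2 ∂μ) ^ (1 / 2 : ℝ) with hNw
  have hconv : ∀ A B : K → ℝ≥0∞, Measurable A → Measurable B →
      (∫⁻ ξ, (C₀ * ∫⁻ η, A (ξ - η) * B η ∂μ) ^ 2 ∂μ) ^ (1 / 2 : ℝ) ≤
        C₀ * ((∫⁻ ξ, A ξ ^ 2 ∂μ) ^ (1 / 2 : ℝ) * ∫⁻ η, B η ∂μ) := by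
    intro A B hA hB
    simp only [mul_pow]
    rw [lintegral_const_mul' _ _ (ENNReal.pow_ne_top hC₀),
      ENNReal.mul_rpow_of_nonneg _ _ (by norm_num), sq_rpow_half]
    gcongr
    exact sqrt_lintegral_conv_sq_le μ hA hB
  have hcm : ∀ A B : K → ℝ≥0∞, Measurable A → Measurable B →
      Measurable fun ξ => C₀ * ∫⁻ η, A (ξ - η) * B η ∂μ := by
    intro A B hA hB
    have : Measurable fun z : K × K => A (z.1 - z.2) * B z.2 := by fun_prop
    exact this.lintegral_prod_right'.const_mul _
  have hbound : (∫⁻ ξ, (β ξ * ‖G ξ‖ₑ) ^ 2 ∂μ) ^ (1 / 2 : ℝ) ≤ 2 * C₀ * S * (Nu * Nw) := by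
    have h1 := ENNReal.lintegral_Lp_add_le (μ := μ) (p := 2)
      (hcm _ _ hAU hWm.enorm).aemeasurable (hcm _ _ hAW hUm.enorm).aemeasurable one_le_two
    simp only [ENNReal.rpow_ofNat, Pi.add_apply] at h1
    calc _ ≤ _ := ENNReal.rpow_le_rpow (lintegral_mono fun ξ => by grw [hpt ξ]) (by norm_num)
      _ ≤ _ := h1
      _ ≤ C₀ * (Nu * ∫⁻ η, ‖W η‖ₑ ∂μ) + C₀ * (Nw * ∫⁻ η, ‖U η‖ₑ ∂μ) := by
          gcongr
          · exact hconv _ _ hAU hWm.enorm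
          · exact hconv _ _ hAW hUm.enorm
      _ ≤ C₀ * (Nu * (S * Nw)) + C₀ * (Nw * (S * Nu)) := by
          gcongr
          · exact hL1 w
          · exact hL1 u
      _ = _ := by ring
  have hG2 : MemLp G 2 μ := by
    refine ⟨hGi.aestronglyMeasurable, ?_⟩
    rw [eLpNorm_two_eq]
    calc (∫⁻ ξ, ‖G ξ‖ₑ ^ 2 ∂μ) ^ (1 / 2 : ℝ)
        ≤ (∫⁻ ξ, (β ξ * ‖G ξ‖ₑ) ^ 2 ∂μ) ^ (1 / 2 : ℝ) := by
          gcongr with ξ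
          exact le_mul_of_one_le_left zero_le (hβ1 ξ)
      _ ≤ _ := hbound
      _ < ∞ := by
          refine ENNReal.mul_lt_top (ENNReal.mul_lt_top (ENNReal.mul_lt_top (by simp)
            hC₀.lt_top) hSt.lt_top) (ENNReal.mul_lt_top ?_ ?_)
          · exact ENNReal.rpow_lt_top_of_nonneg (by norm_num) hu
          · exact ENNReal.rpow_lt_top_of_nonneg (by norm_num) hw
  -- By multiplicativity of the characters, G e is the convolution of U e and W e, and the integral
  -- of a convolution is the product of the integrals.
  have hprod : ∀ x, ∫ ξ, G ξ * e ξ x ∂μ = (∫ ξ, U ξ * e ξ x ∂μ) * ∫ ξ, W ξ * e ξ x ∂μ := by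
    intro x
    have hm : ∀ V : K → ℂ, Integrable V μ → Integrable (fun ξ => V ξ * e ξ x) μ := by
      intro V hV
      refine hV.mul_bdd (c := 1) (hem x).aestronglyMeasurable (ae_of_all _ fun ξ => (hen ξ x).le)
    have h1 := integral_convolution (ContinuousLinearMap.mul ℂ ℂ) (hm U hiu) (hm W hiw)
    rw [ContinuousLinearMap.mul_apply'] at h1
    rw [← h1]
    refine integral_congr_ae (ae_of_all _ fun ξ => ?_)
    simp only [convolution_def, ContinuousLinearMap.mul_apply', hG]
    rw [← integral_mul_const]
    refine integral_congr_ae (ae_of_all _ fun η => ?_)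
    have h2 := hea η (ξ - η) x
    rw [add_sub_cancel] at h2
    simp only [h2]
    ring
  obtain ⟨hJ1, hJ2⟩ := hJ G hGi hG2
  have hae : (fun x => ∫ ξ, G ξ * e ξ x ∂μ) =ᵐ[vol] fun x => u x * w x := by
    filter_upwards [hinv u hiu, hinv w hiw] with x hx1 hx2
    rw [hprod, ← hx1, ← hx2]
  have hmem : MemLp (fun x => u x * w x) 2 vol := hJ1.ae_eq hae
  refine ⟨hmem, ?_⟩
  have heq : hmem.toLp _ = hJ1.toLp _ := MemLp.toLp_congr _ _ hae.symm
  rw [heq, hJ2]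
  refine le_trans (le_of_eq ?_) hbound
  congr 1
  refine lintegral_congr_ae ?_
  filter_upwards [hG2.coeFn_toLp] with ξ hξ
  rw [hξ]

end Algebra

/-! ### Fourier inversion on ℝ^d. -/

section WholeSpace

variable {V : Type*} [NormedAddCommGroup V] [InnerProductSpace ℝ V] [FiniteDimensional ℝ V]
  [MeasurableSpace V] [BorelSpace V]

open scoped ContDiff SchwartzMap

/-- The inverse transform is the Fourier integral for the form -⟨·,·⟩, which is symmetric. -/
lemma integral_fourierInv_mul_eq_flip {f g : V → ℂ} (hf : Integrable f) (hg : Integrable g) :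
    ∫ ξ, 𝓕⁻ f ξ * g ξ = ∫ x, f x * 𝓕⁻ g x := by
  have h := VectorFourier.integral_fourierIntegral_smul_eq_flip (μ := (volume : Measure V))
    (ν := (volume : Measure V)) (L := -innerₗ V) Real.continuous_fourierChar
    continuous_inner.neg hf hg
  have hflip : (-innerₗ V).flip = -innerₗ V := by
    ext x y; simp [real_inner_comm]
  rw [hflip] at h
  exact h

/-- The `L²` Fourier inversion agrees with the inverse Fourier integral on `L¹ ∩ L²`. -/
theorem fourierInv_toLp_ae_eq {G : V → ℂ} (hG1 : Integrable G) (hG2 : MemLp G 2) :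
    ⇑(𝓕⁻ (hG2.toLp G) : Lp ℂ 2 (volume : Measure V)) =ᵐ[volume] 𝓕⁻ G := by
  set U : Lp ℂ 2 (volume : Measure V) := 𝓕⁻ (hG2.toLp G) with hU
  have hcont : Continuous (𝓕⁻ G) := by
    exact VectorFourier.fourierIntegral_continuous Real.continuous_fourierChar
      (L := -innerₗ V) continuous_inner.neg hG1
  -- Both sides are tested against compactly supported smooth functions, and the inverse transform
  -- is moved onto the test function: by its definition on tempered distributions for the L² side,
  -- by Fubini for the L¹ side.
  refine ae_eq_of_integral_contDiff_smul_eq ((Lp.memLp U).locallyIntegrable (by norm_num))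
    hcont.locallyIntegrable fun g g_smooth g_cpt => ?_
  have hg₁ : HasCompactSupport (Complex.ofRealCLM ∘ g) := g_cpt.comp_left rfl
  have hg₂ : ContDiff ℝ ∞ (Complex.ofRealCLM ∘ g) := by fun_prop
  set φ : 𝓢(V, ℂ) := hg₁.toSchwartzMap hg₂ with hφ
  have h1 : (U : 𝓢'(V, ℂ)) φ = (hG2.toLp G : 𝓢'(V, ℂ)) (𝓕⁻ φ) := by
    rw [hU, ← Lp.fourierInv_toTemperedDistribution_eq]
    rfl
  rw [Lp.toTemperedDistribution_apply, Lp.toTemperedDistribution_apply] at h1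
  have h2 : ∫ x, (𝓕⁻ φ : 𝓢(V, ℂ)) x • (hG2.toLp G) x = ∫ ξ, 𝓕⁻ (φ : V → ℂ) ξ * G ξ := by
    refine integral_congr_ae ?_
    filter_upwards [hG2.coeFn_toLp] with x hx
    rw [hx, SchwartzMap.fourierInv_coe, smul_eq_mul]
  rw [h2, integral_fourierInv_mul_eq_flip φ.integrable hG1] at h1
  have h3 : ∀ (k : V → ℂ) x, φ x * k x = g x • k x := by
    intro k x
    simp [hφ]
  simpa only [smul_eq_mul, h3] using h1

end WholeSpace

/-! ### ℓ² and L² of the counting measure. -/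

section CountingMeasure

variable {I : Type*} [MeasurableSpace I] [MeasurableSingletonClass I]

lemma lintegral_count_enorm_sq (f : lp (fun _ : I => ℂ) 2) :
    ∫⁻ i, ‖f i‖ₑ ^ 2 ∂(Measure.count : Measure I) = ‖f‖ₑ ^ 2 := by
  have h1 := lp.norm_rpow_eq_tsum (p := 2) (by simp) f
  have h2 := (lp.memℓp f).summable (by simp)
  simp only [ENNReal.toReal_ofNat, Real.rpow_ofNat] at h1 h2
  rw [lintegral_count, ← ofReal_norm, ← ENNReal.ofReal_pow (norm_nonneg _), h1,
    ENNReal.ofReal_tsum_of_nonneg (fun i => by positivity) h2]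
  refine tsum_congr fun i => ?_
  rw [← ofReal_norm, ← ENNReal.ofReal_pow (norm_nonneg _)]

lemma memLp_count_of_lp [Countable I] (f : lp (fun _ : I => ℂ) 2) :
    MemLp (fun i => f i) 2 (Measure.count : Measure I) := by
  refine ⟨(measurable_of_countable _).aestronglyMeasurable, ?_⟩
  rw [eLpNorm_two_eq, lintegral_count_enorm_sq, sq_rpow_half]
  exact enorm_lt_top

/-- The isometric embedding of `ℓ²` into `L²` of the counting measure. -/
def lpToLpCount [Countable I] : lp (fun _ : I => ℂ) 2 →ₗᵢ[ℂ] Lp ℂ 2 (Measure.count : Measure I) where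
  toFun f := (memLp_count_of_lp f).toLp _
  map_add' f g := by
    rw [← MemLp.toLp_add]
    rfl
  map_smul' c f := by
    rw [RingHom.id_apply, ← MemLp.toLp_const_smul]
    rfl
  norm_map' f := by
    change ‖(memLp_count_of_lp f).toLp _‖ = ‖f‖
    rw [Lp.norm_toLp, eLpNorm_two_eq, lintegral_count_enorm_sq, sq_rpow_half, toReal_enorm]

lemma lpToLpCount_ae_eq [Countable I] (f : lp (fun _ : I => ℂ) 2) :
    ⇑(lpToLpCount f) =ᵐ[Measure.count] fun i => f i :=
  (memLp_count_of_lp f).coeFn_toLp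

lemma memℓp_of_memLp_count {G : I → ℂ} (hG : MemLp G 2 (Measure.count : Measure I)) :
    Memℓp G 2 := by
  refine memℓp_gen ?_
  have h := hG.2
  rw [eLpNorm_two_eq, ENNReal.rpow_lt_top_iff_of_pos (by norm_num), lintegral_count] at h
  have h2 : ∀ i, ‖G i‖ₑ ^ 2 = ENNReal.ofReal (‖G i‖ ^ 2) := fun i => by
    rw [← ofReal_norm, ← ENNReal.ofReal_pow (norm_nonneg _)]
  simp only [ENNReal.toReal_ofNat, Real.rpow_ofNat]
  refine (ENNReal.summable_toReal h.ne).congr fun i => ?_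
  rw [h2, ENNReal.toReal_ofReal (by positivity)]

end CountingMeasure

/-! ### Fourier series on the torus. -/

section Torus

variable {d : ℕ}

/-- The Haar measure of the torus. -/
abbrev torusMeasure (d : ℕ) : Measure (UnitAddTorus (Fin d)) :=
  Measure.pi fun _ : Fin d => (AddCircle.haarAddCircle : Measure UnitAddCircle)

/-- The Fourier coefficients on the torus, as an isometry into `L²` of the counting measure. -/
def torusFourier (d : ℕ) :
    Lp ℂ 2 (torusMeasure d) →ₗᵢ[ℂ] Lp ℂ 2 (Measure.count : Measure (Fin d → ℤ)) :=
  lpToLpCount.comp (UnitAddTorus.mFourierBasis (d := Fin d)).repr.toLinearIsometry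

lemma torusFourier_ae_eq (f : Lp ℂ 2 (torusMeasure d)) :
    ⇑(torusFourier d f) =ᵐ[Measure.count] UnitAddTorus.mFourierCoeff f := by
  filter_upwards [lpToLpCount_ae_eq ((UnitAddTorus.mFourierBasis (d := Fin d)).repr f)] with n hn
  exact hn.trans (UnitAddTorus.mFourierBasis_repr f n)

/-- Absolute summability gives uniform convergence of the series, hence convergence in L². There it
is the expansion in the Hilbert basis of characters with coefficients G. -/
lemma torusFourier_synthesis {G : (Fin d → ℤ) → ℂ} (hG1 : Integrable G Measure.count)
    (hG2 : MemLp G 2 Measure.count) :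
    ∃ hu : MemLp (fun x => ∫ n, G n * UnitAddTorus.mFourier n x ∂Measure.count) 2 (torusMeasure d),
      torusFourier d (hu.toLp _) = hG2.toLp G := by
  have hs : Summable fun n => ‖G n‖ := integrable_count_iff.1 hG1
  have hsC : Summable fun n => G n • UnitAddTorus.mFourier (d := Fin d) n := by
    refine Summable.of_norm (hs.congr fun n => ?_)
    rw [norm_smul, UnitAddTorus.mFourier_norm, mul_one]
  set c : C(UnitAddTorus (Fin d), ℂ) := ∑' n, G n • UnitAddTorus.mFourier n with hc
  have hcx : ∀ x, ∫ n, G n * UnitAddTorus.mFourier n x ∂Measure.count = c x := by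
    intro x
    have hi : Integrable (fun n => G n * UnitAddTorus.mFourier n x)
        (Measure.count : Measure (Fin d → ℤ)) := by
      refine integrable_count_iff.2 (Summable.of_nonneg_of_le (fun _ => norm_nonneg _)
        (fun n => ?_) hs)
      rw [norm_mul]
      refine mul_le_of_le_one_right (norm_nonneg _) ?_
      exact ((UnitAddTorus.mFourier n).norm_coe_le_norm x).trans UnitAddTorus.mFourier_norm.le
    rw [integral_countable hi, hc, ← ContinuousMap.tsum_apply hsC x]
    simp
  simp_rw [hcx]
  have hcoe := ContinuousMap.coeFn_toLp (p := 2) (𝕜 := ℂ) (torusMeasure d) c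
  have hmem : MemLp (fun x => c x) 2 (torusMeasure d) := (memLp_congr_ae hcoe).1 (Lp.memLp _)
  refine ⟨hmem, ?_⟩
  set g : lp (fun _ : Fin d → ℤ => ℂ) 2 := ⟨G, memℓp_of_memLp_count hG2⟩ with hg
  have h1 := (UnitAddTorus.mFourierBasis (d := Fin d)).hasSum_repr_symm g
  have h2 := (ContinuousMap.toLp (E := ℂ) 2 (torusMeasure d) ℂ).hasSum hsC.hasSum
  have h3 : hmem.toLp _ = (UnitAddTorus.mFourierBasis (d := Fin d)).repr.symm g := by
    have h4 : hmem.toLp _ = ContinuousMap.toLp (E := ℂ) 2 (torusMeasure d) ℂ c := by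
      refine Lp.ext ?_
      exact hmem.coeFn_toLp.trans hcoe.symm
    rw [h4]
    have h5 : (fun n => ContinuousMap.toLp (E := ℂ) 2 (torusMeasure d) ℂ
        (G n • UnitAddTorus.mFourier (d := Fin d) n)) =
        fun n => g n • (UnitAddTorus.mFourierBasis (d := Fin d)) n := by
      funext n
      rw [map_smul, UnitAddTorus.coe_mFourierBasis]
      rfl
    rw [h5] at h2
    exact h2.unique h1
  rw [h3]
  change lpToLpCount ((UnitAddTorus.mFourierBasis (d := Fin d)).repr
    ((UnitAddTorus.mFourierBasis (d := Fin d)).repr.symm g)) = _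
  rw [LinearIsometryEquiv.apply_symm_apply]
  rfl

end Torus

/-! ### Both domains at once: Plancherel, the Bessel weight, the algebra property. -/

namespace SpatialDomain

instance instSigmaFiniteVol (d : ℕ) : (Ω : SpatialDomain) → SigmaFinite (Ω.vol d)
  | wholeSpace => inferInstanceAs (SigmaFinite (volume : Measure (EuclideanSpace ℝ (Fin d))))
  | torus => inferInstanceAs (SigmaFinite (torusMeasure d))

instance instSecondCountableLpFreq (d : ℕ) :
    (Ω : SpatialDomain) → SecondCountableTopology (Lp ℂ 2 (Ω.freqVol d))
  | wholeSpace => by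
      have : Fact ((2 : ℝ≥0∞) ≠ ∞) := ⟨by simp⟩
      change SecondCountableTopology (Lp ℂ 2 (volume : Measure (EuclideanSpace ℝ (Fin d))))
      infer_instance
  | torus => by
      have : Fact ((2 : ℝ≥0∞) ≠ ∞) := ⟨by simp⟩
      change SecondCountableTopology (Lp ℂ 2 (Measure.count : Measure (Fin d → ℤ)))
      infer_instance

/-- The Fourier–Plancherel transform of the domain, as an isometry of complex `L²` spaces. -/
def plancherel (d : ℕ) : (Ω : SpatialDomain) → Lp ℂ 2 (Ω.vol d) →ₗᵢ[ℂ] Lp ℂ 2 (Ω.freqVol d)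
  | wholeSpace => (Lp.fourierTransformₗᵢ (EuclideanSpace ℝ (Fin d)) ℂ).toLinearIsometry
  | torus => torusFourier d

lemma fourier_ae_eq (d : ℕ) (Ω : SpatialDomain) {u : Ω.Pt d → ℝ}
    (hu : MemLp (fun x => (u x : ℂ)) 2 (Ω.vol d)) :
    Ω.fourier d u =ᵐ[Ω.freqVol d] Ω.plancherel d (hu.toLp _) := by
  cases Ω with
  | wholeSpace => exact Filter.EventuallyEq.of_eq (dif_pos hu)
  | torus =>
    refine Filter.EventuallyEq.trans (Filter.EventuallyEq.of_eq ?_)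
      (torusFourier_ae_eq (hu.toLp _)).symm
    funext n
    exact integral_congr_ae (Filter.EventuallyEq.rfl.smul hu.coeFn_toLp.symm)

lemma measurable_freqSq (d : ℕ) (Ω : SpatialDomain) : Measurable (Ω.freqSq d) := by
  cases Ω with
  | wholeSpace => exact (continuous_norm.pow 2).measurable
  | torus => exact measurable_of_countable _

lemma freqSq_nonneg (d : ℕ) (Ω : SpatialDomain) (ξ : Ω.Freq d) : 0 ≤ Ω.freqSq d ξ := by
  cases Ω with
  | wholeSpace => exact sq_nonneg _
  | torus => exact Finset.sum_nonneg fun _ _ => sq_nonneg _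

lemma measurable_besselWeight (d : ℕ) (Ω : SpatialDomain) (s : ℝ) :
    Measurable (Ω.besselWeight d s) :=
  (((Ω.measurable_freqSq d).const_mul _).const_add _).pow_const s

lemma one_le_besselWeight (d : ℕ) (Ω : SpatialDomain) {s : ℝ} (hs : 0 ≤ s) (ξ : Ω.Freq d) :
    1 ≤ Ω.besselWeight d s ξ :=
  Real.one_le_rpow (le_add_of_nonneg_right
    (mul_nonneg (sq_nonneg _) (Ω.freqSq_nonneg d ξ))) hs

end SpatialDomain

/-- A finite set of multi-indices lies in the box of its projections, over which the sum factors. -/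
lemma tsum_prod_le_prod_tsum {ι κ : Type*} [Fintype ι] [DecidableEq ι] [DecidableEq κ]
    (f : ι → κ → ℝ≥0∞) :
    ∑' n : ι → κ, ∏ i, f i (n i) ≤ ∏ i, ∑' k, f i k := by
  rw [ENNReal.tsum_eq_iSup_sum]
  refine iSup_le fun T => ?_
  calc ∑ n ∈ T, ∏ i, f i (n i)
      ≤ ∑ n ∈ Fintype.piFinset fun i => T.image fun n => n i, ∏ i, f i (n i) := by
        refine Finset.sum_le_sum_of_subset fun n hn => ?_
        exact Fintype.mem_piFinset.2 fun i => Finset.mem_image_of_mem _ hn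
    _ = ∏ i, ∑ k ∈ T.image fun n => n i, f i k := (Finset.prod_univ_sum _ _).symm
    _ ≤ ∏ i, ∑' k, f i k := Finset.prod_le_prod' fun i _ => ENNReal.sum_le_tsum _

/-- If b is the larger of a and b, then 1 + c ≤ 4(1 + b). -/
lemma sqrt_one_add_rpow_le {a b c s : ℝ} (ha : 0 ≤ a) (hb : 0 ≤ b) (hc : 0 ≤ c)
    (hab : c ≤ 2 * (a + b)) (hs : 0 ≤ s) :
    √((1 + c) ^ s) ≤ √(4 ^ s) * (√((1 + a) ^ s) + √((1 + b) ^ s)) := by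
  wlog h : a ≤ b generalizing a b
  · rw [add_comm √((1 + a) ^ s)]
    exact this hb ha (by linarith) (by linarith)
  have h1 : (1 + c) ^ s ≤ 4 ^ s * (1 + b) ^ s := by
    rw [← Real.mul_rpow (by norm_num) (by linarith)]
    exact Real.rpow_le_rpow (by linarith) (by linarith) hs
  refine (Real.sqrt_le_sqrt h1).trans ?_
  rw [Real.sqrt_mul (by positivity)]
  gcongr
  exact le_add_of_nonneg_left (Real.sqrt_nonneg _)

lemma summable_one_add_sq_rpow {r : ℝ} (hr : 1 / 2 < r) :
    Summable fun n : ℤ => (1 + (n : ℝ) ^ 2) ^ (-r) := by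
  have h := Real.summable_abs_int_rpow (b := 2 * r) (by linarith)
  refine Summable.of_norm_bounded_eventually h ?_
  rw [Filter.eventually_cofinite]
  refine (Set.finite_singleton (0 : ℤ)).subset fun n hn => ?_
  by_contra hn0
  refine hn ?_
  have hpos : 0 < |(n : ℝ)| := by simpa using hn0
  rw [Real.norm_of_nonneg (by positivity), show -(2 * r) = 2 * -r by ring,
    Real.rpow_mul hpos.le, Real.rpow_two, sq_abs]
  exact Real.rpow_le_rpow_of_nonpos (by rw [← sq_abs]; positivity) (by linarith) (by linarith)

/-- Each 1 + n_i² is at most 1 + |n|², so the sum is dominated by a product of d one-dimensional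
sums with exponent s/d > 1/2. -/
lemma tsum_one_add_sum_sq_rpow_ne_top {d : ℕ} (hd : 0 < d) {s : ℝ} (hs : (d : ℝ) / 2 < s) :
    ∑' n : Fin d → ℤ, ENNReal.ofReal ((1 + ∑ i, (n i : ℝ) ^ 2) ^ (-s)) ≠ ∞ := by
  have hd' : (0 : ℝ) < d := by exact_mod_cast hd
  have hs0 : 0 < s := by linarith [half_pos hd']
  have h1 : ∀ n : Fin d → ℤ, ENNReal.ofReal ((1 + ∑ i, (n i : ℝ) ^ 2) ^ (-s)) ≤
      ∏ i, ENNReal.ofReal ((1 + (n i : ℝ) ^ 2) ^ (-(s / d))) := by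
    intro n
    rw [← ENNReal.ofReal_prod_of_nonneg fun _ _ => by positivity]
    refine ENNReal.ofReal_le_ofReal ?_
    have h0 : 0 ≤ ∑ i, (n i : ℝ) ^ 2 := Finset.sum_nonneg fun _ _ => sq_nonneg _
    calc (1 + ∑ i, (n i : ℝ) ^ 2) ^ (-s)
        = ∏ _i : Fin d, (1 + ∑ i, (n i : ℝ) ^ 2) ^ (-(s / d)) := by
          rw [Finset.prod_const, Finset.card_univ, Fintype.card_fin, ← Real.rpow_natCast,
            ← Real.rpow_mul (by positivity)]
          congr 1
          field_simp
      _ ≤ _ := by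
          refine Finset.prod_le_prod (fun _ _ => by positivity) fun i _ => ?_
          refine Real.rpow_le_rpow_of_nonpos (by positivity) ?_ (by
            have : 0 < s / d := by positivity
            linarith)
          have := Finset.single_le_sum (f := fun i => (n i : ℝ) ^ 2)
            (fun _ _ => sq_nonneg _) (Finset.mem_univ i)
          linarith
  have h2 : ∑' k : ℤ, ENNReal.ofReal ((1 + (k : ℝ) ^ 2) ^ (-(s / d))) ≠ ∞ :=
    (summable_one_add_sq_rpow (by rw [lt_div_iff₀ hd']; linarith)).tsum_ofReal_ne_top
  refine ne_top_of_le_ne_top ?_ ((ENNReal.tsum_le_tsum h1).trans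
    (tsum_prod_le_prod_tsum fun (_ : Fin d) (k : ℤ) =>
      ENNReal.ofReal ((1 + (k : ℝ) ^ 2) ^ (-(s / d)))))
  exact ENNReal.prod_ne_top fun i _ => h2

namespace SpatialDomain

lemma lintegral_one_add_freqSq_rpow_ne_top {d : ℕ} (hd : 0 < d) (Ω : SpatialDomain) {s : ℝ}
    (hs : (d : ℝ) / 2 < s) :
    ∫⁻ ξ, ENNReal.ofReal ((1 + Ω.freqSq d ξ) ^ (-s)) ∂Ω.freqVol d ≠ ∞ := by
  cases Ω with
  | wholeSpace =>
    have h := integrable_rpow_neg_one_add_norm_sq (E := EuclideanSpace ℝ (Fin d))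
      (μ := volume) (r := 2 * s) (by simp; linarith)
    rw [show -(2 * s) / 2 = -s by ring] at h
    exact h.lintegral_lt_top.ne
  | torus =>
    refine ne_of_eq_of_ne (lintegral_count _) ?_
    exact tsum_one_add_sum_sq_rpow_ne_top hd hs

lemma lintegral_inv_sqrt_besselWeight_sq_ne_top {d : ℕ} (hd : 0 < d) (Ω : SpatialDomain) {s : ℝ}
    (hs : (d : ℝ) / 2 < s) :
    ∫⁻ ξ, (ENNReal.ofReal √(Ω.besselWeight d s ξ))⁻¹ ^ 2 ∂Ω.freqVol d ≠ ∞ := by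
  have hd' : (0 : ℝ) < d := by exact_mod_cast hd
  have hs0 : 0 < s := by linarith [half_pos hd']
  refine ne_top_of_le_ne_top (Ω.lintegral_one_add_freqSq_rpow_ne_top hd hs)
    (lintegral_mono fun ξ => ?_)
  have h0 := Ω.freqSq_nonneg d ξ
  have hb := Ω.one_le_besselWeight d hs0.le ξ
  rw [← ENNReal.ofReal_inv_of_pos (Real.sqrt_pos.2 (by linarith)),
    ← ENNReal.ofReal_pow (by positivity), inv_pow, Real.sq_sqrt (by linarith)]
  refine ENNReal.ofReal_le_ofReal ?_
  rw [Real.rpow_neg (by positivity)]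
  refine inv_anti₀ (by positivity) (Real.rpow_le_rpow (by positivity) ?_ hs0.le)
  have hpi : 1 ≤ (2 * Real.pi) ^ 2 := by nlinarith [Real.pi_gt_three]
  nlinarith

/-- The algebra property of `H^s` on the level of complex `L²` classes. -/
theorem exists_plancherel_mul_le {d : ℕ} (hd : 0 < d) (Ω : SpatialDomain) {s : ℝ}
    (hs : (d : ℝ) / 2 < s) :
    ∃ C : ℝ≥0∞, C ≠ ∞ ∧ ∀ u w : Lp ℂ 2 (Ω.vol d),
      (∫⁻ ξ, ENNReal.ofReal (Ω.besselWeight d s ξ) * ‖Ω.plancherel d u ξ‖ₑ ^ 2 ∂Ω.freqVol d) ≠ ∞ →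
      (∫⁻ ξ, ENNReal.ofReal (Ω.besselWeight d s ξ) * ‖Ω.plancherel d w ξ‖ₑ ^ 2 ∂Ω.freqVol d) ≠ ∞ →
      ∃ h : MemLp (fun x => u x * w x) 2 (Ω.vol d),
        (∫⁻ ξ, ENNReal.ofReal (Ω.besselWeight d s ξ) * ‖Ω.plancherel d (h.toLp _) ξ‖ₑ ^ 2
          ∂Ω.freqVol d) ^ (1 / 2 : ℝ) ≤
        C * ((∫⁻ ξ, ENNReal.ofReal (Ω.besselWeight d s ξ) * ‖Ω.plancherel d u ξ‖ₑ ^ 2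
            ∂Ω.freqVol d) ^ (1 / 2 : ℝ) *
          (∫⁻ ξ, ENNReal.ofReal (Ω.besselWeight d s ξ) * ‖Ω.plancherel d w ξ‖ₑ ^ 2
            ∂Ω.freqVol d) ^ (1 / 2 : ℝ)) := by
  have hd' : (0 : ℝ) < d := by exact_mod_cast hd
  have hs0 : 0 < s := by linarith [half_pos hd']
  set β : Ω.Freq d → ℝ≥0∞ := fun ξ => ENNReal.ofReal √(Ω.besselWeight d s ξ) with hβdef
  have hβ2 : ∀ ξ, ENNReal.ofReal (Ω.besselWeight d s ξ) = β ξ ^ 2 := fun ξ => by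
    rw [hβdef, ← ENNReal.ofReal_pow (by positivity), Real.sq_sqrt]
    linarith [Ω.one_le_besselWeight d hs0.le ξ]
  have hβm : Measurable β := (Ω.measurable_besselWeight d s).sqrt.ennreal_ofReal
  have hβ1 : ∀ ξ, 1 ≤ β ξ := fun ξ => by
    rw [← ENNReal.ofReal_one]
    exact ENNReal.ofReal_le_ofReal (Real.one_le_sqrt.2 (Ω.one_le_besselWeight d hs0.le ξ))
  have hβi := Ω.lintegral_inv_sqrt_besselWeight_sq_ne_top hd hs
  -- Expressed through `freqSq`, since frequencies are added only once the domain is fixed.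
  have hβs : ∀ a b c : Ω.Freq d, Ω.freqSq d c ≤ 2 * (Ω.freqSq d a + Ω.freqSq d b) →
      β c ≤ ENNReal.ofReal √(4 ^ s) * (β a + β b) := by
    intro a b c h
    rw [hβdef]
    rw [← ENNReal.ofReal_add (by positivity) (by positivity),
      ← ENNReal.ofReal_mul (by positivity)]
    have ha := Ω.freqSq_nonneg d a
    have hb := Ω.freqSq_nonneg d b
    have hc := Ω.freqSq_nonneg d c
    refine ENNReal.ofReal_le_ofReal (sqrt_one_add_rpow_le (by positivity) (by positivity)
      (by positivity) ?_ hs0.le)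
    have : 0 ≤ (2 * Real.pi) ^ 2 := by positivity
    nlinarith
  refine ⟨2 * ENNReal.ofReal √(4 ^ s) * (∫⁻ ξ, (β ξ)⁻¹ ^ 2 ∂Ω.freqVol d) ^ (1 / 2 : ℝ),
    ENNReal.mul_ne_top (ENNReal.mul_ne_top (by simp) ENNReal.ofReal_ne_top)
      (ENNReal.rpow_ne_top_of_nonneg (by norm_num) hβi), fun u w hu hw => ?_⟩
  simp only [hβ2, ← mul_pow] at hu hw ⊢
  cases Ω with
  | wholeSpace =>
    refine weighted_fourier_mul (X := EuclideanSpace ℝ (Fin d))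
      (K := EuclideanSpace ℝ (Fin d)) (vol := volume) (μ := volume)
      (plancherel d wholeSpace) (fun ξ x => (Real.fourierChar (inner ℝ ξ x) : ℂ)) ?_ ?_ ?_ ?_
      hβm hβ1 (fun _ => ENNReal.ofReal_ne_top) ?_ ENNReal.ofReal_ne_top hβi u w hu hw
    · intro x
      exact (Continuous.comp (g := fun z : Circle => (z : ℂ)) (by fun_prop)
        (Real.continuous_fourierChar.comp (by fun_prop))).measurable
    · intro ξ x
      exact Circle.norm_coe _
    · intro ξ η x
      rw [inner_add_left, AddChar.map_add_eq_mul]; rfl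
    · intro G hG1 hG2
      have h1 : (fun x => ∫ ξ, G ξ * (Real.fourierChar (inner ℝ ξ x) : ℂ)) = 𝓕⁻ G := by
        funext x
        rw [Real.fourierInv_eq]
        refine integral_congr_ae (ae_of_all _ fun ξ => ?_)
        simp only [Circle.smul_def, smul_eq_mul]
        exact mul_comm _ _
      have h2 := fourierInv_toLp_ae_eq hG1 hG2
      rw [h1]
      refine ⟨(memLp_congr_ae h2).1 (Lp.memLp _), ?_⟩
      have h3 : ((memLp_congr_ae h2).1 (Lp.memLp _)).toLp (𝓕⁻ G) =
          (Lp.fourierTransformₗᵢ (EuclideanSpace ℝ (Fin d)) ℂ).symm (hG2.toLp G) :=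
        Lp.ext ((MemLp.coeFn_toLp _).trans h2.symm)
      rw [h3]
      exact LinearIsometryEquiv.apply_symm_apply _ _
    · intro ξ η
      refine hβs ξ η (ξ + η) ?_
      change ‖(ξ + η : EuclideanSpace ℝ (Fin d))‖ ^ 2 ≤ 2 * (‖ξ‖ ^ 2 + ‖η‖ ^ 2)
      nlinarith [norm_add_le ξ η, sq_nonneg (‖ξ‖ - ‖η‖), norm_nonneg (ξ + η), norm_nonneg ξ,
        norm_nonneg η]
  | torus =>
    refine weighted_fourier_mul (X := UnitAddTorus (Fin d))
      (K := Fin d → ℤ) (vol := torusMeasure d) (μ := Measure.count)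
      (torusFourier d) (fun n x => UnitAddTorus.mFourier n x) ?_ ?_ ?_ ?_
      hβm hβ1 (fun _ => ENNReal.ofReal_ne_top) ?_ ENNReal.ofReal_ne_top hβi u w hu hw
    · intro x; exact measurable_of_countable _
    · intro n x
      simp only [UnitAddTorus.mFourier, fourier_apply, ContinuousMap.coe_mk, norm_prod,
        Circle.norm_coe, Finset.prod_const_one]
    · intro n m x; exact UnitAddTorus.mFourier_add
    · intro G hG1 hG2
      exact torusFourier_synthesis hG1 hG2
    · intro n m
      refine hβs n m (n + m) ?_
      change ∑ i, (((n + m) i : ℤ) : ℝ) ^ 2 ≤ 2 * (∑ i, (n i : ℝ) ^ 2 + ∑ i, (m i : ℝ) ^ 2)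
      rw [← Finset.sum_add_distrib, Finset.mul_sum]
      refine Finset.sum_le_sum fun i _ => ?_
      push_cast [Pi.add_apply]
      nlinarith [sq_nonneg ((n i : ℝ) - m i)]

end SpatialDomain

/-! ### Norms given by countable duality: measurability and Minkowski's inequality. -/

section DualNorm

variable {X Z : Type*} [MeasurableSpace X] [MeasurableSpace Z] {μ : Measure X} {ν : Measure Z}

/-- An extended norm on real functions which is finite only on `L²`, dominates the `L²` norm, and
is a countable supremum of moduli of `L²` pairings. -/
structure IsDualNorm (μ : Measure X) (N : (X → ℝ) → ℝ≥0∞) : Prop where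
  eq_top : ∀ u, ¬ MemLp u 2 μ → N u = ∞
  eLpNorm_le : ∀ u, eLpNorm u 2 μ ≤ N u
  exists_dual : ∃ χ : ℕ × ℕ → X → ℂ, (∀ k, MemLp (χ k) 2 μ) ∧
    ∀ u, MemLp u 2 μ → N u = ⨆ k, ‖∫ x, χ k x * (u x : ℂ) ∂μ‖ₑ

namespace IsDualNorm

variable {N : (X → ℝ) → ℝ≥0∞} (hN : IsDualNorm μ N)
include hN

lemma memLp {u : X → ℝ} (hu : N u ≠ ∞) : MemLp u 2 μ := by
  by_contra h
  exact hu (hN.eq_top u h)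

lemma congr_ae {u w : X → ℝ} (h : u =ᵐ[μ] w) : N u = N w := by
  obtain ⟨χ, hχ, hd⟩ := hN.exists_dual
  by_cases hu : MemLp u 2 μ
  · rw [hd u hu, hd w ((memLp_congr_ae h).1 hu)]
    refine iSup_congr fun k => ?_
    congr 1
    refine integral_congr_ae ?_
    filter_upwards [h] with x hx
    rw [hx]
  · rw [hN.eq_top u hu, hN.eq_top w fun hw => hu ((memLp_congr_ae h).2 hw)]

lemma zero : N (fun _ => 0) = 0 := by
  obtain ⟨χ, hχ, hd⟩ := hN.exists_dual
  rw [hd _ MemLp.zero']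
  simp

lemma ae_eq_zero {u : X → ℝ} (hu : N u = 0) : u =ᵐ[μ] 0 := by
  have h := hN.eLpNorm_le u
  rw [hu, nonpos_iff_eq_zero] at h
  exact (eLpNorm_eq_zero_iff (hN.memLp (by simp [hu])).1 (by simp)).1 h

lemma mul_const (u : X → ℝ) (c : ℝ) : N (fun x => u x * c) = N u * ‖c‖ₑ := by
  obtain ⟨χ, hχ, hd⟩ := hN.exists_dual
  rcases eq_or_ne c 0 with rfl | hc
  · simp [hN.zero]
  by_cases hu : MemLp u 2 μ
  · have hcu : MemLp (fun x => u x * c) 2 μ := by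
      simpa only [mul_comm] using hu.const_mul c
    rw [hd u hu, hd _ hcu, ENNReal.iSup_mul]
    refine iSup_congr fun k => ?_
    have h1 : ∀ x, χ k x * ((u x * c : ℝ) : ℂ) = χ k x * (u x : ℂ) * (c : ℂ) := fun x => by
      push_cast; ring
    simp only [h1]
    rw [integral_mul_const, enorm_mul, ← ofReal_norm (c : ℂ), Complex.norm_real, ofReal_norm]
  · rw [hN.eq_top u hu, ENNReal.top_mul (by simpa using hc)]
    refine hN.eq_top _ fun h => hu ?_
    have h2 := h.const_mul c⁻¹
    refine (memLp_congr_ae (ae_of_all _ fun x => ?_)).1 h2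
    change c⁻¹ * (u x * c) = u x
    field_simp

lemma add_le (u w : X → ℝ) : N (fun x => u x + w x) ≤ N u + N w := by
  obtain ⟨χ, hχ, hd⟩ := hN.exists_dual
  by_cases hu : N u = ∞
  · simp [hu]
  by_cases hw : N w = ∞
  · simp [hw]
  have hu' := hN.memLp hu
  have hw' := hN.memLp hw
  rw [hd u hu', hd w hw', hd (fun x => u x + w x) (hu'.add hw')]
  refine iSup_le fun k => ?_
  have h1 : ∀ y : X → ℝ, MemLp y 2 μ → Integrable (fun x => χ k x * (y x : ℂ)) μ := fun y hy =>
    (hχ k).integrable_mul hy.ofReal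
  simp only [Complex.ofReal_add, mul_add]
  rw [integral_add (h1 u hu') (h1 w hw')]
  exact (enorm_add_le _ _).trans (add_le_add (le_iSup (fun k => ‖∫ x, χ k x * (u x : ℂ) ∂μ‖ₑ) k)
    (le_iSup (fun k => ‖∫ x, χ k x * (w x : ℂ) ∂μ‖ₑ) k))

lemma sub_le (u w : X → ℝ) : N (fun x => u x - w x) ≤ N u + N w := by
  have h := hN.add_le u fun x => w x * (-1)
  rw [hN.mul_const] at h
  simpa [sub_eq_add_neg] using h

/-- On slices in L² the norm is a countable supremum of parameter integrals, measurable by Fubini;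
on the others it is ∞, and the set of square-integrable slices is measurable. -/
lemma aemeasurable [SFinite μ] [SFinite ν] {f : X → Z → ℝ}
    (hf : AEStronglyMeasurable (Function.uncurry f) (μ.prod ν)) :
    AEMeasurable (fun z => N fun x => f x z) ν := by
  obtain ⟨χ, hχ, hd⟩ := hN.exists_dual
  set g := hf.mk with hg
  have hgm : StronglyMeasurable g := hf.stronglyMeasurable_mk
  have h1 : ∀ᵐ z ∂ν, ∀ᵐ x ∂μ, f x z = g (x, z) := by
    have h := (Measure.measurePreserving_swap (μ := ν) (ν := μ)).quasiMeasurePreserving.ae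
      hf.ae_eq_mk
    exact Measure.ae_ae_of_ae_prod h
  set A : Set Z := {z | ∫⁻ x, ‖g (x, z)‖ₑ ^ 2 ∂μ < ∞} with hA
  have hAm : MeasurableSet A :=
    measurableSet_lt ((hgm.enorm.pow_const 2).lintegral_prod_left') measurable_const
  have h2 : ∀ k, Measurable fun z => ‖∫ x, (hχ k).1.mk (χ k) x * (g (x, z) : ℂ) ∂μ‖ₑ := by
    intro k
    refine StronglyMeasurable.enorm (StronglyMeasurable.integral_prod_left'
      (f := fun y : X × Z => (hχ k).1.mk (χ k) y.1 * (g y : ℂ)) ?_)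
    exact ((hχ k).1.stronglyMeasurable_mk.comp_measurable measurable_fst).mul
      (Complex.continuous_ofReal.comp_stronglyMeasurable hgm)
  classical
  refine ⟨A.piecewise (fun z => ⨆ k, ‖∫ x, (hχ k).1.mk (χ k) x * (g (x, z) : ℂ) ∂μ‖ₑ)
    fun _ => ∞, (Measurable.iSup h2).piecewise hAm measurable_const, ?_⟩
  filter_upwards [h1] with z hz
  rw [hN.congr_ae hz]
  have hgz : AEStronglyMeasurable (fun x => g (x, z)) μ :=
    (hgm.comp_measurable measurable_prodMk_right).aestronglyMeasurable
  by_cases hzA : z ∈ A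
  · rw [Set.piecewise_eq_of_mem _ _ _ hzA, hd]
    · refine iSup_congr fun k => ?_
      congr 1
      refine integral_congr_ae ?_
      filter_upwards [(hχ k).1.ae_eq_mk] with x hx
      rw [hx]
    · refine ⟨hgz, ?_⟩
      rw [eLpNorm_two_eq]
      exact ENNReal.rpow_lt_top_of_nonneg (by norm_num) (ne_of_lt hzA)
  · rw [Set.piecewise_eq_of_notMem _ _ _ hzA]
    refine hN.eq_top _ fun h => hzA ?_
    have h3 := h.2
    rwa [eLpNorm_two_eq, ENNReal.rpow_lt_top_iff_of_pos (by norm_num)] at h3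

/-- Minkowski's integral inequality for a dual norm. -/
theorem integral_le [SFinite μ] [SFinite ν] {f : X → Z → ℝ}
    (hf : AEStronglyMeasurable (Function.uncurry f) (μ.prod ν))
    (hfin : ∫⁻ z, N (fun x => f x z) ∂ν ≠ ∞) :
    (∀ᵐ x ∂μ, Integrable (f x) ν) ∧
      N (fun x => ∫ z, f x z ∂ν) ≤ ∫⁻ z, N (fun x => f x z) ∂ν := by
  obtain ⟨χ, hχ, hd⟩ := hN.exists_dual
  -- Minkowski's inequality in L² comes first: the dual formula for N applies only to functions
  -- already known to lie in L².
  have hmink := sqrt_lintegral_lintegral_sq_le hf.enorm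
  simp only [Function.uncurry_apply_pair, ← eLpNorm_two_eq] at hmink
  have hL2 : ∫⁻ z, eLpNorm (fun x => f x z) 2 μ ∂ν ≠ ∞ :=
    ne_top_of_le_ne_top hfin (lintegral_mono fun z => hN.eLpNorm_le _)
  have hfin2 : ∫⁻ x, (∫⁻ z, ‖f x z‖ₑ ∂ν) ^ 2 ∂μ < ∞ := by
    have h := hmink.trans_lt hL2.lt_top
    rwa [ENNReal.rpow_lt_top_iff_of_pos (by norm_num)] at h
  have hm2 : AEMeasurable (fun x => ∫⁻ z, ‖f x z‖ₑ ∂ν) μ := hf.enorm.lintegral_prod_right'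
  have hU : MemLp (fun x => ∫ z, f x z ∂ν) 2 μ := by
    refine ⟨hf.integral_prod_right', ?_⟩
    rw [eLpNorm_two_eq]
    refine ENNReal.rpow_lt_top_of_nonneg (by norm_num) (ne_top_of_le_ne_top hfin2.ne ?_)
    refine lintegral_mono fun x => ?_
    gcongr
    exact enorm_integral_le_lintegral_enorm _
  refine ⟨?_, ?_⟩
  · filter_upwards [ae_lt_top' (hm2.pow_const 2) hfin2.ne, hf.prodMk_left] with x hx hxm
    refine ⟨hxm, ?_⟩
    by_contra h
    rw [HasFiniteIntegral, not_lt, top_le_iff] at h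
    simp [h] at hx
  rw [hd _ hU]
  refine iSup_le fun k => ?_
  have hprodm : AEStronglyMeasurable (Function.uncurry fun x z => χ k x * (f x z : ℂ))
      (μ.prod ν) :=
    (hχ k).1.comp_fst.mul (Complex.continuous_ofReal.comp_aestronglyMeasurable hf)
  -- Cauchy–Schwarz in x between χ_k and the integral of |f| in z allows each functional to be
  -- exchanged with the z integral.
  have hprod : Integrable (Function.uncurry fun x z => χ k x * (f x z : ℂ)) (μ.prod ν) := by
    refine ⟨hprodm, ?_⟩
    rw [HasFiniteIntegral, lintegral_prod _ hprodm.enorm]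
    simp only [Function.uncurry_apply_pair, enorm_mul]
    have h2 : ∀ x z, ‖((f x z : ℝ) : ℂ)‖ₑ = ‖f x z‖ₑ := fun x z => by
      rw [← ofReal_norm, Complex.norm_real, ofReal_norm]
    simp only [h2]
    calc ∫⁻ x, ∫⁻ z, ‖χ k x‖ₑ * ‖f x z‖ₑ ∂ν ∂μ
        = ∫⁻ x, ‖χ k x‖ₑ * ∫⁻ z, ‖f x z‖ₑ ∂ν ∂μ :=
          lintegral_congr fun x => lintegral_const_mul' _ _ enorm_ne_top
      _ ≤ _ := lintegral_mul_le_sqrt_mul_sqrt (hχ k).1.enorm hm2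
      _ < ∞ := by
          refine ENNReal.mul_lt_top ?_ (ENNReal.rpow_lt_top_of_nonneg (by norm_num) hfin2.ne)
          rw [← eLpNorm_two_eq]
          exact (hχ k).2
  have hswap := integral_integral_swap hprod
  have h3 : ∀ x, χ k x * ((∫ z, f x z ∂ν : ℝ) : ℂ) = ∫ z, χ k x * (f x z : ℂ) ∂ν := fun x => by
    rw [integral_const_mul, integral_complex_ofReal]
  simp only [h3]
  rw [hswap]
  refine (enorm_integral_le_lintegral_enorm _).trans (lintegral_mono fun z => ?_)
  by_cases hz : MemLp (fun x => f x z) 2 μ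
  · rw [hd _ hz]
    exact le_iSup (fun k => ‖∫ x, χ k x * (f x z : ℂ) ∂μ‖ₑ) k
  · simp only [hN.eq_top _ hz, le_top]

end IsDualNorm

end DualNorm

/-! ### The H^s norm and inner product. -/

namespace SpatialDomain

variable {d : ℕ} {Ω : SpatialDomain} {s : ℝ}

lemma hsNorm_eq {u : Ω.Pt d → ℝ} (hu : MemLp u 2 (Ω.vol d))
    (hu' : MemLp (fun x => (u x : ℂ)) 2 (Ω.vol d)) :
    Ω.hsNorm d s u = (∫⁻ ξ, ENNReal.ofReal (Ω.besselWeight d s ξ) *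
      ‖Ω.plancherel d (hu'.toLp _) ξ‖ₑ ^ 2 ∂Ω.freqVol d) ^ (1 / 2 : ℝ) := by
  rw [hsNorm, if_pos hu]
  congr 1
  refine lintegral_congr_ae ?_
  filter_upwards [Ω.fourier_ae_eq d hu'] with ξ hξ
  rw [hξ]

lemma lintegral_ne_top_of_hsNorm_ne_top {u : Ω.Pt d → ℝ} (hu : Ω.hsNorm d s u ≠ ∞) :
    ∫⁻ ξ, ENNReal.ofReal (Ω.besselWeight d s ξ) * ‖Ω.fourier d u ξ‖ₑ ^ 2 ∂Ω.freqVol d ≠ ∞ := by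
  intro h
  refine hu ?_
  rw [hsNorm]
  split_ifs
  · rw [h, ENNReal.top_rpow_of_pos (by norm_num)]
  · rfl

/-- For s ≥ 0 the symbol is at least 1, so Plancherel gives the domination of the L² norm. -/
lemma isDualNorm_hsNorm (hs : 0 ≤ s) : IsDualNorm (Ω.vol d) (Ω.hsNorm d s) where
  eq_top u hu := if_neg hu
  eLpNorm_le u := by
    by_cases hu : MemLp u 2 (Ω.vol d)
    · have hu' : MemLp (fun x => (u x : ℂ)) 2 (Ω.vol d) := hu.ofReal
      rw [hsNorm_eq hu hu']
      have h1 : eLpNorm u 2 (Ω.vol d) = ‖Ω.plancherel d (hu'.toLp _)‖ₑ := by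
        rw [LinearIsometry.enorm_map, Lp.enorm_toLp]
        refine eLpNorm_congr_norm_ae (ae_of_all _ fun x => ?_)
        rw [Complex.norm_real]
      rw [h1, Lp.enorm_def, eLpNorm_two_eq]
      refine ENNReal.rpow_le_rpow (lintegral_mono fun ξ => ?_) (by norm_num)
      refine le_mul_of_one_le_left zero_le ?_
      rw [← ENNReal.ofReal_one]
      exact ENNReal.ofReal_le_ofReal (Ω.one_le_besselWeight d hs ξ)
    · rw [hsNorm, if_neg hu]
      exact le_top
  exists_dual := by
    obtain ⟨χ, hχ, h⟩ := exists_dual_family (Ω.plancherel d) (Ω.measurable_besselWeight d s)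
      fun ξ => zero_le_one.trans (Ω.one_le_besselWeight d hs ξ)
    refine ⟨χ, hχ, fun u hu => ?_⟩
    have hu' : MemLp (fun x => (u x : ℂ)) 2 (Ω.vol d) := hu.ofReal
    rw [hsNorm_eq hu hu', h]
    refine iSup_congr fun k => ?_
    congr 1
    refine integral_congr_ae ?_
    filter_upwards [hu'.coeFn_toLp] with x hx
    rw [hx]

/-- The Sobolev space `H^s` is an algebra for `s > d / 2`. -/
theorem exists_hsNorm_mul_le (hd : 0 < d) (Ω : SpatialDomain) (hs : (d : ℝ) / 2 < s) :
    ∃ C : ℝ≥0∞, C ≠ ∞ ∧ ∀ u w : Ω.Pt d → ℝ,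
      Ω.hsNorm d s (fun x => u x * w x) ≤ C * (Ω.hsNorm d s u * Ω.hsNorm d s w) := by
  have hd' : (0 : ℝ) < d := by exact_mod_cast hd
  have hs0 : 0 < s := by linarith [half_pos hd']
  have hN := isDualNorm_hsNorm (d := d) (Ω := Ω) hs0.le
  obtain ⟨C, hC, h⟩ := Ω.exists_plancherel_mul_le hd hs
  -- A nonzero constant makes the right side infinite when one norm is infinite and the other
  -- nonzero. Vanishing norms are settled separately, because 0 · ∞ = 0.
  refine ⟨max C 1, by simp [hC], fun u w => ?_⟩
  have hC0 : max C 1 ≠ 0 := (zero_lt_one.trans_le (le_max_right _ _)).ne'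
  by_cases hu0 : Ω.hsNorm d s u = 0
  · refine le_of_eq_of_le ((hN.congr_ae ?_).trans hN.zero) zero_le
    filter_upwards [hN.ae_eq_zero hu0] with x hx
    simp [hx]
  by_cases hw0 : Ω.hsNorm d s w = 0
  · refine le_of_eq_of_le ((hN.congr_ae ?_).trans hN.zero) zero_le
    filter_upwards [hN.ae_eq_zero hw0] with x hx
    simp [hx]
  by_cases hu : Ω.hsNorm d s u = ∞
  · rw [hu, ENNReal.top_mul hw0, ENNReal.mul_top hC0]
    exact le_top
  by_cases hw : Ω.hsNorm d s w = ∞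
  · rw [hw, ENNReal.mul_top hu0, ENNReal.mul_top hC0]
    exact le_top
  have hu2 := hN.memLp hu
  have hw2 := hN.memLp hw
  have hu' : MemLp (fun x => (u x : ℂ)) 2 (Ω.vol d) := hu2.ofReal
  have hw' : MemLp (fun x => (w x : ℂ)) 2 (Ω.vol d) := hw2.ofReal
  have hfin : ∀ r : ℝ≥0∞, r ^ (1 / 2 : ℝ) ≠ ∞ → r ≠ ∞ := by
    rintro r hr rfl
    exact hr (ENNReal.top_rpow_of_pos (by norm_num))
  rw [hsNorm_eq hu2 hu'] at hu ⊢
  rw [hsNorm_eq hw2 hw'] at hw ⊢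
  obtain ⟨hm, hle⟩ := h (hu'.toLp _) (hw'.toLp _) (hfin _ hu) (hfin _ hw)
  have hae : (fun x => hu'.toLp _ x * hw'.toLp _ x) =ᵐ[Ω.vol d] fun x => ((u x * w x : ℝ) : ℂ) := by
    filter_upwards [hu'.coeFn_toLp, hw'.coeFn_toLp] with x hx hy
    rw [hx, hy, Complex.ofReal_mul]
  have hm' : MemLp (fun x => ((u x * w x : ℝ) : ℂ)) 2 (Ω.vol d) := (memLp_congr_ae hae).1 hm
  have hmr : MemLp (fun x => u x * w x) 2 (Ω.vol d) := by
    have := hm'.re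
    simpa using this
  rw [hsNorm_eq hmr hm', ← (MemLp.toLp_eq_toLp_iff hm hm').2 hae]
  exact hle.trans (mul_le_mul_left (le_max_left _ _) _)

lemma aestronglyMeasurable_fourier {u : Ω.Pt d → ℝ} (hu : MemLp u 2 (Ω.vol d)) :
    AEStronglyMeasurable (Ω.fourier d u) (Ω.freqVol d) :=
  (Lp.aestronglyMeasurable _).congr (Ω.fourier_ae_eq d hu.ofReal).symm

lemma fourier_add_ae_eq {u w : Ω.Pt d → ℝ} (hu : MemLp u 2 (Ω.vol d)) (hw : MemLp w 2 (Ω.vol d)) :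
    Ω.fourier d (fun x => u x + w x) =ᵐ[Ω.freqVol d]
      fun ξ => Ω.fourier d u ξ + Ω.fourier d w ξ := by
  have hu' : MemLp (fun x => (u x : ℂ)) 2 (Ω.vol d) := hu.ofReal
  have hw' : MemLp (fun x => (w x : ℂ)) 2 (Ω.vol d) := hw.ofReal
  have h' : MemLp (fun x => ((u x + w x : ℝ) : ℂ)) 2 (Ω.vol d) := (hu.add hw).ofReal
  have h2 : h'.toLp _ = hu'.toLp _ + hw'.toLp _ := by
    rw [← MemLp.toLp_add, MemLp.toLp_eq_toLp_iff]
    exact ae_of_all _ fun x => Complex.ofReal_add _ _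
  filter_upwards [Ω.fourier_ae_eq d hu', Ω.fourier_ae_eq d hw', Ω.fourier_ae_eq d h',
    Lp.coeFn_add (Ω.plancherel d (hu'.toLp _)) (Ω.plancherel d (hw'.toLp _))] with ξ h3 h4 h5 h6
  rw [h3, h4, h5, h2, map_add, h6, Pi.add_apply]

lemma fourier_sub_ae_eq {u w : Ω.Pt d → ℝ} (hu : MemLp u 2 (Ω.vol d)) (hw : MemLp w 2 (Ω.vol d)) :
    Ω.fourier d (fun x => u x - w x) =ᵐ[Ω.freqVol d]
      fun ξ => Ω.fourier d u ξ - Ω.fourier d w ξ := by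
  have h := fourier_add_ae_eq (hu.sub hw) hw
  simp only [Pi.sub_apply, sub_add_cancel] at h
  filter_upwards [h] with ξ hξ
  rw [hξ]
  simp [Pi.sub_def]

lemma integrable_of_hsNorm_ne_top (hs : 0 ≤ s) {u : Ω.Pt d → ℝ} (hu : Ω.hsNorm d s u ≠ ∞) :
    Integrable (fun ξ => Ω.besselWeight d s ξ * ‖Ω.fourier d u ξ‖ ^ 2) (Ω.freqVol d) ∧
      ∫ ξ, Ω.besselWeight d s ξ * ‖Ω.fourier d u ξ‖ ^ 2 ∂Ω.freqVol d =
        (Ω.hsNorm d s u).toReal ^ 2 := by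
  have hu2 := (isDualNorm_hsNorm hs).memLp hu
  have hm : AEStronglyMeasurable (fun ξ => Ω.besselWeight d s ξ * ‖Ω.fourier d u ξ‖ ^ 2)
      (Ω.freqVol d) :=
    (Ω.measurable_besselWeight d s).aestronglyMeasurable.mul
      ((aestronglyMeasurable_fourier hu2).norm.pow 2)
  have hb : ∀ ξ, 0 ≤ Ω.besselWeight d s ξ := fun ξ =>
    zero_le_one.trans (Ω.one_le_besselWeight d hs ξ)
  have h0 : ∀ ξ, 0 ≤ Ω.besselWeight d s ξ * ‖Ω.fourier d u ξ‖ ^ 2 := fun ξ =>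
    mul_nonneg (hb ξ) (sq_nonneg _)
  have h1 : ∀ ξ, ENNReal.ofReal (Ω.besselWeight d s ξ * ‖Ω.fourier d u ξ‖ ^ 2) =
      ENNReal.ofReal (Ω.besselWeight d s ξ) * ‖Ω.fourier d u ξ‖ₑ ^ 2 := fun ξ => by
    rw [ENNReal.ofReal_mul (hb ξ), ENNReal.ofReal_pow (norm_nonneg _), ofReal_norm]
  have h2 := lintegral_ne_top_of_hsNorm_ne_top hu
  refine ⟨⟨hm, ?_⟩, ?_⟩
  · rw [hasFiniteIntegral_iff_ofReal (ae_of_all _ h0)]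
    simp only [h1]
    exact h2.lt_top
  · rw [integral_eq_lintegral_of_nonneg_ae (ae_of_all _ h0) hm]
    simp only [h1]
    rw [hsNorm, if_pos hu2, ← ENNReal.toReal_pow, rpow_half_sq]

/-- The polarization identity in `H^s`. -/
theorem hsInner_eq_polarization (hs : 0 ≤ s) {u w : Ω.Pt d → ℝ} (hu : Ω.hsNorm d s u ≠ ∞)
    (hw : Ω.hsNorm d s w ≠ ∞) :
    Ω.hsInner d s u w = ((Ω.hsNorm d s fun x => u x + w x).toReal ^ 2 -
      (Ω.hsNorm d s fun x => u x - w x).toReal ^ 2) / 4 := by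
  have hN := isDualNorm_hsNorm (d := d) (Ω := Ω) hs
  have hu2 := hN.memLp hu
  have hw2 := hN.memLp hw
  have ha : Ω.hsNorm d s (fun x => u x + w x) ≠ ∞ :=
    ne_top_of_le_ne_top (ENNReal.add_ne_top.2 ⟨hu, hw⟩) (hN.add_le u w)
  have hb : Ω.hsNorm d s (fun x => u x - w x) ≠ ∞ :=
    ne_top_of_le_ne_top (ENNReal.add_ne_top.2 ⟨hu, hw⟩) (hN.sub_le u w)
  obtain ⟨ha1, ha2⟩ := integrable_of_hsNorm_ne_top hs ha
  obtain ⟨hb1, hb2⟩ := integrable_of_hsNorm_ne_top hs hb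
  rw [← ha2, ← hb2, ← integral_sub ha1 hb1, ← integral_div, hsInner]
  refine integral_congr_ae ?_
  filter_upwards [fourier_add_ae_eq hu2 hw2, fourier_sub_ae_eq hu2 hw2] with ξ h1 h2
  rw [h1, h2, ← Complex.normSq_eq_norm_sq, ← Complex.normSq_eq_norm_sq, Complex.normSq_add,
    Complex.normSq_sub]
  ring

/-- The Cauchy–Schwarz inequality in `H^s`. -/
theorem enorm_hsInner_le (hs : 0 ≤ s) {u w : Ω.Pt d → ℝ} (hu : Ω.hsNorm d s u ≠ ∞)
    (hw : Ω.hsNorm d s w ≠ ∞) :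
    ‖Ω.hsInner d s u w‖ₑ ≤ Ω.hsNorm d s u * Ω.hsNorm d s w := by
  have hN := isDualNorm_hsNorm (d := d) (Ω := Ω) hs
  have hu2 := hN.memLp hu
  have hw2 := hN.memLp hw
  set β : Ω.Freq d → ℝ≥0∞ := fun ξ => ENNReal.ofReal √(Ω.besselWeight d s ξ) with hβdef
  have hb : ∀ ξ, 0 ≤ Ω.besselWeight d s ξ := fun ξ =>
    zero_le_one.trans (Ω.one_le_besselWeight d hs ξ)
  have hβ2 : ∀ ξ, ENNReal.ofReal (Ω.besselWeight d s ξ) = β ξ ^ 2 := fun ξ => by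
    rw [hβdef, ← ENNReal.ofReal_pow (by positivity), Real.sq_sqrt (hb ξ)]
  have hβm : Measurable β := (Ω.measurable_besselWeight d s).sqrt.ennreal_ofReal
  have h1 := lintegral_mul_le_sqrt_mul_sqrt
    (hβm.aemeasurable.mul (aestronglyMeasurable_fourier hu2).enorm)
    (hβm.aemeasurable.mul (aestronglyMeasurable_fourier hw2).enorm)
  simp only [mul_pow, ← hβ2, Pi.mul_apply] at h1
  rw [hsNorm, if_pos hu2, hsNorm, if_pos hw2]
  refine le_trans ?_ h1
  refine (enorm_integral_le_lintegral_enorm _).trans (lintegral_mono fun ξ => ?_)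
  rw [mul_mul_mul_comm, ← sq, ← hβ2, enorm_mul, Real.enorm_of_nonneg (hb ξ), ← enorm_mul]
  gcongr
  rw [← ofReal_norm, ← ofReal_norm]
  refine ENNReal.ofReal_le_ofReal ?_
  refine (Complex.abs_re_le_norm _).trans ?_
  simp

end SpatialDomain

/-! ### Collision integrals of functions of (x, v). -/

namespace Boltzmann

variable {d : ℕ} {X : Type*} [MeasurableSpace X] {μ : Measure X} [SFinite μ]
  {T : Vel d × Vel d × Sph d → Vel d × Vel d} {N : (X → ℝ) → ℝ≥0∞} {C : ℝ≥0∞} {f g : X → Vel d → ℝ}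

/-- The integrand `|v - v_*| f g` along a collision map. -/
def collIntegrand (T : Vel d × Vel d × Sph d → Vel d × Vel d) (f g : X → Vel d → ℝ) (x : X)
    (v : Vel d) (z : Vel d × Sph d) : ℝ :=
  ‖v - z.1‖ * (f x (T (v, z)).1 * g x (T (v, z)).2)

lemma aestronglyMeasurable_collIntegrand (hT : IsCollisionMap T)
    (hf : AEStronglyMeasurable (Function.uncurry f) (μ.prod volume))
    (hg : AEStronglyMeasurable (Function.uncurry g) (μ.prod volume)) :
    AEStronglyMeasurable (fun q : (X × Vel d) × Vel d × Sph d =>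
      collIntegrand T f g q.1.1 q.1.2 q.2) ((μ.prod volume).prod (collMeasure d)) := by
  have hassoc := (measurePreserving_prodAssoc μ (volume : Measure (Vel d))
    (collMeasure d)).quasiMeasurePreserving
  have h1 := hf.comp_quasiMeasurePreserving
    ((QuasiMeasurePreserving.prodMap (Measure.QuasiMeasurePreserving.id μ)
      hT.quasiMeasurePreserving_fst).comp hassoc)
  have h2 := hg.comp_quasiMeasurePreserving
    ((QuasiMeasurePreserving.prodMap (Measure.QuasiMeasurePreserving.id μ)
      hT.quasiMeasurePreserving_snd).comp hassoc)
  have h3 : AEStronglyMeasurable (fun q : (X × Vel d) × Vel d × Sph d => ‖q.1.2 - q.2.1‖)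
      ((μ.prod volume).prod (collMeasure d)) :=
    Measurable.aestronglyMeasurable (by fun_prop)
  exact h3.mul (h1.mul h2)

lemma ae_aestronglyMeasurable_collIntegrand (hT : IsCollisionMap T)
    (hf : AEStronglyMeasurable (Function.uncurry f) (μ.prod volume))
    (hg : AEStronglyMeasurable (Function.uncurry g) (μ.prod volume)) :
    ∀ᵐ v : Vel d, AEStronglyMeasurable (Function.uncurry fun x z => collIntegrand T f g x v z)
      (μ.prod (collMeasure d)) := by
  have h := aestronglyMeasurable_collIntegrand hT hf hg
  have hassoc := (measurePreserving_prodAssoc (volume : Measure (Vel d)) μ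
    (collMeasure d)).symm
  have h1 := h.comp_measurePreserving
    ((Measure.measurePreserving_swap.prod (MeasurePreserving.id (collMeasure d))).comp hassoc)
  exact h1.prodMk_left

/-- The norm in `x` of a collision integral is bounded by the collision integral of the norms. -/
lemma ae_integrable_and_norm_le (hN : IsDualNorm μ N) (hC : C ≠ ∞)
    (hmul : ∀ u w : X → ℝ, N (fun x => u x * w x) ≤ C * (N u * N w)) (hT : IsCollisionMap T)
    (hf : AEStronglyMeasurable (Function.uncurry f) (μ.prod volume))
    (hg : AEStronglyMeasurable (Function.uncurry g) (μ.prod volume))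
    (hfin : ∀ᵐ v : Vel d, collInt T (fun w => N fun x => f x w) (fun w => N fun x => g x w) v ≠ ∞) :
    ∀ᵐ v : Vel d, (∀ᵐ x ∂μ, Integrable (collIntegrand T f g x v) (collMeasure d)) ∧
      N (fun x => ∫ z, collIntegrand T f g x v z ∂collMeasure d) ≤
        C * collInt T (fun w => N fun x => f x w) (fun w => N fun x => g x w) v := by
  filter_upwards [ae_aestronglyMeasurable_collIntegrand hT hf hg, hfin] with v hv hvfin
  have h1 : ∫⁻ z, N (fun x => collIntegrand T f g x v z) ∂collMeasure d ≤
      C * collInt T (fun w => N fun x => f x w) (fun w => N fun x => g x w) v := by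
    rw [collInt, ← lintegral_const_mul' _ _ hC]
    refine lintegral_mono fun z => ?_
    have h2 : (fun x => collIntegrand T f g x v z) =
        fun x => (f x (T (v, z)).1 * g x (T (v, z)).2) * ‖v - z.1‖ := by
      funext x
      rw [collIntegrand, mul_comm]
    rw [h2, hN.mul_const (fun x => f x (T (v, z)).1 * g x (T (v, z)).2), enorm_norm,
      mul_left_comm, mul_comm ‖v - z.1‖ₑ]
    gcongr
    exact hmul _ _
  obtain ⟨h3, h4⟩ := hN.integral_le hv
    (ne_top_of_le_ne_top (ENNReal.mul_ne_top hC hvfin) h1)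
  exact ⟨h3, h4.trans h1⟩

/-- Iterated almost-everywhere statements combine on the product only for measurable properties.
Integrability is therefore read as finiteness of an almost everywhere measurable function of (x, v),
through its measurable representative. -/
lemma ae_prod_integrable (hT : IsCollisionMap T)
    (hf : AEStronglyMeasurable (Function.uncurry f) (μ.prod volume))
    (hg : AEStronglyMeasurable (Function.uncurry g) (μ.prod volume))
    (h : ∀ᵐ v : Vel d, ∀ᵐ x ∂μ, Integrable (collIntegrand T f g x v) (collMeasure d)) :
    ∀ᵐ z ∂μ.prod (volume : Measure (Vel d)),
      Integrable (collIntegrand T f g z.1 z.2) (collMeasure d) := by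
  have hm := aestronglyMeasurable_collIntegrand hT hf hg
  have hJ : AEMeasurable (fun y : X × Vel d =>
      ∫⁻ z, ‖collIntegrand T f g y.1 y.2 z‖ₑ ∂collMeasure d) (μ.prod volume) :=
    hm.enorm.lintegral_prod_right'
  have hJs := hJ.ae_eq_mk
  have hswap : ∀ᵐ v : Vel d, ∀ᵐ x ∂μ,
      ∫⁻ z, ‖collIntegrand T f g x v z‖ₑ ∂collMeasure d = hJ.mk _ (x, v) :=
    Measure.ae_ae_of_ae_prod ((Measure.measurePreserving_swap
      (μ := (volume : Measure (Vel d))) (ν := μ)).quasiMeasurePreserving.ae hJs)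
  have h1 : ∀ᵐ z ∂(volume : Measure (Vel d)).prod μ, hJ.mk _ z.swap < ∞ := by
    refine (Measure.ae_prod_iff_ae_ae (p := fun z : Vel d × X => hJ.mk _ z.swap < ∞)
      (measurableSet_lt (hJ.measurable_mk.comp measurable_swap) measurable_const)).2 ?_
    filter_upwards [h, hswap] with v hv1 hv2
    filter_upwards [hv1, hv2] with x hx1 hx2
    rw [Prod.swap_prod_mk, ← hx2]
    exact hx1.2
  have h2 : ∀ᵐ z ∂μ.prod (volume : Measure (Vel d)), hJ.mk _ z < ∞ := by
    have h3 := (Measure.measurePreserving_swap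
      (μ := μ) (ν := (volume : Measure (Vel d)))).quasiMeasurePreserving.ae h1
    simpa using h3
  filter_upwards [hm.prodMk_left, hJs, h2] with z hz1 hz2 hz3
  refine ⟨hz1, ?_⟩
  rw [HasFiniteIntegral, hz2]
  exact hz3

lemma aestronglyMeasurable_integral_collIntegrand (hT : IsCollisionMap T)
    (hf : AEStronglyMeasurable (Function.uncurry f) (μ.prod volume))
    (hg : AEStronglyMeasurable (Function.uncurry g) (μ.prod volume)) :
    AEStronglyMeasurable (Function.uncurry fun x v => ∫ z, collIntegrand T f g x v z ∂collMeasure d)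
      (μ.prod volume) :=
  (aestronglyMeasurable_collIntegrand hT hf hg).integral_prod_right'

lemma ae_ne_top_of_eLpNorm_ne_top {Y : Type*} [MeasurableSpace Y] {ρ : Measure Y} {p : ℝ≥0∞}
    (hp : p ≠ 0) {F : Y → ℝ≥0∞} (hF : AEMeasurable F ρ) (h : eLpNorm F p ρ ≠ ∞) :
    ∀ᵐ y ∂ρ, F y ≠ ∞ := by
  rcases eq_or_ne p ∞ with rfl | hp'
  · rw [eLpNorm_exponent_top] at h
    filter_upwards [ae_le_eLpNormEssSup (f := F) (μ := ρ)] with y hy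
    exact ne_top_of_le_ne_top h hy
  · have hp0 := ENNReal.toReal_pos hp hp'
    rw [eLpNorm_eq_lintegral_rpow_enorm_toReal hp hp'] at h
    have h2 : ∫⁻ y, F y ^ p.toReal ∂ρ ≠ ∞ := by
      intro h3
      simp only [enorm_eq_self, h3] at h
      exact h (ENNReal.top_rpow_of_pos (by positivity))
    filter_upwards [ae_lt_top' (hF.pow_const _) h2] with y hy h3
    rw [h3, ENNReal.top_rpow_of_pos hp0] at hy
    exact hy.ne rfl

end Boltzmann

/-! ### From the scalar estimate to the weighted norms. -/

namespace Boltzmann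

variable {d : ℕ} {Ω : SpatialDomain} {s : ℝ} {p p' : ℝ≥0∞} {α : ℝ}

lemma polyNorm_eq (hs : 0 ≤ s) (f : Ω.Pt d → Vel d → ℝ) :
    polyNorm d Ω s p α f =
      eLpNorm (fun v => Ω.hsNorm d s (fun x => f x v) * wt α v) p volume := by
  rw [polyNorm, lpHsNorm]
  congr 1
  funext v
  rw [(SpatialDomain.isDualNorm_hsNorm hs).mul_const (fun x => f x v),
    Real.enorm_of_nonneg (Real.rpow_nonneg (bracket_pos v).le _)]
  rfl

/-- The bound c⟨v⟩ ≤ ν raised to the power 1/p; for p = ∞ both powers are trivial. -/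
lemma exists_eLpNorm_wt_add_le (hd : 0 < d) (Ω : SpatialDomain) (hs : 0 ≤ s) (p : ℝ≥0∞) (α : ℝ) :
    ∃ c : NNReal, ∀ f : Ω.Pt d → Vel d → ℝ,
      eLpNorm (fun v => Ω.hsNorm d s (fun x => f x v) * wt (α + (p⁻¹).toReal) v) p volume ≤
        c * polyNormNu d Ω s p α f := by
  obtain ⟨c, hc, hν⟩ := exists_mul_bracket_le_collFreq hd
  set r : ℝ := (p⁻¹).toReal with hr
  have hr0 : 0 ≤ r := ENNReal.toReal_nonneg
  refine ⟨(c ^ (-r)).toNNReal, fun f => ?_⟩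
  rw [polyNormNu, polyNorm_eq hs, ← smul_eq_mul]
  refine eLpNorm_le_nnreal_smul_eLpNorm_of_ae_le_mul' (ae_of_all _ fun v => ?_) p
  simp only [enorm_eq_self]
  rw [(SpatialDomain.isDualNorm_hsNorm hs).mul_const (fun x => f x v), wt_add,
    Real.enorm_of_nonneg (Real.rpow_nonneg (collFreq_nonneg v) _)]
  have h1 : wt r v ≤ ((c ^ (-r)).toNNReal : ℝ≥0∞) * ENNReal.ofReal (collFreq v ^ r) := by
    rw [wt, ← ENNReal.ofReal, ← ENNReal.ofReal_mul (by positivity)]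
    refine ENNReal.ofReal_le_ofReal ?_
    calc bracket v ^ r = c ^ (-r) * (c * bracket v) ^ r := by
          rw [Real.mul_rpow hc.le (bracket_pos v).le, ← mul_assoc, ← Real.rpow_add hc]
          simp
      _ ≤ _ := by
          gcongr
          · exact mul_nonneg hc.le (bracket_pos v).le
          · exact hν v
  calc Ω.hsNorm d s (fun x => f x v) * (wt α v * wt r v)
      ≤ Ω.hsNorm d s (fun x => f x v) * (wt α v *
        (((c ^ (-r)).toNNReal : ℝ≥0∞) * ENNReal.ofReal (collFreq v ^ r))) := by gcongr
    _ = _ := by ring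

lemma ae_ne_top_of_eLpNorm_mul_wt_ne_top (hp : p ≠ 0) {F : Vel d → ℝ≥0∞} (hF : AEMeasurable F)
    (h : eLpNorm (fun v => F v * wt α v) p volume ≠ ∞) : ∀ᵐ v, F v ≠ ∞ := by
  filter_upwards [ae_ne_top_of_eLpNorm_ne_top hp
    (hF.mul (measurable_wt α).aemeasurable) h] with v hv h2
  exact hv (by simp [h2, ENNReal.top_mul (wt_ne_zero α v)])

lemma aemeasurable_collInt {T : Vel d × Vel d × Sph d → Vel d × Vel d} (hT : IsCollisionMap T)
    {φ ψ : Vel d → ℝ≥0∞} (hφ : AEMeasurable φ) (hψ : AEMeasurable ψ) :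
    AEMeasurable (collInt T φ ψ) :=
  ⟨_, measurable_collInt hT hφ.measurable_mk hψ.measurable_mk,
    collInt_congr_ae hT hφ.ae_eq_mk hψ.ae_eq_mk⟩

/-- The bound of a collision integral of the norms in `x` by the polynomially weighted norms. -/
lemma exists_eLpNorm_collInt_hsNorm_le (hd : 0 < d) (Ω : SpatialDomain) (hs : 0 ≤ s)
    (hpp' : ENNReal.HolderConjugate p p') (hα : 2 + (d : ℝ) * (p'⁻¹).toReal < α)
    {T : Vel d × Vel d × Sph d → Vel d × Vel d} (hT : IsCollisionMap T) :
    ∃ K : ℝ≥0∞, K ≠ ∞ ∧ ∀ f g : Ω.Pt d → Vel d → ℝ,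
      JointlyMeasurable d Ω f → JointlyMeasurable d Ω g →
      eLpNorm (fun v => collInt T (fun w => Ω.hsNorm d s fun x => f x w)
        (fun w => Ω.hsNorm d s fun x => g x w) v * wt (α - (p'⁻¹).toReal) v) p volume ≤
      K * (polyNorm d Ω s p α f * polyNormNu d Ω s p α g +
        polyNormNu d Ω s p α f * polyNorm d Ω s p α g) := by
  obtain ⟨C, hC, hle⟩ := eLpNorm_collInt_le hT hpp' hα
  obtain ⟨c, hc⟩ := exists_eLpNorm_wt_add_le (s := s) hd Ω hs p α
  have hN := SpatialDomain.isDualNorm_hsNorm (d := d) (Ω := Ω) hs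
  refine ⟨C * c, ENNReal.mul_ne_top hC.ne ENNReal.coe_ne_top, fun f g hf hg => ?_⟩
  refine (hle _ _ (hN.aemeasurable hf) (hN.aemeasurable hg)).trans ?_
  rw [mul_assoc C, polyNorm_eq hs, polyNorm_eq hs]
  gcongr
  rw [mul_add, mul_left_comm, ← mul_assoc (c : ℝ≥0∞)]
  exact add_le_add (mul_le_mul_right (hc g) _) (mul_le_mul_left (hc f) _)

lemma MemPolyNu.prod_ne_top {f g : Ω.Pt d → Vel d → ℝ} (hf : MemPolyNu d Ω s p α f)
    (hg : MemPolyNu d Ω s p α g) :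
    polyNorm d Ω s p α f * polyNormNu d Ω s p α g +
      polyNormNu d Ω s p α f * polyNorm d Ω s p α g ≠ ∞ :=
  ENNReal.add_ne_top.2 ⟨ENNReal.mul_ne_top hf.2.1.ne hg.2.2.ne,
    ENNReal.mul_ne_top hf.2.2.ne hg.2.1.ne⟩

/-- One of the four terms of the collision operator: convergence, measurability and the bound. -/
lemma exists_collision_term_bound (hd : 0 < d) (Ω : SpatialDomain) (hs : (d : ℝ) / 2 < s)
    (hpp' : ENNReal.HolderConjugate p p') (hα : 2 + (d : ℝ) * (p'⁻¹).toReal < α)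
    {T : Vel d × Vel d × Sph d → Vel d × Vel d} (hT : IsCollisionMap T) :
    ∃ K : ℝ≥0∞, K ≠ ∞ ∧ ∀ f g : Ω.Pt d → Vel d → ℝ,
      MemPolyNu d Ω s p α f → MemPolyNu d Ω s p α g →
      (∀ᵐ z ∂(Ω.vol d).prod (volume : Measure (Vel d)),
        Integrable (collIntegrand T f g z.1 z.2) (collMeasure d)) ∧
      JointlyMeasurable d Ω (fun x v => ∫ z, collIntegrand T f g x v z ∂collMeasure d) ∧
      polyNorm d Ω s p (α - (p'⁻¹).toReal)
        (fun x v => ∫ z, collIntegrand T f g x v z ∂collMeasure d) ≤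
      K * (polyNorm d Ω s p α f * polyNormNu d Ω s p α g +
        polyNormNu d Ω s p α f * polyNorm d Ω s p α g) := by
  have hd' : (0 : ℝ) < d := by exact_mod_cast hd
  have hs0 : 0 ≤ s := by linarith [half_pos hd']
  obtain ⟨C, hC, hmul⟩ := SpatialDomain.exists_hsNorm_mul_le hd Ω hs
  obtain ⟨K, hK, hle⟩ := exists_eLpNorm_collInt_hsNorm_le (s := s) hd Ω hs0 hpp' hα hT
  have hN := SpatialDomain.isDualNorm_hsNorm (d := d) (Ω := Ω) hs0
  have hp0 : p ≠ 0 := hpp'.ne_zero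
  refine ⟨C * K, ENNReal.mul_ne_top hC hK, fun f g hf hg => ?_⟩
  have h1 := hle f g hf.1 hg.1
  have hmeas := aemeasurable_collInt hT (hN.aemeasurable hf.1) (hN.aemeasurable hg.1)
  have h2 := ae_ne_top_of_eLpNorm_mul_wt_ne_top hp0 hmeas
    (ne_top_of_le_ne_top (ENNReal.mul_ne_top hK (hf.prod_ne_top hg)) h1)
  have h3 := ae_integrable_and_norm_le hN hC hmul hT hf.1 hg.1 h2
  refine ⟨ae_prod_integrable hT hf.1 hg.1 (h3.mono fun v hv => hv.1),
    aestronglyMeasurable_integral_collIntegrand hT hf.1 hg.1, ?_⟩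
  rw [polyNorm_eq hs0, mul_assoc]
  lift C to NNReal using hC
  refine le_trans ?_ (mul_le_mul_right h1 _)
  rw [← smul_eq_mul]
  refine eLpNorm_le_nnreal_smul_eLpNorm_of_ae_le_mul' (h3.mono fun v hv => ?_) p
  simp only [enorm_eq_self]
  rw [← mul_assoc]
  exact mul_le_mul_left hv.2 _

lemma polyNorm_add_le (hs : 0 ≤ s) (hp : 1 ≤ p) {f g : Ω.Pt d → Vel d → ℝ}
    (hf : JointlyMeasurable d Ω f) (hg : JointlyMeasurable d Ω g) :
    polyNorm d Ω s p α (fun x v => f x v + g x v) ≤ polyNorm d Ω s p α f + polyNorm d Ω s p α g := by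
  have hN := SpatialDomain.isDualNorm_hsNorm (d := d) (Ω := Ω) hs
  rw [polyNorm_eq hs, polyNorm_eq hs, polyNorm_eq hs]
  refine le_trans ?_ (eLpNorm_add_le
    ((hN.aemeasurable hf).mul (measurable_wt α).aemeasurable).aestronglyMeasurable
    ((hN.aemeasurable hg).mul (measurable_wt α).aemeasurable).aestronglyMeasurable hp)
  refine eLpNorm_mono_enorm fun v => ?_
  simp only [enorm_eq_self, Pi.add_apply]
  rw [← add_mul]
  exact mul_le_mul_left (hN.add_le _ _) _

lemma polyNorm_mul_const (hs : 0 ≤ s) (f : Ω.Pt d → Vel d → ℝ) (c : ℝ) :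
    polyNorm d Ω s p α (fun x v => f x v * c) ≤ ‖c‖ₑ * polyNorm d Ω s p α f := by
  have hN := SpatialDomain.isDualNorm_hsNorm (d := d) (Ω := Ω) hs
  rw [polyNorm_eq hs, polyNorm_eq hs]
  refine eLpNorm_le_nnreal_smul_eLpNorm_of_ae_le_mul' (c := ‖c‖₊) (ae_of_all _ fun v => ?_) p
  simp only [enorm_eq_self]
  rw [hN.mul_const (fun x => f x v), mul_right_comm, mul_comm]
  rfl

end Boltzmann

/-! ### The collision operator and the duality pairing. -/

namespace Boltzmann

variable {d : ℕ} {Ω : SpatialDomain} {s : ℝ} {p p' : ℝ≥0∞} {α : ℝ}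

lemma Q_eq (f g : Ω.Pt d → Vel d → ℝ) :
    Q f g = fun x v =>
      (∫ z, collIntegrand collMap f g x v z ∂collMeasure d) * (1 / 2) +
      (∫ z, collIntegrand lossMap f g x v z ∂collMeasure d) * (-1 / 2) +
      ((∫ z, collIntegrand collMap g f x v z ∂collMeasure d) * (1 / 2) +
      (∫ z, collIntegrand lossMap g f x v z ∂collMeasure d) * (-1 / 2)) := by
  funext x v
  change (1 / 2) * (Qgain (f x) (g x) v - Qloss (f x) (g x) v + Qgain (g x) (f x) v -
    Qloss (g x) (f x) v) = Qgain (f x) (g x) v * (1 / 2) + Qloss (f x) (g x) v * (-1 / 2) +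
    (Qgain (g x) (f x) v * (1 / 2) + Qloss (g x) (f x) v * (-1 / 2))
  ring

/-- Convergence, measurability and the norm bound of the collision operator. -/
theorem exists_polyNorm_Q_le (hd : 0 < d) (Ω : SpatialDomain) (hs : (d : ℝ) / 2 < s)
    (hpp' : ENNReal.HolderConjugate p p') (hα : 2 + (d : ℝ) * (p'⁻¹).toReal < α) :
    ∃ K : ℝ≥0∞, K ≠ ∞ ∧ ∀ f g : Ω.Pt d → Vel d → ℝ,
      MemPolyNu d Ω s p α f → MemPolyNu d Ω s p α g →
      (∀ᵐ z ∂(Ω.vol d).prod (volume : Measure (Vel d)), QConverges (f z.1) (g z.1) z.2) ∧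
      JointlyMeasurable d Ω (Q f g) ∧
      polyNorm d Ω s p (α - (p'⁻¹).toReal) (Q f g) ≤
      K * (polyNorm d Ω s p α f * polyNormNu d Ω s p α g +
        polyNormNu d Ω s p α f * polyNorm d Ω s p α g) := by
  have hd' : (0 : ℝ) < d := by exact_mod_cast hd
  have hs0 : 0 ≤ s := by linarith [half_pos hd']
  obtain ⟨K₁, hK₁, h1⟩ := exists_collision_term_bound hd Ω hs hpp' hα (isCollisionMap_collMap hd)
  obtain ⟨K₂, hK₂, h2⟩ := exists_collision_term_bound hd Ω hs hpp' hα
    (isCollisionMap_lossMap (d := d))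
  -- Two gain and two loss terms; their coefficients ±1/2 are simply bounded by 1.
  refine ⟨K₁ + K₂ + (K₁ + K₂), by simp [hK₁, hK₂], fun f g hf hg => ?_⟩
  obtain ⟨a1, a2, a3⟩ := h1 f g hf hg
  obtain ⟨b1, b2, b3⟩ := h2 f g hf hg
  obtain ⟨c1, c2, c3⟩ := h1 g f hg hf
  obtain ⟨e1, e2, e3⟩ := h2 g f hg hf
  set P := polyNorm d Ω s p α f * polyNormNu d Ω s p α g +
    polyNormNu d Ω s p α f * polyNorm d Ω s p α g with hP
  -- The right side is symmetric in f and g, so the terms with exchanged arguments share it.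
  have hPs : polyNorm d Ω s p α g * polyNormNu d Ω s p α f +
      polyNormNu d Ω s p α g * polyNorm d Ω s p α f = P := by
    rw [hP]; ring
  rw [hPs] at c3 e3
  have hmc : ∀ {F : Ω.Pt d → Vel d → ℝ} (c : ℝ), JointlyMeasurable d Ω F →
      JointlyMeasurable d Ω fun x v => F x v * c := fun c hF => hF.mul_const c
  have hma : ∀ {F G : Ω.Pt d → Vel d → ℝ}, JointlyMeasurable d Ω F → JointlyMeasurable d Ω G →
      JointlyMeasurable d Ω fun x v => F x v + G x v := fun hF hG => hF.add hG
  have hc : ∀ {F : Ω.Pt d → Vel d → ℝ} {K : ℝ≥0∞} {c : ℝ}, |c| ≤ 1 →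
      polyNorm d Ω s p (α - (p'⁻¹).toReal) F ≤ K * P →
      polyNorm d Ω s p (α - (p'⁻¹).toReal) (fun x v => F x v * c) ≤ K * P := by
    intro F K c hc hF
    refine (polyNorm_mul_const hs0 F c).trans ((mul_le_of_le_one_left zero_le ?_).trans hF)
    rw [← ofReal_norm, ← ENNReal.ofReal_one]
    exact ENNReal.ofReal_le_ofReal hc
  have hp1 : |(1 / 2 : ℝ)| ≤ 1 := by rw [abs_of_pos] <;> norm_num
  have hm1 : |(-1 / 2 : ℝ)| ≤ 1 := by rw [abs_of_neg] <;> norm_num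
  rw [Q_eq]
  refine ⟨?_, hma (hma (hmc _ a2) (hmc _ b2)) (hma (hmc _ c2) (hmc _ e2)), ?_⟩
  · filter_upwards [a1, b1, c1, e1] with z ha hb hc he
    exact ⟨ha, hb, hc, he⟩
  · have hp := hpp'.one_le
    refine (polyNorm_add_le hs0 hp (hma (hmc _ a2) (hmc _ b2))
      (hma (hmc _ c2) (hmc _ e2))).trans ?_
    rw [add_mul, add_mul]
    exact add_le_add
      ((polyNorm_add_le hs0 hp (hmc _ a2) (hmc _ b2)).trans (add_le_add (hc hp1 a3) (hc hm1 b3)))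
      ((polyNorm_add_le hs0 hp (hmc _ c2) (hmc _ e2)).trans (add_le_add (hc hp1 c3) (hc hm1 e3)))

/-- Cauchy–Schwarz supplies one more power of ‖h‖. Where ‖h‖ = 0 the inner product vanishes, so the
value of 0^{p-2} is immaterial, also for p = 2 where it is 1. -/
lemma enorm_dualIntegrand_le (hs : 0 ≤ s) {q h : Ω.Pt d → Vel d → ℝ} {v : Vel d}
    (hq : Ω.hsNorm d s (fun x => q x v) ≠ ∞) (hh : Ω.hsNorm d s (fun x => h x v) ≠ ∞) :
    ‖dualIntegrand d Ω s p α q h v‖ₑ ≤ Ω.hsNorm d s (fun x => q x v) *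
      Ω.hsNorm d s (fun x => h x v) ^ (p.toReal - 1) * wt (p.toReal * α) v := by
  have hcs := SpatialDomain.enorm_hsInner_le hs hq hh
  rw [dualIntegrand, enorm_mul, enorm_mul,
    Real.enorm_of_nonneg (Real.rpow_nonneg (bracket_pos v).le _)]
  refine mul_le_mul_left ?_ _
  rcases eq_or_ne (Ω.hsNorm d s fun x => h x v) 0 with h0 | h0
  · rw [h0, mul_zero, nonpos_iff_eq_zero] at hcs
    rw [hcs, zero_mul]
    exact zero_le
  · have hpos := ENNReal.toReal_pos h0 hh
    rw [Real.enorm_of_nonneg (Real.rpow_nonneg hpos.le _), ← ENNReal.ofReal_rpow_of_pos hpos,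
      ENNReal.ofReal_toReal hh]
    refine (mul_le_mul_left hcs _).trans (le_of_eq ?_)
    rw [mul_assoc, show p.toReal - 1 = 1 + (p.toReal - 2) by ring, ENNReal.rpow_add _ _ h0 hh,
      ENNReal.rpow_one]

/-- Polarization reduces the inner product to the norms of q + h and q - h, whose measurability in v
is known. -/
lemma aemeasurable_dualIntegrand (hs : 0 ≤ s) {q h : Ω.Pt d → Vel d → ℝ}
    (hqm : JointlyMeasurable d Ω q) (hhm : JointlyMeasurable d Ω h)
    (hq : ∀ᵐ v, Ω.hsNorm d s (fun x => q x v) ≠ ∞) (hh : ∀ᵐ v, Ω.hsNorm d s (fun x => h x v) ≠ ∞) :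
    AEMeasurable (dualIntegrand d Ω s p α q h) := by
  have hN := SpatialDomain.isDualNorm_hsNorm (d := d) (Ω := Ω) hs
  have h1 := (hN.aemeasurable (f := fun x v => q x v + h x v) (hqm.add hhm)).ennreal_toReal
  have h2 := (hN.aemeasurable (f := fun x v => q x v - h x v) (hqm.sub hhm)).ennreal_toReal
  have h3 := (hN.aemeasurable hhm).ennreal_toReal
  have h4 := measurable_bracket (d := d)
  have h5 : AEMeasurable (fun v => Ω.hsInner d s (fun x => q x v) fun x => h x v) := by
    refine (((h1.pow_const 2).sub (h2.pow_const 2)).div_const 4).congr ?_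
    filter_upwards [hq, hh] with v hv1 hv2
    exact (SpatialDomain.hsInner_eq_polarization hs hv1 hv2).symm
  exact (h5.mul (h3.pow_const _)).mul (h4.pow_const _).aemeasurable

/-- Hölder's inequality in the form used for the duality pairing. -/
lemma lintegral_mul_rpow_wt_le (hpp' : ENNReal.HolderConjugate p p') (hp : p ≠ ∞)
    {A B : Vel d → ℝ≥0∞} (hA : AEMeasurable A) (hB : AEMeasurable B) :
    ∫⁻ v, A v * B v ^ (p.toReal - 1) * wt (p.toReal * α) v ≤
      eLpNorm (fun v => A v * wt (α - (p'⁻¹).toReal) v) p volume *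
        eLpNorm (fun v => B v * wt (α + (p⁻¹).toReal) v) p volume ^ (p.toReal - 1) := by
  have hp0 : p ≠ 0 := hpp'.ne_zero
  have hp1 : 1 ≤ p.toReal := by
    have := ENNReal.toReal_mono hp hpp'.one_le
    simpa using this
  have hpos : 0 < p.toReal := by linarith
  have hsum : (p⁻¹).toReal + (p'⁻¹).toReal = 1 := by
    rw [← ENNReal.toReal_add (by simp [hp0]) (by simp [hpp'.symm.ne_zero]),
      hpp'.inv_add_inv_eq_one, ENNReal.toReal_one]
  have hinv : p.toReal * (p⁻¹).toReal = 1 := by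
    rw [ENNReal.toReal_inv, mul_inv_cancel₀ hpos.ne']
  set a : Vel d → ℝ≥0∞ := fun v => A v * wt (α - (p'⁻¹).toReal) v with ha
  set b : Vel d → ℝ≥0∞ := fun v => B v * wt (α + (p⁻¹).toReal) v with hb
  have ham : AEMeasurable a := hA.mul (measurable_wt _).aemeasurable
  have hbm : AEMeasurable b := hB.mul (measurable_wt _).aemeasurable
  -- The weights match: pα = (α - 1/p') + (p - 1)(α + 1/p), because (p - 1)/p = 1/p'.
  have h1 : ∀ v, A v * B v ^ (p.toReal - 1) * wt (p.toReal * α) v =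
      a v * b v ^ (p.toReal - 1) := fun v => by
    rw [ha, hb]
    simp only
    rw [ENNReal.mul_rpow_of_nonneg _ _ (by linarith), wt_rpow, mul_mul_mul_comm, ← wt_add]
    congr 2
    linear_combination hsum - hinv
  simp only [h1]
  rw [eLpNorm_eq_lintegral_rpow hp0 hp, eLpNorm_eq_lintegral_rpow hp0 hp]
  -- For p = 1 the power of B is zero and both sides agree; Hölder's inequality is used only for p >
  -- 1.
  rcases hp1.eq_or_lt with h | h
  · simp [← h]
  · have hc := Real.HolderConjugate.conjExponent h
    have h2 := ENNReal.lintegral_mul_le_Lp_mul_Lq volume hc ham (hbm.pow_const (p.toReal - 1))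
    refine h2.trans (le_of_eq ?_)
    rw [one_div]
    congr 1
    have h3 : (p.toReal - 1) * Real.conjExponent p.toReal = p.toReal := by
      rw [Real.conjExponent, mul_div_cancel₀ _ (by linarith)]
    simp only [← ENNReal.rpow_mul, h3]
    congr 1
    rw [Real.conjExponent]
    field_simp

end Boltzmann

end

/-! ### Conclusion: one constant for the norm bound and the dual bound. -/

theorem mainTheorem2 (d : ℕ) (hd : d = 2 ∨ d = 3) (Ω : SpatialDomain)
    (s : ℝ) (hs : (d : ℝ) / 2 < s)
    (p p' : ℝ≥0∞) (hpp' : ENNReal.HolderConjugate p p')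
    (α : ℝ) (hα : 2 + (d : ℝ) * (p'⁻¹).toReal < α) :
    ∃ C : ℝ, 0 < C ∧
      ∀ f g : Ω.Pt d → Boltzmann.Vel d → ℝ,
        Boltzmann.MemPolyNu d Ω s p α f → Boltzmann.MemPolyNu d Ω s p α g →
        -- `Q(f, g)` is well defined almost everywhere, and measurable
        (∀ᵐ z ∂((Ω.vol d).prod (volume : Measure (Boltzmann.Vel d))),
          Boltzmann.QConverges (f z.1) (g z.1) z.2) ∧
        Boltzmann.JointlyMeasurable d Ω (Boltzmann.Q f g) ∧
        -- the norm bound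
        Boltzmann.polyNorm d Ω s p (α - (p'⁻¹).toReal) (Boltzmann.Q f g) ≤
          ENNReal.ofReal C *
            (Boltzmann.polyNorm d Ω s p α f * Boltzmann.polyNormNu d Ω s p α g
              + Boltzmann.polyNormNu d Ω s p α f * Boltzmann.polyNorm d Ω s p α g) ∧
        -- the dual bound
        (p ≠ ∞ → ∀ h : Ω.Pt d → Boltzmann.Vel d → ℝ, Boltzmann.MemPolyNu d Ω s p α h →
          Integrable (Boltzmann.dualIntegrand d Ω s p α (Boltzmann.Q f g) h) volume ∧
          ∫ v, Boltzmann.dualIntegrand d Ω s p α (Boltzmann.Q f g) h v ≤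
            C * ((Boltzmann.polyNorm d Ω s p α f).toReal
                    * (Boltzmann.polyNormNu d Ω s p α g).toReal
                  + (Boltzmann.polyNormNu d Ω s p α f).toReal
                    * (Boltzmann.polyNorm d Ω s p α g).toReal)
              * (Boltzmann.polyNormNu d Ω s p α h).toReal ^ (p.toReal - 1)) := by
  have hd0 : 0 < d := by omega
  have hd' : (0 : ℝ) < d := by exact_mod_cast hd0
  have hs0 : 0 ≤ s := by linarith [half_pos hd']
  have hp0 : p ≠ 0 := hpp'.ne_zero
  have hN := SpatialDomain.isDualNorm_hsNorm (d := d) (Ω := Ω) hs0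
  obtain ⟨K, hK, hQ⟩ := Boltzmann.exists_polyNorm_Q_le hd0 Ω hs hpp' hα
  obtain ⟨c, hc⟩ := Boltzmann.exists_eLpNorm_wt_add_le (s := s) hd0 Ω hs0 p α
  have hcr : 0 ≤ (c : ℝ) ^ (p.toReal - 1) := by positivity
  -- The constant dominates K, needed for the norm bound, and K c^{p-1}, needed for the dual bound,
  -- where c compares ⟨v⟩^{1/p} with ν^{1/p}; adding 1 makes it positive.
  refine ⟨K.toReal * (1 + (c : ℝ) ^ (p.toReal - 1)) + 1, by positivity, fun f g hf hg => ?_⟩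
  set C : ℝ := K.toReal * (1 + (c : ℝ) ^ (p.toReal - 1)) + 1 with hCdef
  have hC0 : 0 ≤ C := by positivity
  obtain ⟨h1, h2, h3⟩ := hQ f g hf hg
  have hfin := hf.prod_ne_top hg
  refine ⟨h1, h2, h3.trans ?_, fun hp h hh => ?_⟩
  · gcongr
    rw [← ENNReal.ofReal_toReal hK]
    refine ENNReal.ofReal_le_ofReal ?_
    rw [hCdef]
    nlinarith [mul_nonneg (ENNReal.toReal_nonneg (a := K)) hcr]
  have hp1 : 1 ≤ p.toReal := by
    have := ENNReal.toReal_mono hp hpp'.one_le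
    simpa using this
  have hQfin := ne_top_of_le_ne_top (ENNReal.mul_ne_top hK hfin) h3
  have hqm := hN.aemeasurable h2
  have hhm := hN.aemeasurable hh.1
  have hq := Boltzmann.ae_ne_top_of_eLpNorm_mul_wt_ne_top hp0 hqm
    (by rwa [Boltzmann.polyNorm_eq hs0] at hQfin)
  have hhn := Boltzmann.ae_ne_top_of_eLpNorm_mul_wt_ne_top hp0 hhm
    (by have := hh.2.1.ne; rwa [Boltzmann.polyNorm_eq hs0] at this)
  set P := Boltzmann.polyNorm d Ω s p α f * Boltzmann.polyNormNu d Ω s p α g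
    + Boltzmann.polyNormNu d Ω s p α f * Boltzmann.polyNorm d Ω s p α g with hP
  -- A finite bound in [0, ∞] on the integral of the modulus gives both the integrability and, after
  -- `toReal`, the inequality.
  have hbound : ∫⁻ v, ‖Boltzmann.dualIntegrand d Ω s p α (Boltzmann.Q f g) h v‖ₑ ≤
      K * P * (c * Boltzmann.polyNormNu d Ω s p α h) ^ (p.toReal - 1) := by
    refine (lintegral_mono_ae ?_).trans
      ((Boltzmann.lintegral_mul_rpow_wt_le (α := α) hpp' hp hqm hhm).trans ?_)
    · filter_upwards [hq, hhn] with v hv1 hv2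
      exact Boltzmann.enorm_dualIntegrand_le hs0 hv1 hv2
    · rw [← Boltzmann.polyNorm_eq hs0]
      exact mul_le_mul' h3 (ENNReal.rpow_le_rpow (hc h) (by linarith))
  have hbfin : K * P * (c * Boltzmann.polyNormNu d Ω s p α h) ^ (p.toReal - 1) ≠ ∞ :=
    ENNReal.mul_ne_top (ENNReal.mul_ne_top hK hfin) (ENNReal.rpow_ne_top_of_nonneg (by linarith)
      (ENNReal.mul_ne_top ENNReal.coe_ne_top hh.2.2.ne))
  refine ⟨⟨(Boltzmann.aemeasurable_dualIntegrand hs0 h2 hh.1 hq hhn).aestronglyMeasurable,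
    hbound.trans_lt hbfin.lt_top⟩, ?_⟩
  have h4 : ∫ v, Boltzmann.dualIntegrand d Ω s p α (Boltzmann.Q f g) h v ≤
      (K * P * (c * Boltzmann.polyNormNu d Ω s p α h) ^ (p.toReal - 1)).toReal := by
    refine (Real.le_norm_self _).trans ?_
    rw [← toReal_enorm]
    exact ENNReal.toReal_mono hbfin ((enorm_integral_le_lintegral_enorm _).trans hbound)
  refine h4.trans ?_
  rw [ENNReal.toReal_mul, ENNReal.toReal_mul, ← ENNReal.toReal_rpow, ENNReal.toReal_mul,
    ENNReal.coe_toReal, Real.mul_rpow c.coe_nonneg ENNReal.toReal_nonneg, hP,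
    ENNReal.toReal_add (ENNReal.mul_ne_top hf.2.1.ne hg.2.2.ne)
      (ENNReal.mul_ne_top hf.2.2.ne hg.2.1.ne), ENNReal.toReal_mul, ENNReal.toReal_mul,
    ← mul_assoc, mul_right_comm K.toReal]
  refine mul_le_mul_of_nonneg_right (mul_le_mul_of_nonneg_right ?_ (by positivity)) (by positivity)
  rw [hCdef]
  nlinarith [ENNReal.toReal_nonneg (a := K)]
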